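/- **Setting.** Let $d\ge 1$ be an integer and let $(p,\lambda)\in\Gamma:=\{(p,\lambda): p>1,\ \lambda>p-1\}\cup\{(1,\lambda):\lambda\ge 0\}$. Write $m_n$ for Lebesgue measure on $\mathbb R^n$, and let $\mathbb R^{d+1}_+=\{x\in\mathbb R^{d+1}: x_{d+1}>0\}$. *Weighted Sobolev space.* Let $\omega(x)=x_{d+1}^{p-1}\log^\lambda\frac{4}{x_{d+1}}$ for $0<x_{d+1}\le 1$ and $\omega(x)=\log^\lambda 4$ for $x_{d+1}>1$. Let $\mu_{p-1}^\lambda$ be the measure on $\mathbb R^{d+1}_+$ with density $\omega/\log^\lambda 4$ with respect to $m_{d+1}$. The space $W^{1,p}(\mathbb R^{d+1}_+,\mu_{p-1}^\lambda)$ consists of the $u\in L^1_{\rm loc}(\mathbb R^{d+1}_+)$ whose distributional gradient is in $L^1_{\rm loc}(\mathbb R^{d+1}_+)$ and for which $\|u\|_{W^{1,p}}:=\|u\|_{L^p(\mu_{p-1}^\lambda)}+\|\nabla u\|_{L^p(\mu_{p-1}^\lambda)}<\infty$. *Dyadic cubes.* For an integer $k\ge 0$ let $\mathscr Q_{d,k}$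 be the set of cubes $Q=2^{-k}((0,1]^d+m)$, $m\in\mathbb Z^d$, with edge length $\ell(Q)=2^{-k}$. Put $\mathscr Q^1_d=\bigcup_{k\ge 1}\mathscr Q_{d,k}$ and $f_Q=\frac1{m_d(Q)}\int_Q f\,dm_d$. For $Q\in\mathscr Q_{d,2^j}$, $j\ge 0$, write $Q'\asymp Q$ if $Q'\in\mathscr Q_{d,2^j}\cup\mathscr Q_{d,2^{j-1}}$ and $\overline Q\cap\overline{Q'}\ne\emptyset$, with the convention $\mathscr Q_{d,2^{-1}}:=\mathscr Q_{d,1}$. For $Q\in\mathscr Q_{d,k}$ with $2^j\le k<2^{j+1}$ let $\mathcal S(Q)$ be the unique cube in $\mathscr Q_{d,2^j}$ that contains $Q$. *Besov-type space.* $\mathcal B^\lambda_p(\mathbb R^d)$ consists of the $f\in L^1_{\rm loc}(\mathbb R^d)$ with $$\|f\|_{\mathcal B^\lambda_p}:=\|f\|_{L^p(\mathbb R^d)}+\Big(\sum_{j=0}^\infty(2^j+2)^\lambda\sum_{Q\in\mathscr Q_{d,2^j}}m_d(Q)\sum_{Q'\asymp Q}|f_Q-f_{Q'}|^p\Big)^{1/p}<\infty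 .$$ *Whitney cubes and bump functions.* For $Q\in\mathscr Q_{d,k}$ let $\mathscr W(Q)=Q\times(2^{-k},2^{-k+1}]$ and $\mathscr N(Q)=\{y\in\mathbb R^{d+1}_+:\operatorname{dist}(y,\mathscr W(Q))<\ell(Q)/4\}$. For $L\ge0$ and $c>0$, an *$(L,c)$-admissible family* is a family of smooth functions $\psi_Q:\mathbb R^{d+1}_+\to[0,1]$, $Q\in\mathscr Q^1_d$, such that for every $Q\in\mathscr Q^1_d$: $\psi_Q$ is Lipschitz with constant $L/\ell(Q)$; $\psi_Q\ge c$ on $\mathscr W(Q)$; $\operatorname{supp}\psi_Q\subset\mathscr N(Q)$; and moreover $\sum_{Q\in\mathscr Q^1_d}\psi_Q=1$ on $\bigcup_{Q\in\mathscr Q^1_d}\mathscr W(Q)$. *Extension and trace.* For an admissible family $\psi$ and $f\in L^1_{\rm loc}(\mathbb R^d)$, the selected Whitney extension is $\mathscr E f(x)=\sum_{Q\in\mathscr Q^1_d}f_{\mathcal S(Q)}\,\psi_Q(x)$, $x\in\mathbb R^{d+1}_+$. For $u\in L^1_{\rm loc}(\mathbb R^{d+1}_+)$, the trace is $\mathscr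 T u=\lim_{k\to\infty}\mathscr T_k u$, if this limit exists $m_d$-almost everywhere, where $\mathscr T_k u=\sum_{Q\in\mathscr Q_{d,k}}\Big(\frac1{m_{d+1}(\mathscr N(Q))}\int_{\mathscr N(Q)}u\,dm_{d+1}\Big)\chi_Q$. **Theorem.** For some $L\ge 0$ and $c>0$ there is an $(L,c)$-admissible family. For all $L\ge 0$ and $c>0$ there is a constant $C=C(d,p,\lambda,L,c)$ such that, for every $(L,c)$-admissible family $\psi$, the selected Whitney extension $\mathscr E$ is a well-defined (independent of the values of $f$ on null sets) linear operator from the linear space $\mathcal B^\lambda_p(\mathbb R^d)$ to $W^{1,p}(\mathbb R^{d+1}_+,\mu_{p-1}^\lambda)$ with $$\|\mathscr E f\|_{W^{1,p}(\mathbb R^{d+1}_+,\mu_{p-1}^\lambda)}\le C\,\|f\|_{\mathcal B^\lambda_p(\mathbb R^d)}\qquad\text{for all } f\in\mathcal B^\lambda_p(\mathbb R^d),$$ and for every $f\in\mathcal B^\lambda_p(\mathbb R^d)$ the trace of $\mathscr E f$ exists and $\mathscr T(\mathscr E f)=f$ almost everywhere in $\mathbb R^d$. -/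

import Mathlib

open MeasureTheory Set Filter Topology
open scoped ENNReal NNReal ContDiff

namespace SelectedWhitney

noncomputable section

/-- The parameter set `Γ` of pairs `(p, λ)`. -/
def Gamma : Set (ℝ × ℝ) :=
  {q | (1 < q.1 ∧ q.1 - 1 < q.2) ∨ (q.1 = 1 ∧ 0 ≤ q.2)}

/-! ### Dyadic cubes -/

/-- A semi-open dyadic cube `2⁻ᵏ ((0,1]ᵈ + m)` of level `k` and position `m`
(only the levels `k ≥ 0`, i.e. edge length at most one, are needed). For `d ≥ 1` distinct data give
distinct cubes. -/
structure DyadicCube (d : ℕ) where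
  level : ℕ
  idx : Fin d → ℤ

/-- The edge length `ℓ(Q) = 2⁻ᵏ`. -/
def DyadicCube.len {d : ℕ} (Q : DyadicCube d) : ℝ := (2 : ℝ)⁻¹ ^ Q.level

/-- The point set `2⁻ᵏ ((0,1]ᵈ + m)`. -/
def DyadicCube.toSet {d : ℕ} (Q : DyadicCube d) : Set (EuclideanSpace ℝ (Fin d)) :=
  {x | ∀ i, Q.len * (Q.idx i : ℝ) < x i ∧ x i ≤ Q.len * ((Q.idx i : ℝ) + 1)}

/-- The cubes of level exactly `k` (edge length `2⁻ᵏ`). -/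
abbrev CubesOfLevel (d k : ℕ) : Type := {Q : DyadicCube d // Q.level = k}

/-- The cubes of level at least one (edge length at most `1/2`). -/
abbrev FineCube (d : ℕ) : Type := {Q : DyadicCube d // 1 ≤ Q.level}

/-- `Q'` is a selected neighbor of `Q`: `Q` has level `2 ^ j`, `Q'` has level `2 ^ j` or
`2 ^ (j - 1)`, and the closures meet. For `j = 0` the truncated subtraction gives
`2 ^ (0 - 1) = 1`, which is the convention that level `2⁻¹` stands for level `1`. -/
def SelectedNeighbor {d : ℕ} (Q' Q : DyadicCube d) : Prop :=
  ∃ j : ℕ, Q.level = 2 ^ j ∧ (Q'.level = 2 ^ j ∨ Q'.level = 2 ^ (j - 1)) ∧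
    (closure Q.toSet ∩ closure Q'.toSet).Nonempty

/-- The selected ancestor `S(Q)`: the cube of level `2 ^ j` containing `Q`, where
`2 ^ j ≤ level Q < 2 ^ (j + 1)` (integer division rounds down, so this is the dyadic ancestor). -/
def DyadicCube.selectedAncestor {d : ℕ} (Q : DyadicCube d) : DyadicCube d where
  level := 2 ^ Nat.log 2 Q.level
  idx i := Q.idx i / 2 ^ (Q.level - 2 ^ Nat.log 2 Q.level)

theorem DyadicCube.subset_selectedAncestor {d : ℕ} (Q : DyadicCube d) (hQ : 1 ≤ Q.level) :
    Q.toSet ⊆ Q.selectedAncestor.toSet := by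
  have hle : 2 ^ Nat.log 2 Q.level ≤ Q.level := Nat.pow_log_le_self 2 (by omega)
  intro x hx i
  obtain ⟨h1, h2⟩ := hx i
  set K := 2 ^ Nat.log 2 Q.level with hK
  set n : ℕ := Q.level - K with hn
  have hlen : Q.selectedAncestor.len = Q.len * 2 ^ n := by
    have e : Q.level = K + n := by omega
    simp only [DyadicCube.len, DyadicCube.selectedAncestor, ← hK]
    rw [e, pow_add, mul_assoc, ← mul_pow]
    norm_num
  have hidx : Q.selectedAncestor.idx i = Q.idx i / 2 ^ n := rfl
  have hpos : 0 < Q.len := by unfold DyadicCube.len; positivity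
  have hz : (0 : ℤ) < 2 ^ n := by positivity
  have l1 : (2 : ℤ) ^ n * (Q.idx i / 2 ^ n) ≤ Q.idx i := Int.mul_ediv_self_le hz.ne'
  have l2 : Q.idx i + 1 ≤ (2 : ℤ) ^ n * (Q.idx i / 2 ^ n + 1) := by
    have := Int.lt_mul_ediv_self_add (x := Q.idx i) hz
    linarith [Int.add_one_le_iff.2 this]
  have r1 : (2 : ℝ) ^ n * ((Q.idx i / 2 ^ n : ℤ) : ℝ) ≤ Q.idx i := by exact_mod_cast l1
  have r2 : (Q.idx i : ℝ) + 1 ≤ (2 : ℝ) ^ n * (((Q.idx i / 2 ^ n : ℤ) : ℝ) + 1) := by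
    exact_mod_cast l2
  rw [hlen, hidx, mul_assoc, mul_assoc]
  exact ⟨(mul_le_mul_of_nonneg_left r1 hpos.le).trans_lt h1,
    h2.trans (mul_le_mul_of_nonneg_left r2 hpos.le)⟩

/-! ### The Besov-type space on `ℝᵈ` -/

/-- The average `f_Q` of `f` over the cube `Q`. -/
def cubeAvg {d : ℕ} (f : EuclideanSpace ℝ (Fin d) → ℝ) (Q : DyadicCube d) : ℝ :=
  ⨍ x in Q.toSet, f x

/-- The `p`-th power of the homogeneous Besov seminorm over the selected layers. -/
def besovEnergy {d : ℕ} (p lam : ℝ) (f : EuclideanSpace ℝ (Fin d) → ℝ) : ℝ≥0∞ :=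
  ∑' j : ℕ, ENNReal.ofReal (((2 : ℝ) ^ j + 2) ^ lam) *
    ∑' Q : CubesOfLevel d (2 ^ j), volume Q.1.toSet *
      ∑' Q' : {Q' : DyadicCube d // SelectedNeighbor Q' Q.1},
        ENNReal.ofReal (|cubeAvg f Q.1 - cubeAvg f Q'.1| ^ p)

/-- The norm of the Besov-type space (`∞` if `f` is not in the space). -/
def besovNorm {d : ℕ} (p lam : ℝ) (f : EuclideanSpace ℝ (Fin d) → ℝ) : ℝ≥0∞ :=
  eLpNorm f (ENNReal.ofReal p) volume + besovEnergy p lam f ^ (1 / p)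

/-- Membership in the Besov-type space. -/
def MemBesov {d : ℕ} (p lam : ℝ) (f : EuclideanSpace ℝ (Fin d) → ℝ) : Prop :=
  LocallyIntegrable f volume ∧ besovNorm p lam f < ⊤

/-! ### The weighted Sobolev space on the upper half-space -/

/-- The open upper half-space in `ℝᵈ⁺¹`. -/
def upperHalf (d : ℕ) : Set (EuclideanSpace ℝ (Fin (d + 1))) := {x | 0 < x (Fin.last d)}

/-- The weight `ω` with exponents `α` and `λ`. -/
def weight {d : ℕ} (α lam : ℝ) (x : EuclideanSpace ℝ (Fin (d + 1))) : ℝ :=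
  if x (Fin.last d) ≤ 1 then
    |x (Fin.last d)| ^ α * Real.log (4 / |x (Fin.last d)|) ^ lam
  else Real.log 4 ^ lam

/-- The weighted measure `μ` on the upper half-space. -/
def weightedMeasure (d : ℕ) (α lam : ℝ) : Measure (EuclideanSpace ℝ (Fin (d + 1))) :=
  ENNReal.ofReal (1 / Real.log 4 ^ lam) •
    (volume.restrict (upperHalf d)).withDensity fun x => ENNReal.ofReal (weight α lam x)

/-- `G` is the distributional gradient of `f` on the upper half-space, and is locally
integrable there. -/
structure IsWeakGradient {d : ℕ} (f : EuclideanSpace ℝ (Fin (d + 1)) → ℝ)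
    (G : EuclideanSpace ℝ (Fin (d + 1)) → EuclideanSpace ℝ (Fin (d + 1))) : Prop where
  locallyIntegrableOn : LocallyIntegrableOn G (upperHalf d) volume
  integral_eq : ∀ φ : EuclideanSpace ℝ (Fin (d + 1)) → ℝ, ContDiff ℝ ∞ φ →
    HasCompactSupport φ → tsupport φ ⊆ upperHalf d → ∀ i : Fin (d + 1),
      ∫ x in upperHalf d, f x * fderiv ℝ φ x (EuclideanSpace.single i 1) =
        -∫ x in upperHalf d, G x i * φ x

/-- The norm `‖f‖ + ‖∇f‖` in `Lᵖ(μ)`. The distributional gradient is unique up to null sets, so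
the infimum is over a constant family; it is `∞` if there is no locally integrable gradient. -/
def sobolevNorm {d : ℕ} (p α lam : ℝ) (f : EuclideanSpace ℝ (Fin (d + 1)) → ℝ) : ℝ≥0∞ :=
  eLpNorm f (ENNReal.ofReal p) (weightedMeasure d α lam) +
    ⨅ (G : EuclideanSpace ℝ (Fin (d + 1)) → EuclideanSpace ℝ (Fin (d + 1)))
      (_ : IsWeakGradient f G), eLpNorm G (ENNReal.ofReal p) (weightedMeasure d α lam)

/-- Membership in the weighted Sobolev space. -/
def MemSobolev {d : ℕ} (p α lam : ℝ) (f : EuclideanSpace ℝ (Fin (d + 1)) → ℝ) : Prop :=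
  LocallyIntegrableOn f (upperHalf d) volume ∧ (∃ G, IsWeakGradient f G) ∧
    sobolevNorm p α lam f < ⊤

/-! ### Whitney cubes, the trace and the extension -/

/-- The Whitney cube `Q × (ℓ(Q), 2 ℓ(Q)]`. -/
def DyadicCube.whitney {d : ℕ} (Q : DyadicCube d) : Set (EuclideanSpace ℝ (Fin (d + 1))) :=
  {y | WithLp.toLp 2 (fun i : Fin d => y i.castSucc) ∈ Q.toSet ∧
    Q.len < y (Fin.last d) ∧ y (Fin.last d) ≤ 2 * Q.len}

/-- The (Euclidean) `ℓ(Q)/4`-neighborhood of the Whitney cube in the upper half-space. -/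
def DyadicCube.whitneyNhd {d : ℕ} (Q : DyadicCube d) : Set (EuclideanSpace ℝ (Fin (d + 1))) :=
  {y | y ∈ upperHalf d ∧ Metric.infDist y Q.whitney < Q.len / 4}

/-- The approximate trace at level `k`. -/
def approxTrace {d : ℕ} (k : ℕ) (u : EuclideanSpace ℝ (Fin (d + 1)) → ℝ)
    (x : EuclideanSpace ℝ (Fin d)) : ℝ :=
  ∑' Q : CubesOfLevel d k, Q.1.toSet.indicator (fun _ => ⨍ y in Q.1.whitneyNhd, u y) x

/-- `g` is the trace of `u`: the approximate traces converge to `g` almost everywhere. -/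
def HasTrace {d : ℕ} (u : EuclideanSpace ℝ (Fin (d + 1)) → ℝ)
    (g : EuclideanSpace ℝ (Fin d) → ℝ) : Prop :=
  ∀ᵐ x ∂(volume : Measure (EuclideanSpace ℝ (Fin d))),
    Tendsto (fun k : ℕ => approxTrace k u x) atTop (𝓝 (g x))

/-- The families `ψ_Q` of bump functions admitted in the extension, with Lipschitz constant `L`
and lower bound `c`. -/
structure IsWhitneyPartition {d : ℕ} (L : ℝ≥0) (c : ℝ)
    (ψ : FineCube d → EuclideanSpace ℝ (Fin (d + 1)) → ℝ) : Prop where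
  smooth : ∀ Q, ContDiffOn ℝ ∞ (ψ Q) (upperHalf d)
  mem_Icc : ∀ Q, ∀ x ∈ upperHalf d, ψ Q x ∈ Icc (0 : ℝ) 1
  lipschitz : ∀ Q, ∀ x ∈ upperHalf d, ∀ y ∈ upperHalf d,
    |ψ Q x - ψ Q y| ≤ L / Q.1.len * dist x y
  pos : 0 < c
  lower_bound : ∀ Q, ∀ x ∈ Q.1.whitney, c ≤ ψ Q x
  support_subset : ∀ Q, closure {x | x ∈ upperHalf d ∧ ψ Q x ≠ 0} ⊆ Q.1.whitneyNhd
  sum_eq_one : ∀ x ∈ ⋃ Q : FineCube d, Q.1.whitney, HasSum (fun Q : FineCube d => ψ Q x) 1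

/-- The selected Whitney extension of `f` (the sum is locally finite in the upper half-space). -/
def selectedExtension {d : ℕ} (ψ : FineCube d → EuclideanSpace ℝ (Fin (d + 1)) → ℝ)
    (f : EuclideanSpace ℝ (Fin d) → ℝ) (x : EuclideanSpace ℝ (Fin (d + 1))) : ℝ :=
  ∑' Q : FineCube d, cubeAvg f Q.1.selectedAncestor * ψ Q x

end

end SelectedWhitney

namespace SelectedWhitney

noncomputable section

/-! ### Geometry of dyadic cubes -/

/-! Near the Whitney cube of `P` only boundedly many bumps are nonzero, namely those of cubes `Q`
with `P.Near Q` (`near_of_mem_whitneyNhd`, `card_nearFinset_le`). There the extension is a finite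
smooth sum of averages of `f` over selected ancestors, so its classical gradient is its weak
gradient. It vanishes above height 9/8.

A Whitney cube of level k has weighted measure at most a constant times ℓ^p (k+2)^λ m_d(P). For the
function itself, Jensen's inequality bounds the contribution of each level by ‖f‖_p^p, and the
factors 2^(-kp) (k+2)^λ are summable.

For the gradient, subtracting the constant f_{S(P)} is free wherever the bumps sum to 1. Hence |∇Ef|
is at most a constant times ℓ(P)^(-1) times the sum of |f_{S(P)} - f_{S(Q)}| over the near cubes Q,
and ℓ^p cancels against the measure. The decisive point is that this difference vanishes unless P
touches the boundary of S(P) (`selectedAncestor_eq_of_near`). At level k = 2^j + n such cubes fill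
only a fraction of at most 2d 2^(-n) of S(P) (`tsum_level_boundary_le`). Summing the geometric
series over n collapses each block 2^j ≤ k < 2^(j+1) to the single selected level 2^j, on which
(k+2)^λ is comparable to (2^j+2)^λ. What remains is the Besov energy (`tsum_near_energy_le`). In the
top layers, where the bumps need not sum to 1, the gradient is controlled by ‖f‖_p instead.

The trace is Lebesgue differentiation: over a small cube containing x, Ef is a convex combination of
averages over selected ancestors. These may be much larger than the cube, but they still shrink to x
and lie in balls about x of comparable size.

An admissible family is built from products of differences of smooth steps, whose sums telescope. -/

theorem DyadicCube.len_pos {d : ℕ} (Q : DyadicCube d) : 0 < Q.len := by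
  unfold DyadicCube.len; positivity

theorem DyadicCube.len_le_two_mul {d : ℕ} {P Q : DyadicCube d} (h : P.level ≤ Q.level + 1) :
    Q.len ≤ 2 * P.len := by
  have : (2 : ℝ)⁻¹ ^ (Q.level + 1) ≤ 2⁻¹ ^ P.level :=
    pow_le_pow_of_le_one (by norm_num) (by norm_num) h
  rw [pow_succ] at this
  unfold DyadicCube.len
  linarith

theorem DyadicCube.len_le_of_level_le {d : ℕ} {P Q : DyadicCube d} (h : P.level ≤ Q.level) :
    Q.len ≤ P.len :=
  pow_le_pow_of_le_one (by norm_num) (by norm_num) h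

theorem DyadicCube.toSet_eq_preimage {d : ℕ} (Q : DyadicCube d) :
    Q.toSet = (WithLp.ofLp : EuclideanSpace ℝ (Fin d) → Fin d → ℝ) ⁻¹'
      (univ.pi fun i => Ioc (Q.len * (Q.idx i : ℝ)) (Q.len * ((Q.idx i : ℝ) + 1))) := by
  ext x
  simp [DyadicCube.toSet, Set.mem_pi]

theorem DyadicCube.measurableSet_toSet {d : ℕ} (Q : DyadicCube d) : MeasurableSet Q.toSet := by
  rw [Q.toSet_eq_preimage]
  exact (PiLp.volume_preserving_ofLp (Fin d)).measurable
    (MeasurableSet.univ_pi fun i => measurableSet_Ioc)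

theorem DyadicCube.volume_toSet {d : ℕ} (Q : DyadicCube d) :
    volume Q.toSet = ENNReal.ofReal Q.len ^ d := by
  rw [Q.toSet_eq_preimage, (PiLp.volume_preserving_ofLp (Fin d)).measure_preimage
    (MeasurableSet.univ_pi fun i => measurableSet_Ioc).nullMeasurableSet, Real.volume_pi_Ioc]
  have : ∀ i : Fin d, Q.len * ((Q.idx i : ℝ) + 1) - Q.len * (Q.idx i : ℝ) = Q.len :=
    fun i => by ring
  simp [this]

theorem DyadicCube.whitney_eq_preimage {d : ℕ} (Q : DyadicCube d) :
    Q.whitney = (WithLp.ofLp : EuclideanSpace ℝ (Fin (d + 1)) → Fin (d + 1) → ℝ) ⁻¹'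
      (univ.pi fun i => Ioc (Fin.lastCases (motive := fun _ => ℝ) Q.len
          (fun i => Q.len * (Q.idx i : ℝ)) i)
        (Fin.lastCases (motive := fun _ => ℝ) (2 * Q.len)
          (fun i => Q.len * ((Q.idx i : ℝ) + 1)) i)) := by
  ext x
  simp [DyadicCube.whitney, DyadicCube.toSet, Set.mem_pi, Fin.forall_fin_succ', -mem_preimage,
    mem_preimage (f := WithLp.ofLp)]

theorem DyadicCube.measurableSet_whitney {d : ℕ} (Q : DyadicCube d) :
    MeasurableSet Q.whitney := by
  rw [Q.whitney_eq_preimage]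
  exact (PiLp.volume_preserving_ofLp (Fin (d + 1))).measurable
    (MeasurableSet.univ_pi fun i => measurableSet_Ioc)

theorem DyadicCube.volume_whitney {d : ℕ} (Q : DyadicCube d) :
    volume Q.whitney = ENNReal.ofReal Q.len ^ (d + 1) := by
  rw [Q.whitney_eq_preimage, (PiLp.volume_preserving_ofLp (Fin (d + 1))).measure_preimage
    (MeasurableSet.univ_pi fun i => measurableSet_Ioc).nullMeasurableSet, Real.volume_pi_Ioc,
    Fin.prod_univ_castSucc]
  have : ∀ i : Fin d, Q.len * ((Q.idx i : ℝ) + 1) - Q.len * (Q.idx i : ℝ) = Q.len :=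
    fun i => by ring
  have h2 : 2 * Q.len - Q.len = Q.len := by ring
  simp [this, h2, pow_succ]

theorem DyadicCube.whitney_nonempty {d : ℕ} (Q : DyadicCube d) : Q.whitney.Nonempty := by
  have := Q.len_pos
  refine nonempty_of_measure_ne_zero (μ := volume) ?_
  rw [Q.volume_whitney]
  simpa using this

theorem mem_closure_toSet {d : ℕ} {Q : DyadicCube d} {x : EuclideanSpace ℝ (Fin d)}
    (hx : ∀ i, Q.len * (Q.idx i : ℝ) ≤ x i ∧ x i ≤ Q.len * ((Q.idx i : ℝ) + 1)) :
    x ∈ closure Q.toSet := by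
  have e : Q.toSet = (PiLp.homeomorph 2 (fun _ : Fin d => ℝ)) ⁻¹'
      (univ.pi fun i => Ioc (Q.len * (Q.idx i : ℝ)) (Q.len * ((Q.idx i : ℝ) + 1))) :=
    Q.toSet_eq_preimage
  rw [e, ← Homeomorph.preimage_closure, closure_pi_set]
  intro i _
  beta_reduce
  rw [closure_Ioc]
  · exact hx i
  · have := Q.len_pos
    nlinarith

theorem abs_coord_le_dist {n : ℕ} (x y : EuclideanSpace ℝ (Fin n)) (i : Fin n) :
    |x i - y i| ≤ dist x y := by
  rw [dist_eq_norm]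
  simpa using PiLp.norm_apply_le (x - y) i

theorem dist_le_of_abs_coord_le {n : ℕ} {x y : EuclideanSpace ℝ (Fin n)} {r : ℝ} (hr : 0 ≤ r)
    (h : ∀ i, |x i - y i| ≤ r) : dist x y ≤ n * r := by
  rw [EuclideanSpace.dist_eq]
  refine Real.sqrt_le_iff.2 ⟨by positivity, ?_⟩
  calc ∑ i, dist (x i) (y i) ^ 2 ≤ ∑ _i : Fin n, r ^ 2 := by
        refine Finset.sum_le_sum fun i _ => ?_
        rw [Real.dist_eq]
        exact pow_le_pow_left₀ (abs_nonneg _) (h i) 2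
    _ = n * r ^ 2 := by simp
    _ ≤ (n * r) ^ 2 := by
        rw [mul_pow]
        have : (n : ℝ) ≤ (n : ℝ) ^ 2 := by exact_mod_cast Nat.le_self_pow (by norm_num) n
        nlinarith [sq_nonneg r]

theorem isOpen_upperHalf (d : ℕ) : IsOpen (upperHalf d) :=
  isOpen_lt continuous_const (by fun_prop)

theorem DyadicCube.isOpen_whitneyNhd {d : ℕ} (Q : DyadicCube d) : IsOpen Q.whitneyNhd :=
  (isOpen_upperHalf d).inter
    (isOpen_lt (Metric.continuous_infDist_pt _) continuous_const)

theorem DyadicCube.whitneyNhd_subset {d : ℕ} (Q : DyadicCube d) :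
    Q.whitneyNhd ⊆ upperHalf d := fun _ hy => hy.1

theorem DyadicCube.whitney_subset_whitneyNhd {d : ℕ} (Q : DyadicCube d) :
    Q.whitney ⊆ Q.whitneyNhd := by
  intro y hy
  have := Q.len_pos
  refine ⟨this.trans hy.2.1, ?_⟩
  rw [Metric.infDist_zero_of_mem hy]
  positivity

/-- The open box containing the enlarged Whitney cube. -/
theorem DyadicCube.bounds_of_mem_whitneyNhd {d : ℕ} {Q : DyadicCube d}
    {y : EuclideanSpace ℝ (Fin (d + 1))} (hy : y ∈ Q.whitneyNhd) :
    (∀ i : Fin d, Q.len * Q.idx i - Q.len / 4 < y i.castSucc ∧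
      y i.castSucc < Q.len * (Q.idx i + 1) + Q.len / 4) ∧
    3 / 4 * Q.len < y (Fin.last d) ∧ y (Fin.last d) < 9 / 4 * Q.len := by
  obtain ⟨w, hw, hyw⟩ := (Metric.infDist_lt_iff Q.whitney_nonempty).1 hy.2
  have hc := fun i => abs_sub_lt_iff.1 ((abs_coord_le_dist y w i).trans_lt hyw)
  obtain ⟨hw1, hw2, hw3⟩ := hw
  refine ⟨fun i => ?_, ?_, ?_⟩
  · obtain ⟨a, b⟩ := hw1 i
    obtain ⟨c, e⟩ := hc i.castSucc
    simp only at a b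
    constructor <;> linarith
  · linarith [(hc (Fin.last d)).2]
  · linarith [(hc (Fin.last d)).1]

/-! ### Neighboring cubes -/

/-- Two cubes of consecutive or equal levels whose closures meet. -/
def DyadicCube.Near {d : ℕ} (P Q : DyadicCube d) : Prop :=
  P.level ≤ Q.level + 1 ∧ Q.level ≤ P.level + 1 ∧
    ∀ i, P.len * P.idx i ≤ Q.len * (Q.idx i + 1) ∧ Q.len * Q.idx i ≤ P.len * (P.idx i + 1)

theorem DyadicCube.Near.symm {d : ℕ} {P Q : DyadicCube d} (h : P.Near Q) : Q.Near P :=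
  ⟨h.2.1, h.1, fun i => (h.2.2 i).symm⟩

theorem DyadicCube.idx_le_of_near {d : ℕ} {P Q : DyadicCube d} (h : P.Near Q)
    (hl : P.level = Q.level) (i : Fin d) : P.idx i ≤ Q.idx i + 1 := by
  have e : P.len = Q.len := by simp [DyadicCube.len, hl]
  have h1 := (h.2.2 i).1
  rw [e] at h1
  have := le_of_mul_le_mul_left h1 Q.len_pos
  exact_mod_cast this

theorem DyadicCube.idx_le_of_near_succ {d : ℕ} {P Q : DyadicCube d} (h : P.Near Q)
    (hl : Q.level = P.level + 1) (i : Fin d) :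
    2 * P.idx i ≤ Q.idx i + 1 ∧ Q.idx i ≤ 2 * P.idx i + 2 := by
  have e : P.len = 2 * Q.len := by simp only [DyadicCube.len, hl, pow_succ]; ring
  obtain ⟨h1, h2⟩ := h.2.2 i
  rw [e] at h1 h2
  have hq := Q.len_pos
  have h1' : (2 : ℝ) * P.idx i ≤ Q.idx i + 1 := by
    refine le_of_mul_le_mul_left ?_ hq
    linarith
  have h2' : (Q.idx i : ℝ) ≤ 2 * P.idx i + 2 := by
    refine le_of_mul_le_mul_left ?_ hq
    linarith
  exact ⟨by exact_mod_cast h1', by exact_mod_cast h2'⟩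

/-- Heights determine levels up to one: two levels apart, 9/4 · ℓ(P) ≤ 9/16 · ℓ(Q) < 3/4 · ℓ(Q), so
the height ranges are disjoint. -/
theorem DyadicCube.level_le_of_mem_whitneyNhd {d : ℕ} {P Q : DyadicCube d}
    {y : EuclideanSpace ℝ (Fin (d + 1))} (hP : y ∈ P.whitneyNhd) (hQ : y ∈ Q.whitneyNhd) :
    P.level ≤ Q.level + 1 := by
  by_contra! h
  have h1 : P.len ≤ 2⁻¹ ^ (Q.level + 2) :=
    pow_le_pow_of_le_one (by norm_num) (by norm_num) h
  have h2 : (2⁻¹ : ℝ) ^ (Q.level + 2) = Q.len / 4 := by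
    rw [pow_add, DyadicCube.len]; norm_num; ring
  have h3 := (DyadicCube.bounds_of_mem_whitneyNhd hP).2.2
  have h4 := (DyadicCube.bounds_of_mem_whitneyNhd hQ).2.1
  have := Q.len_pos
  linarith

/-- The two enlargements add up to less than one edge of the finer cube, while all faces lie on the
finer lattice. By integrality a gap smaller than one lattice unit is no gap, so the closed cubes
already meet. -/
theorem DyadicCube.near_of_mem_whitneyNhd {d : ℕ} {P Q : DyadicCube d}
    {y : EuclideanSpace ℝ (Fin (d + 1))} (hP : y ∈ P.whitneyNhd) (hQ : y ∈ Q.whitneyNhd) :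
    P.Near Q := by
  have hPQ := DyadicCube.level_le_of_mem_whitneyNhd hP hQ
  have hQP := DyadicCube.level_le_of_mem_whitneyNhd hQ hP
  have key : ∀ P Q : DyadicCube d, y ∈ P.whitneyNhd → y ∈ Q.whitneyNhd →
      P.level ≤ Q.level + 1 → Q.level ≤ P.level + 1 → ∀ i,
      P.len * P.idx i ≤ Q.len * (Q.idx i + 1) := by
    intro P Q hP hQ hPQ hQP i
    have hp := ((DyadicCube.bounds_of_mem_whitneyNhd hP).1 i).1
    have hq := ((DyadicCube.bounds_of_mem_whitneyNhd hQ).1 i).2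
    have pP := P.len_pos
    have pQ := Q.len_pos
    have h := hp.trans hq
    obtain hl | hl | hl : P.level = Q.level ∨ Q.level = P.level + 1 ∨ P.level = Q.level + 1 := by
      omega
    · have e : P.len = Q.len := by simp [DyadicCube.len, hl]
      rw [e] at h ⊢
      refine mul_le_mul_of_nonneg_left ?_ pQ.le
      have : Q.len * (P.idx i) < Q.len * (Q.idx i + 2) := by linarith
      have := lt_of_mul_lt_mul_left this pQ.le
      have : P.idx i < Q.idx i + 2 := by exact_mod_cast this
      have : P.idx i ≤ Q.idx i + 1 := by omega
      exact_mod_cast this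
    · have e : P.len = Q.len * 2 := by simp only [DyadicCube.len, hl, pow_succ]; ring
      rw [e] at h ⊢
      rw [mul_assoc]
      refine mul_le_mul_of_nonneg_left ?_ pQ.le
      have : Q.len * (2 * P.idx i) < Q.len * (Q.idx i + 2) := by linarith
      have := lt_of_mul_lt_mul_left this pQ.le
      have : 2 * P.idx i < Q.idx i + 2 := by exact_mod_cast this
      have : 2 * P.idx i ≤ Q.idx i + 1 := by omega
      exact_mod_cast this
    · have e : Q.len = P.len * 2 := by simp only [DyadicCube.len, hl, pow_succ]; ring
      rw [e] at h ⊢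
      rw [mul_assoc]
      refine mul_le_mul_of_nonneg_left ?_ pP.le
      have : P.len * (P.idx i) < P.len * (2 * (Q.idx i + 1) + 1) := by linarith
      have := lt_of_mul_lt_mul_left this pP.le
      have : P.idx i < 2 * (Q.idx i + 1) + 1 := by exact_mod_cast this
      have : P.idx i ≤ 2 * (Q.idx i + 1) := by omega
      exact_mod_cast this
  exact ⟨hPQ, hQP, fun i => ⟨key P Q hP hQ hPQ hQP i, key Q P hQ hP hQP hPQ i⟩⟩

theorem DyadicCube.ext_iff' {d : ℕ} {P Q : DyadicCube d} :
    P = Q ↔ P.level = Q.level ∧ P.idx = Q.idx := by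
  cases P; cases Q; simp

/-- A dyadic cube is determined by its level and its position. -/
def DyadicCube.equivProd (d : ℕ) : (ℕ × (Fin d → ℤ)) ≃ DyadicCube d where
  toFun q := ⟨q.1, q.2⟩
  invFun Q := (Q.level, Q.idx)
  left_inv _ := rfl
  right_inv _ := rfl

instance (d : ℕ) : Countable (DyadicCube d) := (DyadicCube.equivProd d).symm.injective.countable

open Classical in
-- Three levels are possible. On each, `P.len ≤ 2 * Q.len` confines every coordinate of the position
-- to an interval [t - 1, t + 2], which contains at most four integers.
theorem DyadicCube.exists_finset_near {d : ℕ} (P : DyadicCube d) :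
    ∃ s : Finset (DyadicCube d), (∀ Q, Q ∈ s ↔ P.Near Q) ∧ s.card ≤ 3 * 4 ^ d := by
  let c : ℕ → Fin d → ℤ := fun k i => ⌊P.len * P.idx i / (2⁻¹ : ℝ) ^ k⌋ - 1
  let t : Finset (DyadicCube d) := ((Finset.Icc (P.level - 1) (P.level + 1)).sigma fun k =>
    Fintype.piFinset fun i => Finset.Icc (c k i) (c k i + 3)).image fun s => ⟨s.1, s.2⟩
  have ht : t.card ≤ 3 * 4 ^ d := by
    refine Finset.card_image_le.trans ?_
    rw [Finset.card_sigma]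
    simp only [Fintype.card_piFinset, Int.card_Icc]
    have e : ∀ k i, (c k i + 3 + 1 - c k i).toNat = 4 := fun k i => by
      rw [show c k i + 3 + 1 - c k i = 4 by ring]; rfl
    simp only [e, Finset.prod_const, Finset.card_univ, Fintype.card_fin, Finset.sum_const,
      Nat.card_Icc, smul_eq_mul]
    gcongr
    omega
  refine ⟨t.filter fun Q => P.Near Q, fun Q => ?_, (Finset.card_filter_le _ _).trans ht⟩
  rw [Finset.mem_filter]
  refine ⟨fun h => h.2, fun h => ⟨?_, h⟩⟩
  refine Finset.mem_image.2 ⟨⟨Q.level, Q.idx⟩, ?_, rfl⟩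
  refine Finset.mem_sigma.2 ⟨Finset.mem_Icc.2 ⟨by have := h.1; simp only; omega, h.2.1⟩, ?_⟩
  refine Fintype.mem_piFinset.2 fun i => Finset.mem_Icc.2 ?_
  obtain ⟨h1, h2⟩ := h.2.2 i
  have pQ := Q.len_pos
  have hlen : P.len ≤ 2 * Q.len := DyadicCube.len_le_two_mul h.2.1
  have f1 := Int.floor_le (P.len * P.idx i / Q.len)
  have f2 := Int.lt_floor_add_one (P.len * P.idx i / Q.len)
  have hc : c Q.level i = ⌊P.len * P.idx i / Q.len⌋ - 1 := rfl
  simp only [hc]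
  have g1 : P.len * P.idx i / Q.len ≤ Q.idx i + 1 := by
    rw [div_le_iff₀ pQ]; linarith
  have g2 : (Q.idx i : ℝ) ≤ P.len * P.idx i / Q.len + 2 := by
    have : P.len * P.idx i = P.len * P.idx i / Q.len * Q.len := by field_simp
    refine le_of_mul_le_mul_left ?_ pQ
    nlinarith
  constructor
  · have : ((⌊P.len * P.idx i / Q.len⌋ : ℤ) : ℝ) ≤ Q.idx i + 1 := f1.trans g1
    have : ⌊P.len * P.idx i / Q.len⌋ ≤ Q.idx i + 1 := by exact_mod_cast this
    omega
  · have : (Q.idx i : ℝ) < (⌊P.len * P.idx i / Q.len⌋ : ℝ) + 3 := by linarith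
    have : Q.idx i < ⌊P.len * P.idx i / Q.len⌋ + 3 := by exact_mod_cast this
    omega

/-- The finitely many neighbors of a cube. -/
def DyadicCube.nearFinset {d : ℕ} (P : DyadicCube d) : Finset (DyadicCube d) :=
  P.exists_finset_near.choose

theorem DyadicCube.mem_nearFinset {d : ℕ} {P Q : DyadicCube d} :
    Q ∈ P.nearFinset ↔ P.Near Q := P.exists_finset_near.choose_spec.1 Q

theorem DyadicCube.card_nearFinset_le {d : ℕ} (P : DyadicCube d) :
    P.nearFinset.card ≤ 3 * 4 ^ d := P.exists_finset_near.choose_spec.2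

/-! ### Selected ancestors -/

/-- The number of generations between a cube and its selected ancestor. -/
def DyadicCube.depth {d : ℕ} (P : DyadicCube d) : ℕ := P.level - 2 ^ Nat.log 2 P.level

/-- The cube lies along the boundary of its selected ancestor. -/
def DyadicCube.IsBoundary {d : ℕ} (P : DyadicCube d) : Prop :=
  ∃ i, P.idx i % 2 ^ P.depth = 0 ∨ P.idx i % 2 ^ P.depth = 2 ^ P.depth - 1

theorem DyadicCube.level_eq_add_depth {d : ℕ} {P : DyadicCube d} (hP : 1 ≤ P.level) :
    P.level = 2 ^ Nat.log 2 P.level + P.depth := by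
  have : 2 ^ Nat.log 2 P.level ≤ P.level := Nat.pow_log_le_self 2 (by omega)
  unfold DyadicCube.depth
  omega

theorem log_le_log_add_one {k l : ℕ} (h : k ≤ l + 1) (hl : 1 ≤ l) :
    Nat.log 2 k ≤ Nat.log 2 l + 1 := by
  have h1 : Nat.log 2 k ≤ Nat.log 2 (l * 2) := Nat.log_mono_right (by omega)
  rwa [Nat.log_mul_base (by norm_num) (by omega)] at h1

theorem DyadicCube.closure_inter_nonempty_of_near {d : ℕ} {P Q : DyadicCube d} (h : P.Near Q) :
    (closure P.toSet ∩ closure Q.toSet).Nonempty := by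
  have hP := P.len_pos
  have hQ := Q.len_pos
  refine ⟨WithLp.toLp 2 fun i => max (P.len * P.idx i) (Q.len * Q.idx i),
    mem_closure_toSet fun i => ⟨le_max_left _ _, max_le (by nlinarith) (h.2.2 i).2⟩,
    mem_closure_toSet fun i => ⟨le_max_right _ _, max_le (h.2.2 i).1 (by nlinarith)⟩⟩

/-- The Besov energy compares a selected cube only with cubes of the same or the next coarser
selected level, which is why the pair must be ordered by `hl`. The closures of the ancestors meet
because those of `P` and `Q` do. -/
theorem DyadicCube.selectedNeighbor_of_near {d : ℕ} {P Q : DyadicCube d} (h : P.Near Q)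
    (hP : 1 ≤ P.level) (hQ : 1 ≤ Q.level)
    (hl : Nat.log 2 Q.level ≤ Nat.log 2 P.level) :
    SelectedNeighbor Q.selectedAncestor P.selectedAncestor := by
  refine ⟨Nat.log 2 P.level, rfl, ?_, (DyadicCube.closure_inter_nonempty_of_near h).mono
    (inter_subset_inter (closure_mono (P.subset_selectedAncestor hP))
      (closure_mono (Q.subset_selectedAncestor hQ)))⟩
  have := log_le_log_add_one h.1 hQ
  obtain e | e : Nat.log 2 Q.level = Nat.log 2 P.level ∨
      Nat.log 2 Q.level = Nat.log 2 P.level - 1 := by omega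
  · left; rw [← e]; rfl
  · right; rw [← e]; rfl

/-- Away from the boundary, each residue of the position modulo 2^n lies between 1 and 2^n - 2.
Moving to a touching cube of the same or an adjacent level then cannot leave the ancestor. -/
theorem DyadicCube.selectedAncestor_eq_of_near {d : ℕ} (hd : 1 ≤ d) {P Q : DyadicCube d}
    (h : P.Near Q) (hP : 1 ≤ P.level) (hQ : 1 ≤ Q.level)
    (hl : Nat.log 2 Q.level ≤ Nat.log 2 P.level) (hb : ¬ P.IsBoundary) :
    Q.selectedAncestor = P.selectedAncestor := by
  -- At depth zero the residue modulo 1 is 0, so the cube counts as a boundary cube; this takes at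
  -- least one coordinate.
  have hdep : P.depth ≠ 0 := by
    intro h0
    exact hb ⟨⟨0, hd⟩, Or.inl (by simp [h0])⟩
  have hPl := DyadicCube.level_eq_add_depth hP
  have hQl := DyadicCube.level_eq_add_depth hQ
  -- With positive depth, even one level coarser than `P` is still at or below the selected level of
  -- `P`, so both cubes belong to the same block.
  have hlog : Nat.log 2 Q.level = Nat.log 2 P.level := by
    refine le_antisymm hl ?_
    rw [Nat.le_log_iff_pow_le (by norm_num) (by omega)]
    have := h.1
    omega
  rw [hlog] at hQl
  rw [DyadicCube.ext_iff']
  refine ⟨by simp only [DyadicCube.selectedAncestor, hlog], funext fun i => ?_⟩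
  change Q.idx i / 2 ^ Q.depth = P.idx i / 2 ^ P.depth
  have hs1 : P.idx i % 2 ^ P.depth ≠ 0 := fun e => hb ⟨i, Or.inl e⟩
  have hs2 : P.idx i % 2 ^ P.depth ≠ 2 ^ P.depth - 1 := fun e => hb ⟨i, Or.inr e⟩
  have hs3 := Int.emod_nonneg (P.idx i) (b := 2 ^ P.depth) (by positivity)
  have hs4 := Int.emod_lt_of_pos (P.idx i) (b := 2 ^ P.depth) (by positivity)
  have hs5 := Int.mul_ediv_add_emod (P.idx i) (2 ^ P.depth)
  set r := P.idx i / 2 ^ P.depth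
  set s := P.idx i % 2 ^ P.depth
  obtain e | e | e : P.level = Q.level ∨ Q.level = P.level + 1 ∨ P.level = Q.level + 1 := by
    have := h.1; have := h.2.1; omega
  · have hD : Q.depth = P.depth := by unfold DyadicCube.depth; rw [e]
    have a1 := DyadicCube.idx_le_of_near h e i
    have a2 := DyadicCube.idx_le_of_near h.symm e.symm i
    rw [hD, Int.ediv_eq_iff_of_pos (by positivity)]
    constructor <;> nlinarith [Int.lt_iff_add_one_le.1 (lt_of_le_of_ne hs3 (Ne.symm hs1)),
      Int.lt_iff_add_one_le.1 (lt_of_le_of_ne (Int.le_sub_one_of_lt hs4) hs2)]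
  · have hD : Q.depth = P.depth + 1 := by omega
    obtain ⟨a1, a2⟩ := DyadicCube.idx_le_of_near_succ h e i
    rw [hD, pow_succ, Int.ediv_eq_iff_of_pos (by positivity)]
    constructor <;> nlinarith [Int.lt_iff_add_one_le.1 (lt_of_le_of_ne hs3 (Ne.symm hs1)),
      Int.lt_iff_add_one_le.1 (lt_of_le_of_ne (Int.le_sub_one_of_lt hs4) hs2)]
  · have hD : P.depth = Q.depth + 1 := by omega
    obtain ⟨a1, a2⟩ := DyadicCube.idx_le_of_near_succ h.symm e i
    rw [hD, pow_succ] at hs2 hs4 hs5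
    rw [Int.ediv_eq_iff_of_pos (by positivity)]
    constructor <;> nlinarith [Int.lt_iff_add_one_le.1 (lt_of_le_of_ne hs3 (Ne.symm hs1)),
      Int.lt_iff_add_one_le.1 (lt_of_le_of_ne (Int.le_sub_one_of_lt hs4) hs2)]

/-! ### Counting lemmas for sums over cubes -/

theorem sum_eq_tsum_indicator_ennreal {α : Type*} (F : α → ℝ≥0∞) (s : Finset α) :
    ∑ x ∈ s, F x = ∑' x, (s : Set α).indicator F x := sum_eq_tsum_indicator F s

theorem tsum_indicator_const_le {α : Type*} {A : Set α} {s : Finset α} (hA : A ⊆ s) {c : ℕ}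
    (hs : s.card ≤ c) (b : ℝ≥0∞) : ∑' m, A.indicator (fun _ => b) m ≤ c * b := by
  calc ∑' m, A.indicator (fun _ => b) m
      ≤ ∑' m, (s : Set α).indicator (fun _ => b) m :=
        ENNReal.tsum_le_tsum fun m => indicator_le_indicator_of_subset hA (fun _ => zero_le) m
    _ = ∑ m ∈ s, b := by rw [sum_eq_tsum_indicator_ennreal]
    _ ≤ c * b := by
        rw [Finset.sum_const, nsmul_eq_mul]
        gcongr

/-- The counting principle behind all the sums over cubes: regroup by the value of `q`, and each
value is taken at most `c` times on `B`. -/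
theorem tsum_fiber_le {α β : Type*} (q : α → β) (B : Set α) (c : ℕ)
    (hc : ∀ r, ∃ s : Finset α, (∀ m ∈ B, q m = r → m ∈ s) ∧ s.card ≤ c) (H : β → ℝ≥0∞) :
    ∑' m, B.indicator (fun m => H (q m)) m ≤ c * ∑' r, H r := by
  calc ∑' m, B.indicator (fun m => H (q m)) m
      ≤ ∑' m, ∑' r, {m | m ∈ B ∧ q m = r}.indicator (fun _ => H r) m := by
        refine ENNReal.tsum_le_tsum fun m => ?_
        by_cases hm : m ∈ B
        · refine le_trans ?_ (ENNReal.le_tsum (q m))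
          simp [hm]
        · simp [hm]
    _ = ∑' r, ∑' m, {m | m ∈ B ∧ q m = r}.indicator (fun _ => H r) m := ENNReal.tsum_comm
    _ ≤ ∑' r, c * H r := by
        refine ENNReal.tsum_le_tsum fun r => ?_
        obtain ⟨s, hs, hsc⟩ := hc r
        exact tsum_indicator_const_le (fun m hm => hs m hm.1 hm.2) hsc _
    _ = c * ∑' r, H r := ENNReal.tsum_mul_left

theorem exists_finset_idx_div {d : ℕ} (n : ℕ) (r : Fin d → ℤ) :
    ∃ s : Finset (Fin d → ℤ), (∀ m ∈ univ, (fun i => m i / 2 ^ n) = r → m ∈ s) ∧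
      s.card ≤ (2 ^ n) ^ d := by
  classical
  refine ⟨Fintype.piFinset fun i => Finset.Ico (2 ^ n * r i) (2 ^ n * r i + 2 ^ n), ?_, ?_⟩
  · intro m _ hm
    refine Fintype.mem_piFinset.2 fun i => Finset.mem_Ico.2 ?_
    have h1 := Int.mul_ediv_add_emod (m i) (2 ^ n)
    have h2 := Int.emod_nonneg (m i) (b := 2 ^ n) (by positivity)
    have h3 := Int.emod_lt_of_pos (m i) (b := 2 ^ n) (by positivity)
    rw [show m i / 2 ^ n = r i from congrFun hm i] at h1
    constructor <;> linarith
  · simp only [Fintype.card_piFinset, Int.card_Ico, add_sub_cancel_left, Finset.prod_const,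
      Finset.card_univ, Fintype.card_fin]
    norm_cast

/-- One coordinate `i` is pinned to one of two extreme values and the other d - 1 are free. This
saves a factor of order 2^n against all descendants. -/
theorem exists_finset_idx_boundary {d : ℕ} (n : ℕ) (r : Fin d → ℤ) :
    ∃ s : Finset (Fin d → ℤ),
      (∀ m ∈ {m : Fin d → ℤ | ∃ i, m i % 2 ^ n = 0 ∨ m i % 2 ^ n = 2 ^ n - 1},
        (fun i => m i / 2 ^ n) = r → m ∈ s) ∧
      s.card ≤ d * (2 * (2 ^ n) ^ (d - 1)) := by
  classical
  refine ⟨Finset.univ.biUnion fun i : Fin d => Fintype.piFinset fun j =>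
    if j = i then {2 ^ n * r i, 2 ^ n * r i + (2 ^ n - 1)}
    else Finset.Ico (2 ^ n * r j) (2 ^ n * r j + 2 ^ n), ?_, ?_⟩
  · rintro m ⟨i, hi⟩ hm
    refine Finset.mem_biUnion.2 ⟨i, Finset.mem_univ _, Fintype.mem_piFinset.2 fun j => ?_⟩
    have h1 := Int.mul_ediv_add_emod (m j) (2 ^ n)
    have h2 := Int.emod_nonneg (m j) (b := 2 ^ n) (by positivity)
    have h3 := Int.emod_lt_of_pos (m j) (b := 2 ^ n) (by positivity)
    rw [show m j / 2 ^ n = r j from congrFun hm j] at h1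
    split_ifs with hj
    · subst hj
      rw [Finset.mem_insert, Finset.mem_singleton]
      exact hi.imp (fun e => by linarith) (fun e => by linarith)
    · rw [Finset.mem_Ico]
      constructor <;> linarith
  · refine Finset.card_biUnion_le.trans ?_
    calc _ ≤ ∑ _i : Fin d, 2 * (2 ^ n) ^ (d - 1) := by
          refine Finset.sum_le_sum fun i _ => ?_
          rw [Fintype.card_piFinset, ← Finset.mul_prod_erase _ _ (Finset.mem_univ i), if_pos rfl]
          gcongr
          · exact Finset.card_le_two
          · rw [Finset.prod_congr rfl (g := fun _ => 2 ^ n)]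
            · simp
            · intro j hj
              rw [if_neg (Finset.ne_of_mem_erase hj), Int.card_Ico, add_sub_cancel_left]
              norm_cast
      _ = d * (2 * (2 ^ n) ^ (d - 1)) := by simp

theorem two_inv_pow_mul_two_pow (n : ℕ) : (2⁻¹ : ℝ≥0∞) ^ n * 2 ^ n = 1 := by
  rw [← mul_pow, ENNReal.inv_mul_cancel (by norm_num) (by norm_num), one_pow]

theorem DyadicCube.ofReal_len {d : ℕ} (Q : DyadicCube d) :
    ENNReal.ofReal Q.len = (2⁻¹ : ℝ≥0∞) ^ Q.level := by
  rw [DyadicCube.len, ENNReal.ofReal_pow (by norm_num), ENNReal.ofReal_inv_of_pos (by norm_num)]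
  norm_num

theorem DyadicCube.volume_toSet' {d : ℕ} (Q : DyadicCube d) :
    volume Q.toSet = ((2⁻¹ : ℝ≥0∞) ^ Q.level) ^ d := by
  rw [Q.volume_toSet, Q.ofReal_len]

theorem DyadicCube.volume_toSet_ne_zero {d : ℕ} (Q : DyadicCube d) : volume Q.toSet ≠ 0 := by
  rw [Q.volume_toSet]
  simp [Q.len_pos]

theorem DyadicCube.volume_toSet_ne_top {d : ℕ} (Q : DyadicCube d) : volume Q.toSet ≠ ⊤ := by
  rw [Q.volume_toSet]
  simp

/-- A selected cube has 2^(nd) descendants at depth n, each with 2^(-nd) of its volume. -/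
theorem tsum_level_le {d k : ℕ} (hk : 1 ≤ k) (H : DyadicCube d → ℝ≥0∞) :
    ∑' m : Fin d → ℤ, volume (⟨k, m⟩ : DyadicCube d).toSet *
        H (⟨k, m⟩ : DyadicCube d).selectedAncestor ≤
      ∑' r : Fin d → ℤ, volume (⟨2 ^ Nat.log 2 k, r⟩ : DyadicCube d).toSet *
        H ⟨2 ^ Nat.log 2 k, r⟩ := by
  have hkn := DyadicCube.level_eq_add_depth (P := (⟨k, 0⟩ : DyadicCube d)) hk
  simp only [DyadicCube.depth] at hkn
  have h := tsum_fiber_le (fun (m : Fin d → ℤ) i => m i / 2 ^ (k - 2 ^ Nat.log 2 k)) univ _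
    (exists_finset_idx_div _) fun r => H ⟨2 ^ Nat.log 2 k, r⟩
  simp only [indicator_univ] at h
  simp only [DyadicCube.volume_toSet', ENNReal.tsum_mul_left]
  set n := k - 2 ^ Nat.log 2 k with hn
  calc _ ≤ ((2⁻¹ : ℝ≥0∞) ^ k) ^ d * ((((2 ^ n) ^ d : ℕ) : ℝ≥0∞) *
        ∑' r : Fin d → ℤ, H ⟨2 ^ Nat.log 2 k, r⟩) := mul_le_mul_right h _
    _ = _ := by
      rw [← mul_assoc]
      congr 1
      push_cast
      rw [← mul_pow]
      congr 1
      conv_lhs => rw [hkn]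
      rw [pow_add, mul_assoc, two_inv_pow_mul_two_pow, mul_one]

/-- The same volume count restricted to boundary cubes gains the decay 2^(-n) in the depth n; this
is what makes the sum over the unselected levels converge. -/
theorem tsum_level_boundary_le {d k : ℕ} (hd : 1 ≤ d) (hk : 1 ≤ k) (H : DyadicCube d → ℝ≥0∞) :
    ∑' m : Fin d → ℤ, {P : DyadicCube d | P.IsBoundary}.indicator
      (fun P => volume P.toSet * H P.selectedAncestor) ⟨k, m⟩ ≤
      2 * d * 2⁻¹ ^ (k - 2 ^ Nat.log 2 k) *
        ∑' r : Fin d → ℤ, volume (⟨2 ^ Nat.log 2 k, r⟩ : DyadicCube d).toSet *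
          H ⟨2 ^ Nat.log 2 k, r⟩ := by
  have hkn := DyadicCube.level_eq_add_depth (P := (⟨k, 0⟩ : DyadicCube d)) hk
  simp only [DyadicCube.depth] at hkn
  have h := tsum_fiber_le (fun (m : Fin d → ℤ) i => m i / 2 ^ (k - 2 ^ Nat.log 2 k)) _ _
    (exists_finset_idx_boundary _) fun r => H ⟨2 ^ Nat.log 2 k, r⟩
  have e : ∀ m : Fin d → ℤ, {P : DyadicCube d | P.IsBoundary}.indicator
      (fun P => volume P.toSet * H P.selectedAncestor) ⟨k, m⟩ = ((2⁻¹ : ℝ≥0∞) ^ k) ^ d *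
      {m : Fin d → ℤ | ∃ i, m i % 2 ^ (k - 2 ^ Nat.log 2 k) = 0 ∨
        m i % 2 ^ (k - 2 ^ Nat.log 2 k) = 2 ^ (k - 2 ^ Nat.log 2 k) - 1}.indicator
      (fun m => H ⟨2 ^ Nat.log 2 k, fun i => m i / 2 ^ (k - 2 ^ Nat.log 2 k)⟩) m := by
    intro m
    by_cases hm : (⟨k, m⟩ : DyadicCube d).IsBoundary
    · have hm' : m ∈ {m : Fin d → ℤ | ∃ i, m i % 2 ^ (k - 2 ^ Nat.log 2 k) = 0 ∨
        m i % 2 ^ (k - 2 ^ Nat.log 2 k) = 2 ^ (k - 2 ^ Nat.log 2 k) - 1} := hm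
      rw [indicator_of_mem hm', indicator_of_mem (show _ ∈ {P : DyadicCube d | P.IsBoundary}
        from hm), DyadicCube.volume_toSet']
      rfl
    · have hm' : m ∉ {m : Fin d → ℤ | ∃ i, m i % 2 ^ (k - 2 ^ Nat.log 2 k) = 0 ∨
        m i % 2 ^ (k - 2 ^ Nat.log 2 k) = 2 ^ (k - 2 ^ Nat.log 2 k) - 1} := hm
      rw [indicator_of_notMem hm', indicator_of_notMem
        (show _ ∉ {P : DyadicCube d | P.IsBoundary} from hm), mul_zero]
  rw [tsum_congr e]
  simp only [DyadicCube.volume_toSet', ENNReal.tsum_mul_left]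
  set n := k - 2 ^ Nat.log 2 k with hn
  calc _ ≤ ((2⁻¹ : ℝ≥0∞) ^ k) ^ d * (((d * (2 * (2 ^ n) ^ (d - 1)) : ℕ) : ℝ≥0∞) *
        ∑' r : Fin d → ℤ, H ⟨2 ^ Nat.log 2 k, r⟩) := mul_le_mul_right h _
    _ = _ := by
      simp only [← mul_assoc]
      congr 1
      push_cast
      obtain ⟨b, rfl⟩ : ∃ b, d = b + 1 := ⟨d - 1, by omega⟩
      rw [Nat.add_sub_cancel]
      conv_lhs => rw [hkn]
      rw [pow_add (2⁻¹ : ℝ≥0∞), mul_pow]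
      have h1 : ((2⁻¹ : ℝ≥0∞) ^ n) ^ (b + 1) * (2 ^ n) ^ b = 2⁻¹ ^ n := by
        rw [pow_succ, mul_right_comm, ← mul_pow, two_inv_pow_mul_two_pow, one_pow, one_mul]
      calc _ = ((2⁻¹ : ℝ≥0∞) ^ 2 ^ Nat.log 2 k) ^ (b + 1) * ((b + 1 : ℕ) : ℝ≥0∞) * 2 *
            (((2⁻¹ : ℝ≥0∞) ^ n) ^ (b + 1) * (2 ^ n) ^ b) := by push_cast; ring
        _ = _ := by rw [h1]; push_cast; ring

theorem tsum_dyadicCube {d : ℕ} (F : DyadicCube d → ℝ≥0∞) :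
    ∑' P, F P = ∑' (k : ℕ) (m : Fin d → ℤ), F ⟨k, m⟩ := by
  rw [← (DyadicCube.equivProd d).tsum_eq, ENNReal.tsum_prod']
  rfl

theorem tsum_cubesOfLevel {d k : ℕ} (F : DyadicCube d → ℝ≥0∞) :
    ∑' Q : CubesOfLevel d k, F Q.1 = ∑' m : Fin d → ℤ, F ⟨k, m⟩ := by
  let e : (Fin d → ℤ) ≃ CubesOfLevel d k :=
    { toFun := fun m => ⟨⟨k, m⟩, rfl⟩
      invFun := fun Q => Q.1.idx
      left_inv := fun _ => rfl
      right_inv := by rintro ⟨⟨_, _⟩, rfl⟩; rfl }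
  rw [← e.tsum_eq]
  rfl

/-! ### Sums over pairs of neighboring cubes -/

open Classical in
/-- The neighbors of level at least one. -/
def DyadicCube.fineNear {d : ℕ} (P : DyadicCube d) : Finset (DyadicCube d) :=
  P.nearFinset.filter fun Q => 1 ≤ Q.level

theorem DyadicCube.mem_fineNear {d : ℕ} {P Q : DyadicCube d} :
    Q ∈ P.fineNear ↔ P.Near Q ∧ 1 ≤ Q.level := by
  rw [DyadicCube.fineNear, Finset.mem_filter, DyadicCube.mem_nearFinset]

theorem DyadicCube.card_fineNear_le {d : ℕ} (P : DyadicCube d) :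
    P.fineNear.card ≤ 3 * 4 ^ d :=
  (Finset.card_filter_le _ _).trans P.card_nearFinset_le

/-- Nearness is symmetric but the restriction to level at least one falls only on `Q`. After the
exchange it becomes the indicator, and `P` runs over all near cubes, including level zero. -/
theorem tsum_sum_fineNear_eq {d : ℕ} (F : DyadicCube d → DyadicCube d → ℝ≥0∞) :
    ∑' P, ∑ Q ∈ P.fineNear, F P Q =
      ∑' Q, {Q : DyadicCube d | 1 ≤ Q.level}.indicator
        (fun Q => ∑ P ∈ Q.nearFinset, F P Q) Q := by
  simp only [sum_eq_tsum_indicator_ennreal]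
  rw [ENNReal.tsum_comm]
  refine tsum_congr fun Q => ?_
  by_cases hQ : 1 ≤ Q.level
  · rw [indicator_of_mem (show Q ∈ {Q : DyadicCube d | 1 ≤ Q.level} from hQ)]
    refine tsum_congr fun P => ?_
    by_cases h : P.Near Q
    · rw [indicator_of_mem (Finset.mem_coe.2 (DyadicCube.mem_fineNear.2 ⟨h, hQ⟩)),
        indicator_of_mem (Finset.mem_coe.2 (DyadicCube.mem_nearFinset.2 h.symm))]
    · rw [indicator_of_notMem fun h' => h (DyadicCube.mem_fineNear.1 (Finset.mem_coe.1 h')).1,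
        indicator_of_notMem fun h' => h (DyadicCube.mem_nearFinset.1 (Finset.mem_coe.1 h')).symm]
  · rw [indicator_of_notMem (show Q ∉ {Q : DyadicCube d | 1 ≤ Q.level} from hQ)]
    refine ENNReal.tsum_eq_zero.2 fun P => ?_
    rw [indicator_of_notMem fun h' => hQ (DyadicCube.mem_fineNear.1 (Finset.mem_coe.1 h')).2]

theorem tsum_sum_fineNear_le {d : ℕ} (G : DyadicCube d → ℝ≥0∞) :
    ∑' P : DyadicCube d, ∑ Q ∈ P.fineNear, G Q ≤
      (3 * 4 ^ d : ℕ) * ∑' Q, {Q : DyadicCube d | 1 ≤ Q.level}.indicator G Q := by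
  rw [tsum_sum_fineNear_eq, ← ENNReal.tsum_mul_left]
  refine ENNReal.tsum_le_tsum fun Q => ?_
  by_cases hQ : Q ∈ {Q : DyadicCube d | 1 ≤ Q.level}
  · rw [indicator_of_mem hQ, indicator_of_mem hQ, Finset.sum_const, nsmul_eq_mul]
    gcongr
    exact Q.card_nearFinset_le
  · simp [indicator_of_notMem hQ]

theorem volume_le_of_near {d : ℕ} {P Q : DyadicCube d} (h : P.Near Q) :
    volume P.toSet ≤ 2 ^ d * volume Q.toSet := by
  have hl : P.len ≤ 2 * Q.len := DyadicCube.len_le_two_mul h.2.1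
  rw [P.volume_toSet, Q.volume_toSet, ← mul_pow]
  gcongr
  calc ENNReal.ofReal P.len ≤ ENNReal.ofReal (2 * Q.len) := ENNReal.ofReal_le_ofReal hl
    _ = 2 * ENNReal.ofReal Q.len := by rw [ENNReal.ofReal_mul (by norm_num)]; norm_num

/-- The logarithmic part of the weight on the cubes of level `k`. -/
def logWeight (lam : ℝ) (k : ℕ) : ℝ≥0∞ := ENNReal.ofReal (((k : ℝ) + 2) ^ lam)

theorem logWeight_le {lam : ℝ} (hlam : 0 ≤ lam) {k l : ℕ} (h : k ≤ 2 * l + 2) :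
    logWeight lam k ≤ ENNReal.ofReal (2 ^ lam) * logWeight lam l := by
  unfold logWeight
  rw [← ENNReal.ofReal_mul (by positivity), ← Real.mul_rpow (by norm_num) (by positivity)]
  refine ENNReal.ofReal_le_ofReal (Real.rpow_le_rpow (by positivity) ?_ hlam)
  have : (k : ℝ) ≤ 2 * l + 2 := by exact_mod_cast h
  linarith

theorem logWeight_mul_volume_le {d : ℕ} {lam : ℝ} (hlam : 0 ≤ lam) {P Q : DyadicCube d}
    (h : P.Near Q) : logWeight lam P.level * volume P.toSet ≤
      ENNReal.ofReal (2 ^ lam) * 2 ^ d * (logWeight lam Q.level * volume Q.toSet) := by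
  calc logWeight lam P.level * volume P.toSet
      ≤ (ENNReal.ofReal (2 ^ lam) * logWeight lam Q.level) * (2 ^ d * volume Q.toSet) :=
        mul_le_mul' (logWeight_le hlam (by have := h.1; omega)) (volume_le_of_near h)
    _ = _ := by ring

/-! ### The energy of neighboring differences -/

/-- The local contribution of a cube to the Besov energy. -/
def localEnergy {d : ℕ} (p : ℝ) (f : EuclideanSpace ℝ (Fin d) → ℝ) (R : DyadicCube d) : ℝ≥0∞ :=
  ∑' Q' : {Q' : DyadicCube d // SelectedNeighbor Q' R},
    ENNReal.ofReal (|cubeAvg f R - cubeAvg f Q'.1| ^ p)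

theorem besovEnergy_eq {d : ℕ} (p lam : ℝ) (f : EuclideanSpace ℝ (Fin d) → ℝ) :
    besovEnergy p lam f = ∑' j : ℕ, logWeight lam (2 ^ j) *
      ∑' r : Fin d → ℤ, volume (⟨2 ^ j, r⟩ : DyadicCube d).toSet *
        localEnergy p f ⟨2 ^ j, r⟩ := by
  unfold besovEnergy logWeight
  refine tsum_congr fun j => ?_
  rw [← tsum_cubesOfLevel (fun Q => volume Q.toSet * localEnergy p f Q)]
  push_cast
  rfl

/-- Every k ≥ 1 is 2^j + n with j its binary logarithm, so k is recovered from (j, n); the geometric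
series in n contributes the factor 2. -/
theorem tsum_log_le (T : ℕ → ℝ≥0∞) :
    ∑' k : ℕ, {k : ℕ | 1 ≤ k}.indicator
      (fun k => 2⁻¹ ^ (k - 2 ^ Nat.log 2 k) * T (Nat.log 2 k)) k ≤ 2 * ∑' j, T j := by
  have h := tsum_fiber_le (fun k : ℕ => (Nat.log 2 k, k - 2 ^ Nat.log 2 k)) {k : ℕ | 1 ≤ k} 1
    (fun r => ⟨{2 ^ r.1 + r.2}, ?_, by simp⟩) fun r => 2⁻¹ ^ r.2 * T r.1
  · refine h.trans ?_
    rw [Nat.cast_one, one_mul, ENNReal.tsum_prod']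
    simp only [ENNReal.tsum_mul_right, ENNReal.tsum_mul_left]
    rw [ENNReal.tsum_geometric, ENNReal.one_sub_inv_two, inv_inv]
  · rintro k hk rfl
    have : 2 ^ Nat.log 2 k ≤ k := Nat.pow_log_le_self 2 (Nat.one_le_iff_ne_zero.1 hk)
    rw [Finset.mem_singleton]
    dsimp only
    omega

theorem tsum_boundary_energy_le {d : ℕ} (hd : 1 ≤ d) {lam : ℝ} (hlam : 0 ≤ lam) (p : ℝ)
    (f : EuclideanSpace ℝ (Fin d) → ℝ) :
    ∑' P, {P : DyadicCube d | 1 ≤ P.level ∧ P.IsBoundary}.indicator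
      (fun P => logWeight lam P.level * volume P.toSet * localEnergy p f P.selectedAncestor) P ≤
      ENNReal.ofReal (2 ^ lam) * (2 * d) * 2 * besovEnergy p lam f := by
  rw [tsum_dyadicCube, besovEnergy_eq]
  set T : ℕ → ℝ≥0∞ := fun j => logWeight lam (2 ^ j) *
      ∑' r : Fin d → ℤ, volume (⟨2 ^ j, r⟩ : DyadicCube d).toSet *
        localEnergy p f ⟨2 ^ j, r⟩ with hT
  calc _ ≤ ∑' k : ℕ, ENNReal.ofReal (2 ^ lam) * (2 * d) * {k : ℕ | 1 ≤ k}.indicator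
          (fun k => 2⁻¹ ^ (k - 2 ^ Nat.log 2 k) * T (Nat.log 2 k)) k := by
        refine ENNReal.tsum_le_tsum fun k => ?_
        by_cases hk : 1 ≤ k
        · rw [indicator_of_mem (show k ∈ {k : ℕ | 1 ≤ k} from hk)]
          have e : ∀ m : Fin d → ℤ, {P : DyadicCube d | 1 ≤ P.level ∧ P.IsBoundary}.indicator
              (fun P => logWeight lam P.level * volume P.toSet *
                localEnergy p f P.selectedAncestor) ⟨k, m⟩ = logWeight lam k *
              {P : DyadicCube d | P.IsBoundary}.indicator
                (fun P => volume P.toSet * localEnergy p f P.selectedAncestor) ⟨k, m⟩ := by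
            intro m
            by_cases hm : (⟨k, m⟩ : DyadicCube d).IsBoundary
            · rw [indicator_of_mem (show _ ∈ {P : DyadicCube d | P.IsBoundary} from hm),
                indicator_of_mem (show _ ∈ {P : DyadicCube d | 1 ≤ P.level ∧ P.IsBoundary}
                  from ⟨hk, hm⟩), mul_assoc]
            · rw [indicator_of_notMem (show _ ∉ {P : DyadicCube d | P.IsBoundary} from hm),
                indicator_of_notMem (show _ ∉ {P : DyadicCube d | 1 ≤ P.level ∧ P.IsBoundary}
                  from fun h => hm h.2), mul_zero]
          simp only [e, ENNReal.tsum_mul_left]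
          have hlt : k < 2 ^ (Nat.log 2 k + 1) := Nat.lt_pow_succ_log_self (by norm_num) k
          rw [pow_succ] at hlt
          refine (mul_le_mul' (logWeight_le hlam (l := 2 ^ Nat.log 2 k) (by omega))
            (tsum_level_boundary_le hd hk (localEnergy p f))).trans_eq ?_
          simp only [hT]
          ring
        · have e : ∀ m : Fin d → ℤ, (⟨k, m⟩ : DyadicCube d) ∉
              {P : DyadicCube d | 1 ≤ P.level ∧ P.IsBoundary} := fun m h => hk h.1
          simp [e]
    _ ≤ _ := by
        rw [ENNReal.tsum_mul_left, mul_assoc _ (2 : ℝ≥0∞) (∑' j, _)]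
        exact mul_le_mul_right (tsum_log_le T) _

/-- For a boundary cube each difference is one term of the local energy of its ancestor; for any
other cube the two ancestors coincide and the difference is zero. Bounding each term by the whole
local energy costs only the number of neighbors. -/
theorem sum_fineNear_le_localEnergy {d : ℕ} (hd : 1 ≤ d) {p : ℝ} (hp : 0 < p)
    (f : EuclideanSpace ℝ (Fin d) → ℝ) {P : DyadicCube d} (hP : 1 ≤ P.level) :
    ∑ Q ∈ P.fineNear, {Q : DyadicCube d | Nat.log 2 Q.level ≤ Nat.log 2 P.level}.indicator
      (fun Q => ENNReal.ofReal
        (|cubeAvg f P.selectedAncestor - cubeAvg f Q.selectedAncestor| ^ p)) Q ≤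
      (3 * 4 ^ d : ℕ) * {P : DyadicCube d | P.IsBoundary}.indicator
        (fun P => localEnergy p f P.selectedAncestor) P := by
  have key : ∀ Q ∈ P.fineNear, {Q : DyadicCube d | Nat.log 2 Q.level ≤
      Nat.log 2 P.level}.indicator (fun Q => ENNReal.ofReal
        (|cubeAvg f P.selectedAncestor - cubeAvg f Q.selectedAncestor| ^ p)) Q ≤
      {P : DyadicCube d | P.IsBoundary}.indicator
        (fun P => localEnergy p f P.selectedAncestor) P := by
    intro Q hQ
    obtain ⟨hn, hQ1⟩ := DyadicCube.mem_fineNear.1 hQ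
    by_cases hl : Nat.log 2 Q.level ≤ Nat.log 2 P.level
    · rw [indicator_of_mem (show Q ∈ {Q : DyadicCube d | Nat.log 2 Q.level ≤ Nat.log 2 P.level} from hl)]
      by_cases hb : P.IsBoundary
      · rw [indicator_of_mem (show P ∈ {P : DyadicCube d | P.IsBoundary} from hb)]
        exact ENNReal.le_tsum (f := fun Q' : {Q' : DyadicCube d //
          SelectedNeighbor Q' P.selectedAncestor} => ENNReal.ofReal
          (|cubeAvg f P.selectedAncestor - cubeAvg f Q'.1| ^ p))
          ⟨Q.selectedAncestor, DyadicCube.selectedNeighbor_of_near hn hP hQ1 hl⟩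
      · rw [DyadicCube.selectedAncestor_eq_of_near hd hn hP hQ1 hl hb, sub_self, abs_zero,
          Real.zero_rpow hp.ne', ENNReal.ofReal_zero]
        exact zero_le
    · rw [indicator_of_notMem (show Q ∉ {Q : DyadicCube d | Nat.log 2 Q.level ≤ Nat.log 2 P.level} from hl)]
      exact zero_le
  refine (Finset.sum_le_card_nsmul _ _ _ key).trans ?_
  rw [nsmul_eq_mul]
  gcongr
  exact P.card_fineNear_le

/-- The sum of the differences over all neighboring pairs of fine cubes is controlled by the Besov
energy. -/
theorem tsum_near_energy_le {d : ℕ} (hd : 1 ≤ d) {p lam : ℝ} (hp : 0 < p) (hlam : 0 ≤ lam)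
    (f : EuclideanSpace ℝ (Fin d) → ℝ) :
    ∑' P, {P : DyadicCube d | 1 ≤ P.level}.indicator (fun P => logWeight lam P.level *
      volume P.toSet * ∑ Q ∈ P.fineNear, ENNReal.ofReal
        (|cubeAvg f P.selectedAncestor - cubeAvg f Q.selectedAncestor| ^ p)) P ≤
      (1 + ENNReal.ofReal (2 ^ lam) * 2 ^ d) * ((3 * 4 ^ d : ℕ) *
        (ENNReal.ofReal (2 ^ lam) * (2 * d) * 2)) * besovEnergy p lam f := by
  set D : DyadicCube d → DyadicCube d → ℝ≥0∞ := fun P Q => ENNReal.ofReal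
    (|cubeAvg f P.selectedAncestor - cubeAvg f Q.selectedAncestor| ^ p) with hD
  have hsymm : ∀ P Q, D P Q = D Q P := fun P Q => by simp only [hD, abs_sub_comm]
  -- The pairs are split by which cube lies in the later block. `A` has the order required by the
  -- Besov energy; `B` has the reverse order and is reduced to `A` by exchanging the roles of the
  -- cubes, since weights and volumes of near cubes are comparable.
  set A : ℝ≥0∞ := ∑' P, {P : DyadicCube d | 1 ≤ P.level}.indicator (fun P => logWeight lam P.level *
      volume P.toSet * ∑ Q ∈ P.fineNear, {Q : DyadicCube d | Nat.log 2 Q.level ≤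
        Nat.log 2 P.level}.indicator (D P) Q) P with hA
  have hAle : A ≤ (3 * 4 ^ d : ℕ) * (ENNReal.ofReal (2 ^ lam) * (2 * d) * 2 *
      besovEnergy p lam f) := by
    refine le_trans ?_ (mul_le_mul_right (tsum_boundary_energy_le hd hlam p f) _)
    rw [← ENNReal.tsum_mul_left]
    refine ENNReal.tsum_le_tsum fun P => ?_
    by_cases hP : 1 ≤ P.level
    · rw [indicator_of_mem (show P ∈ {P : DyadicCube d | 1 ≤ P.level} from hP)]
      refine (mul_le_mul_right (sum_fineNear_le_localEnergy hd hp f hP) _).trans_eq ?_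
      by_cases hb : P.IsBoundary
      · rw [indicator_of_mem (show P ∈ {P : DyadicCube d | P.IsBoundary} from hb),
          indicator_of_mem (show P ∈ {P : DyadicCube d | 1 ≤ P.level ∧ P.IsBoundary} from ⟨hP, hb⟩)]
        ring
      · rw [indicator_of_notMem (show P ∉ {P : DyadicCube d | P.IsBoundary} from hb),
          indicator_of_notMem (show P ∉ {P : DyadicCube d | 1 ≤ P.level ∧ P.IsBoundary} from fun h => hb h.2)]
        ring
    · rw [indicator_of_notMem (show P ∉ {P : DyadicCube d | 1 ≤ P.level} from hP)]
      exact zero_le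
  set B : ℝ≥0∞ := ∑' P, {P : DyadicCube d | 1 ≤ P.level}.indicator (fun P => logWeight lam P.level *
      volume P.toSet * ∑ Q ∈ P.fineNear, {Q : DyadicCube d | Nat.log 2 P.level ≤
        Nat.log 2 Q.level}.indicator (D P) Q) P with hB
  have hBle : B ≤ ENNReal.ofReal (2 ^ lam) * 2 ^ d * A := by
    have e1 : B = ∑' P : DyadicCube d, ∑ Q ∈ P.fineNear,
        {P : DyadicCube d | 1 ≤ P.level ∧ Nat.log 2 P.level ≤ Nat.log 2 Q.level}.indicator
          (fun P => logWeight lam P.level * volume P.toSet * D P Q) P := by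
      rw [hB]
      refine tsum_congr fun P => ?_
      by_cases hP : 1 ≤ P.level
      · rw [indicator_of_mem (show P ∈ {P : DyadicCube d | 1 ≤ P.level} from hP), Finset.mul_sum]
        refine Finset.sum_congr rfl fun Q _ => ?_
        by_cases hl : Nat.log 2 P.level ≤ Nat.log 2 Q.level
        · rw [indicator_of_mem (show Q ∈ {Q : DyadicCube d | Nat.log 2 P.level ≤ Nat.log 2 Q.level} from hl),
            indicator_of_mem (show P ∈ {P : DyadicCube d | 1 ≤ P.level ∧ Nat.log 2 P.level ≤ Nat.log 2 Q.level} from ⟨hP, hl⟩)]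
        · rw [indicator_of_notMem (show Q ∉ {Q : DyadicCube d | Nat.log 2 P.level ≤ Nat.log 2 Q.level} from hl),
            indicator_of_notMem (show P ∉ {P : DyadicCube d | 1 ≤ P.level ∧ Nat.log 2 P.level ≤ Nat.log 2 Q.level} from fun h => hl h.2),
            mul_zero]
      · rw [indicator_of_notMem (show P ∉ {P : DyadicCube d | 1 ≤ P.level} from hP)]
        symm
        refine Finset.sum_eq_zero fun Q _ => ?_
        rw [indicator_of_notMem (show P ∉ {P : DyadicCube d | 1 ≤ P.level ∧ Nat.log 2 P.level ≤ Nat.log 2 Q.level} from fun h => hP h.1)]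
    rw [e1, tsum_sum_fineNear_eq, hA, ← ENNReal.tsum_mul_left]
    refine ENNReal.tsum_le_tsum fun Q => ?_
    by_cases hQ : 1 ≤ Q.level
    · rw [indicator_of_mem (show Q ∈ {P : DyadicCube d | 1 ≤ P.level} from hQ),
        indicator_of_mem (show Q ∈ {P : DyadicCube d | 1 ≤ P.level} from hQ), Finset.mul_sum,
        Finset.mul_sum]
      rw [← Finset.sum_subset (Finset.filter_subset _ _ : Q.fineNear ⊆ Q.nearFinset)]
      · refine Finset.sum_le_sum fun P hP => ?_
        by_cases hl : Nat.log 2 P.level ≤ Nat.log 2 Q.level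
        · rw [indicator_of_mem (show P ∈ {P : DyadicCube d | Nat.log 2 P.level ≤ Nat.log 2 Q.level} from hl),
            indicator_of_mem (show P ∈ {P : DyadicCube d | 1 ≤ P.level ∧ Nat.log 2 P.level ≤ Nat.log 2 Q.level} from
              ⟨(DyadicCube.mem_fineNear.1 hP).2, hl⟩), hsymm P Q, ← mul_assoc]
          exact mul_le_mul_left
            (logWeight_mul_volume_le hlam (DyadicCube.mem_fineNear.1 hP).1.symm) _
        · rw [indicator_of_notMem (show P ∉ {P : DyadicCube d | 1 ≤ P.level ∧ Nat.log 2 P.level ≤ Nat.log 2 Q.level} from fun h => hl h.2)]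
          exact zero_le
      · intro P hP hP'
        rw [indicator_of_notMem]
        exact fun h => hP' (DyadicCube.mem_fineNear.2 ⟨DyadicCube.mem_nearFinset.1 hP, h.1⟩)
    · rw [indicator_of_notMem (show Q ∉ {P : DyadicCube d | 1 ≤ P.level} from hQ)]
      exact zero_le
  calc _ ≤ A + B := by
        rw [hA, hB, ← ENNReal.tsum_add]
        refine ENNReal.tsum_le_tsum fun P => ?_
        by_cases hP : 1 ≤ P.level
        · simp only [indicator_of_mem (show P ∈ {P : DyadicCube d | 1 ≤ P.level} from hP)]
          rw [← mul_add, ← Finset.sum_add_distrib]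
          refine mul_le_mul_right (Finset.sum_le_sum fun Q _ => ?_) _
          obtain hl | hl := le_total (Nat.log 2 Q.level) (Nat.log 2 P.level)
          · rw [indicator_of_mem (show Q ∈ {Q : DyadicCube d | Nat.log 2 Q.level ≤ _} from hl)]
            exact le_self_add
          · rw [indicator_of_mem (show Q ∈ {Q : DyadicCube d | _ ≤ Nat.log 2 Q.level} from hl)]
            exact le_add_self
        · rw [indicator_of_notMem (show P ∉ {P : DyadicCube d | 1 ≤ P.level} from hP)]
          exact zero_le
    _ ≤ A + ENNReal.ofReal (2 ^ lam) * 2 ^ d * A := by gcongr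
    _ = (1 + ENNReal.ofReal (2 ^ lam) * 2 ^ d) * A := by ring
    _ ≤ (1 + ENNReal.ofReal (2 ^ lam) * 2 ^ d) * ((3 * 4 ^ d : ℕ) *
        (ENNReal.ofReal (2 ^ lam) * (2 * d) * 2 * besovEnergy p lam f)) := by gcongr
    _ = _ := by ring

/-! ### Averages over cubes -/

theorem DyadicCube.mem_toSet_iff {d : ℕ} {Q : DyadicCube d} {x : EuclideanSpace ℝ (Fin d)} :
    x ∈ Q.toSet ↔ ∀ i, Q.idx i = ⌈x i / Q.len⌉ - 1 := by
  refine forall_congr' fun i => ?_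
  have hQ := Q.len_pos
  rw [eq_sub_iff_add_eq, eq_comm, Int.ceil_eq_iff, lt_div_iff₀ hQ, div_le_iff₀ hQ]
  push_cast
  rw [add_sub_cancel_right, mul_comm, mul_comm Q.len]

theorem tsum_setLIntegral_level_le {d : ℕ} (k : ℕ) (g : EuclideanSpace ℝ (Fin d) → ℝ≥0∞) :
    ∑' r : Fin d → ℤ, ∫⁻ x in (⟨k, r⟩ : DyadicCube d).toSet, g x ≤ ∫⁻ x, g x := by
  rw [← lintegral_iUnion]
  · exact setLIntegral_le_lintegral _ _
  · exact fun r => DyadicCube.measurableSet_toSet _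
  · intro r s hrs
    refine Set.disjoint_left.2 fun x hr hs => hrs (funext fun i => ?_)
    exact (DyadicCube.mem_toSet_iff.1 hr i).trans (DyadicCube.mem_toSet_iff.1 hs i).symm

/-- Jensen's inequality, in the form of monotonicity of Lebesgue norms on a probability space. -/
theorem volume_mul_enorm_cubeAvg_rpow_le {d : ℕ} {p : ℝ} (hp : 1 ≤ p)
    {f : EuclideanSpace ℝ (Fin d) → ℝ} (hf : AEStronglyMeasurable f volume) (Q : DyadicCube d) :
    volume Q.toSet * ‖cubeAvg f Q‖ₑ ^ p ≤ ∫⁻ x in Q.toSet, ‖f x‖ₑ ^ p := by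
  have hp0 : 0 < p := by linarith
  have h0 := Q.volume_toSet_ne_zero
  have ht := Q.volume_toSet_ne_top
  -- `cubeAvg f Q` is by definition the integral against this normalized measure.
  set ν : Measure (EuclideanSpace ℝ (Fin d)) :=
    (volume.restrict Q.toSet univ)⁻¹ • volume.restrict Q.toSet with hν
  have hprob : IsProbabilityMeasure ν := ⟨by
    rw [hν, Measure.smul_apply, Measure.restrict_apply_univ, smul_eq_mul,
      ENNReal.inv_mul_cancel h0 ht]⟩
  have hfν : AEStronglyMeasurable f ν := hf.restrict.smul_measure _
  have h1 : ‖cubeAvg f Q‖ₑ ≤ eLpNorm f (ENNReal.ofReal p) ν := by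
    calc ‖cubeAvg f Q‖ₑ ≤ ∫⁻ x, ‖f x‖ₑ ∂ν := enorm_integral_le_lintegral_enorm _
      _ = eLpNorm f 1 ν := eLpNorm_one_eq_lintegral_enorm.symm
      _ ≤ _ := eLpNorm_le_eLpNorm_of_exponent_le (by simpa using hp) hfν
  have h2 : eLpNorm f (ENNReal.ofReal p) ν ^ p =
      (volume Q.toSet)⁻¹ * ∫⁻ x in Q.toSet, ‖f x‖ₑ ^ p := by
    rw [eLpNorm_eq_lintegral_rpow_enorm_toReal (by simpa using hp0) (by simp),
      ENNReal.toReal_ofReal hp0.le, ← ENNReal.rpow_mul, one_div, inv_mul_cancel₀ hp0.ne',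
      ENNReal.rpow_one, hν, lintegral_smul_measure, Measure.restrict_apply_univ, smul_eq_mul]
  calc volume Q.toSet * ‖cubeAvg f Q‖ₑ ^ p
      ≤ volume Q.toSet * eLpNorm f (ENNReal.ofReal p) ν ^ p := by gcongr
    _ = ∫⁻ x in Q.toSet, ‖f x‖ₑ ^ p := by
      rw [h2, ← mul_assoc, ENNReal.mul_inv_cancel h0 ht, one_mul]

/-- The weight of the Whitney cubes of level `k`, relative to the volume of the base. -/
def lpWeight (p lam : ℝ) (k : ℕ) : ℝ≥0∞ :=
  ENNReal.ofReal (((2 : ℝ)⁻¹ ^ k) ^ p) * logWeight lam k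

theorem tsum_lpWeight_ne_top {p : ℝ} (hp : 1 ≤ p) (lam : ℝ) : ∑' k, lpWeight p lam k ≠ ⊤ := by
  obtain ⟨N, hN⟩ := exists_nat_ge lam
  have hs : Summable fun k : ℕ => ((k : ℝ) + 2) ^ N * (2⁻¹ : ℝ) ^ k := by
    have h1 := (summable_nat_add_iff 2).2
      (summable_pow_mul_geometric_of_norm_lt_one (R := ℝ) N (r := 2⁻¹) (by norm_num))
    -- The factor 4 undoes the shift by two in the exponent of the geometric factor.
    refine (h1.mul_left 4).congr fun k => ?_
    push_cast
    rw [pow_add]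
    ring
  refine ne_top_of_le_ne_top hs.tsum_ofReal_ne_top (ENNReal.tsum_le_tsum fun k => ?_)
  unfold lpWeight logWeight
  rw [← ENNReal.ofReal_mul (by positivity), mul_comm]
  refine ENNReal.ofReal_le_ofReal (mul_le_mul ?_ ?_ (by positivity) (by positivity))
  · rw [← Real.rpow_natCast]
    refine Real.rpow_le_rpow_of_exponent_le ?_ hN
    have : (0 : ℝ) ≤ k := by positivity
    linarith
  · calc ((2 : ℝ)⁻¹ ^ k) ^ p ≤ ((2 : ℝ)⁻¹ ^ k) ^ (1 : ℝ) :=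
          Real.rpow_le_rpow_of_exponent_ge (by positivity)
            (pow_le_one₀ (by norm_num) (by norm_num)) hp
      _ = _ := Real.rpow_one _

/-- Each level costs at most ‖f‖_p^p: pass to the selected level by counting, apply Jensen there,
and use that the cubes of one level are disjoint. -/
theorem tsum_fine_cubeAvg_le {d : ℕ} {p : ℝ} (hp : 1 ≤ p) (lam : ℝ)
    {f : EuclideanSpace ℝ (Fin d) → ℝ} (hf : AEStronglyMeasurable f volume) :
    ∑' Q, {Q : DyadicCube d | 1 ≤ Q.level}.indicator (fun Q =>
      lpWeight p lam Q.level * volume Q.toSet * ‖cubeAvg f Q.selectedAncestor‖ₑ ^ p) Q ≤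
      (∑' k, lpWeight p lam k) * ∫⁻ x, ‖f x‖ₑ ^ p := by
  rw [tsum_dyadicCube, ← ENNReal.tsum_mul_right]
  refine ENNReal.tsum_le_tsum fun k => ?_
  by_cases hk : 1 ≤ k
  · have e : ∀ m : Fin d → ℤ, {Q : DyadicCube d | 1 ≤ Q.level}.indicator (fun Q =>
        lpWeight p lam Q.level * volume Q.toSet * ‖cubeAvg f Q.selectedAncestor‖ₑ ^ p) ⟨k, m⟩ =
        lpWeight p lam k * (volume (⟨k, m⟩ : DyadicCube d).toSet *
          ‖cubeAvg f (⟨k, m⟩ : DyadicCube d).selectedAncestor‖ₑ ^ p) := fun m => by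
      rw [indicator_of_mem (show (⟨k, m⟩ : DyadicCube d) ∈ {Q : DyadicCube d | 1 ≤ Q.level}
        from hk), mul_assoc]
    rw [tsum_congr e, ENNReal.tsum_mul_left]
    refine mul_le_mul_right ((tsum_level_le hk fun R => ‖cubeAvg f R‖ₑ ^ p).trans ?_) _
    refine le_trans (ENNReal.tsum_le_tsum fun r => ?_)
      (tsum_setLIntegral_level_le (2 ^ Nat.log 2 k) fun x => ‖f x‖ₑ ^ p)
    exact volume_mul_enorm_cubeAvg_rpow_le hp hf _
  · have e : ∀ m : Fin d → ℤ, (⟨k, m⟩ : DyadicCube d) ∉ {Q : DyadicCube d | 1 ≤ Q.level} :=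
      fun m h => hk h
    simp [indicator_of_notMem (e _)]

theorem lpWeight_mul_volume_le {d : ℕ} {p lam : ℝ} (hp : 0 ≤ p) (hlam : 0 ≤ lam)
    {P Q : DyadicCube d} (h : P.Near Q) : lpWeight p lam P.level * volume P.toSet ≤
      ENNReal.ofReal (2 ^ p) * (ENNReal.ofReal (2 ^ lam) * 2 ^ d) *
        (lpWeight p lam Q.level * volume Q.toSet) := by
  have hl : P.len ≤ 2 * Q.len := DyadicCube.len_le_two_mul h.2.1
  have h1 : ENNReal.ofReal (((2 : ℝ)⁻¹ ^ P.level) ^ p) ≤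
      ENNReal.ofReal (2 ^ p) * ENNReal.ofReal (((2 : ℝ)⁻¹ ^ Q.level) ^ p) := by
    rw [← ENNReal.ofReal_mul (by positivity), ← Real.mul_rpow (by norm_num) (by positivity)]
    exact ENNReal.ofReal_le_ofReal (Real.rpow_le_rpow (by positivity) hl hp)
  unfold lpWeight
  calc _ = ENNReal.ofReal (((2 : ℝ)⁻¹ ^ P.level) ^ p) *
        (logWeight lam P.level * volume P.toSet) := by ring
    _ ≤ _ := mul_le_mul' h1 (logWeight_mul_volume_le hlam h)
    _ = _ := by ring

theorem tsum_near_cubeAvg_le {d : ℕ} {p lam : ℝ} (hp : 1 ≤ p) (hlam : 0 ≤ lam)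
    {f : EuclideanSpace ℝ (Fin d) → ℝ} (hf : AEStronglyMeasurable f volume) :
    ∑' P : DyadicCube d, lpWeight p lam P.level * volume P.toSet *
        ∑ Q ∈ P.fineNear, ‖cubeAvg f Q.selectedAncestor‖ₑ ^ p ≤
      ENNReal.ofReal (2 ^ p) * (ENNReal.ofReal (2 ^ lam) * 2 ^ d) * (3 * 4 ^ d : ℕ) *
        (∑' k, lpWeight p lam k) * ∫⁻ x, ‖f x‖ₑ ^ p := by
  set K : ℝ≥0∞ := ENNReal.ofReal (2 ^ p) * (ENNReal.ofReal (2 ^ lam) * 2 ^ d) with hK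
  set G : DyadicCube d → ℝ≥0∞ := fun Q =>
    lpWeight p lam Q.level * volume Q.toSet * ‖cubeAvg f Q.selectedAncestor‖ₑ ^ p with hG
  calc _ ≤ ∑' P : DyadicCube d, K * ∑ Q ∈ P.fineNear, G Q := by
        refine ENNReal.tsum_le_tsum fun P => ?_
        rw [Finset.mul_sum, Finset.mul_sum]
        refine Finset.sum_le_sum fun Q hQ => ?_
        rw [hG, ← mul_assoc K]
        exact mul_le_mul_left
          (lpWeight_mul_volume_le (by linarith) hlam (DyadicCube.mem_fineNear.1 hQ).1) _
    _ ≤ K * ((3 * 4 ^ d : ℕ) * ((∑' k, lpWeight p lam k) * ∫⁻ x, ‖f x‖ₑ ^ p)) := by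
        rw [ENNReal.tsum_mul_left]
        refine mul_le_mul_right ((tsum_sum_fineNear_le G).trans ?_) _
        exact mul_le_mul_right (tsum_fine_cubeAvg_le hp lam hf) _
    _ = _ := by ring

/-! ### The extension operator -/

/-- The neighbors of level at least one, as elements of the subtype. -/
def DyadicCube.fineCubes {d : ℕ} (P : DyadicCube d) : Finset (FineCube d) :=
  P.fineNear.subtype fun Q => 1 ≤ Q.level

theorem DyadicCube.mem_fineCubes {d : ℕ} {P : DyadicCube d} {Q : FineCube d} :
    Q ∈ P.fineCubes ↔ P.Near Q.1 := by
  rw [DyadicCube.fineCubes, Finset.mem_subtype, DyadicCube.mem_fineNear]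
  exact and_iff_left Q.2

theorem DyadicCube.sum_fineCubes {d : ℕ} {M : Type*} [AddCommMonoid M] (P : DyadicCube d)
    (g : DyadicCube d → M) : ∑ Q ∈ P.fineCubes, g Q.1 = ∑ Q ∈ P.fineNear, g Q :=
  Finset.sum_subtype_of_mem g fun _ hQ => (DyadicCube.mem_fineNear.1 hQ).2

theorem exists_mem_whitney {d : ℕ} {x : EuclideanSpace ℝ (Fin (d + 1))} (hx : x ∈ upperHalf d)
    (h2 : x (Fin.last d) ≤ 2) : ∃ P : DyadicCube d, x ∈ P.whitney := by
  have hx0 : 0 < x (Fin.last d) := hx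
  obtain ⟨n, hn1, hn2⟩ := exists_nat_pow_near_of_lt_one (x := x (Fin.last d) / 2)
    (y := (2⁻¹ : ℝ)) (by positivity) (by linarith) (by norm_num) (by norm_num)
  refine ⟨⟨n, fun i => ⌈x i.castSucc / (2⁻¹ : ℝ) ^ n⌉ - 1⟩,
    DyadicCube.mem_toSet_iff.2 fun i => rfl, ?_, ?_⟩
  · rw [pow_succ] at hn1
    simp only [DyadicCube.len]
    linarith
  · simp only [DyadicCube.len]
    linarith

theorem DyadicCube.one_le_level_of_mem_whitney {d : ℕ} {P : DyadicCube d}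
    {x : EuclideanSpace ℝ (Fin (d + 1))} (hx : x ∈ P.whitney) (h1 : x (Fin.last d) ≤ 1) :
    1 ≤ P.level := by
  by_contra! h
  have h0 : P.level = 0 := by omega
  have := hx.2.1
  simp only [DyadicCube.len, h0, pow_zero] at this
  linarith

theorem mem_iUnion_whitney {d : ℕ} {x : EuclideanSpace ℝ (Fin (d + 1))} (hx : x ∈ upperHalf d)
    (h1 : x (Fin.last d) ≤ 1) : x ∈ ⋃ Q : FineCube d, Q.1.whitney := by
  obtain ⟨P, hP⟩ := exists_mem_whitney hx (by linarith)
  exact mem_iUnion.2 ⟨⟨P, DyadicCube.one_le_level_of_mem_whitney hP h1⟩, hP⟩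

section

variable {d : ℕ} {L : ℝ≥0} {c : ℝ} {ψ : FineCube d → EuclideanSpace ℝ (Fin (d + 1)) → ℝ}

theorem IsWhitneyPartition.mem_whitneyNhd (hψ : IsWhitneyPartition L c ψ) {Q : FineCube d}
    {x : EuclideanSpace ℝ (Fin (d + 1))} (hx : x ∈ upperHalf d) (h : ψ Q x ≠ 0) :
    x ∈ Q.1.whitneyNhd :=
  hψ.support_subset Q (subset_closure ⟨hx, h⟩)

theorem IsWhitneyPartition.eq_zero_of_notMem_fineCubes (hψ : IsWhitneyPartition L c ψ)
    {P : DyadicCube d} {x : EuclideanSpace ℝ (Fin (d + 1))} (hx : x ∈ P.whitneyNhd)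
    {Q : FineCube d} (hQ : Q ∉ P.fineCubes) : ψ Q x = 0 := by
  by_contra h
  exact hQ (DyadicCube.mem_fineCubes.2 (DyadicCube.near_of_mem_whitneyNhd hx
    (hψ.mem_whitneyNhd (P.whitneyNhd_subset hx) h)))

theorem IsWhitneyPartition.selectedExtension_eq_sum (hψ : IsWhitneyPartition L c ψ)
    (f : EuclideanSpace ℝ (Fin d) → ℝ) {P : DyadicCube d} {x : EuclideanSpace ℝ (Fin (d + 1))}
    (hx : x ∈ P.whitneyNhd) : selectedExtension ψ f x =
      ∑ Q ∈ P.fineCubes, cubeAvg f Q.1.selectedAncestor * ψ Q x :=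
  tsum_eq_sum fun Q hQ => by rw [hψ.eq_zero_of_notMem_fineCubes hx hQ, mul_zero]

/-- The coarsest bumps have edge length 1/2, and 9/4 · 1/2 = 9/8. -/
theorem IsWhitneyPartition.selectedExtension_eq_zero (hψ : IsWhitneyPartition L c ψ)
    (f : EuclideanSpace ℝ (Fin d) → ℝ) {x : EuclideanSpace ℝ (Fin (d + 1))}
    (hx : 9 / 8 < x (Fin.last d)) : selectedExtension ψ f x = 0 := by
  have h : ∀ Q, ψ Q x = 0 := by
    intro Q
    by_contra h
    have hxu : x ∈ upperHalf d := lt_trans (by norm_num) hx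
    have h1 := (DyadicCube.bounds_of_mem_whitneyNhd (hψ.mem_whitneyNhd hxu h)).2.2
    have h2 : Q.1.len ≤ 2⁻¹ ^ 1 := pow_le_pow_of_le_one (by norm_num) (by norm_num) Q.2
    linarith
  simp [selectedExtension, h]

theorem IsWhitneyPartition.sum_fineCubes_eq_one (hψ : IsWhitneyPartition L c ψ)
    {P : DyadicCube d} {x : EuclideanSpace ℝ (Fin (d + 1))} (hx : x ∈ P.whitneyNhd)
    (h1 : x (Fin.last d) ≤ 1) : ∑ Q ∈ P.fineCubes, ψ Q x = 1 :=
  (hasSum_sum_of_ne_finset_zero fun _ hQ => hψ.eq_zero_of_notMem_fineCubes hx hQ).unique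
    (hψ.sum_eq_one x (mem_iUnion_whitney (P.whitneyNhd_subset hx) h1))

theorem IsWhitneyPartition.contDiffOn_selectedExtension (hψ : IsWhitneyPartition L c ψ)
    (f : EuclideanSpace ℝ (Fin d) → ℝ) :
    ContDiffOn ℝ ∞ (selectedExtension ψ f) (upperHalf d) := by
  intro x hx
  refine ContDiffAt.contDiffWithinAt ?_
  by_cases h2 : x (Fin.last d) ≤ 2
  · obtain ⟨P, hP⟩ := exists_mem_whitney hx h2
    have hev : selectedExtension ψ f =ᶠ[𝓝 x]
        fun y => ∑ Q ∈ P.fineCubes, cubeAvg f Q.1.selectedAncestor * ψ Q y := by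
      filter_upwards [P.isOpen_whitneyNhd.mem_nhds (P.whitney_subset_whitneyNhd hP)] with y hy
      exact hψ.selectedExtension_eq_sum f hy
    refine ContDiffAt.congr_of_eventuallyEq ?_ hev
    refine ContDiffAt.sum fun Q _ => contDiffAt_const.mul ?_
    exact (hψ.smooth Q).contDiffAt ((isOpen_upperHalf d).mem_nhds hx)
  · have hev : selectedExtension ψ f =ᶠ[𝓝 x] fun _ => 0 := by
      have ho : IsOpen {y : EuclideanSpace ℝ (Fin (d + 1)) | 9 / 8 < y (Fin.last d)} :=
        isOpen_lt continuous_const (by fun_prop)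
      filter_upwards [ho.mem_nhds (show 9 / 8 < x (Fin.last d) by linarith)] with y hy
      exact hψ.selectedExtension_eq_zero f hy
    exact contDiffAt_const.congr_of_eventuallyEq hev

/-- The constant `a` can be subtracted from all averages wherever the bumps sum to 1. From level two
on, the enlarged Whitney cube stays below height 9/16, where this holds; at levels zero and one only
`a = 0` is available. -/
theorem IsWhitneyPartition.norm_fderiv_selectedExtension_le (hψ : IsWhitneyPartition L c ψ)
    (f : EuclideanSpace ℝ (Fin d) → ℝ) {P : DyadicCube d} {x : EuclideanSpace ℝ (Fin (d + 1))}
    (hx : x ∈ P.whitney) {a : ℝ} (ha : a = 0 ∨ 2 ≤ P.level) :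
    ‖fderiv ℝ (selectedExtension ψ f) x‖ ≤
      2 * L / P.len * ∑ Q ∈ P.fineNear, |cubeAvg f Q.selectedAncestor - a| := by
  have hlen := P.len_pos
  have hxN := P.whitney_subset_whitneyNhd hx
  refine norm_fderiv_le_of_lip' ℝ (by positivity) ?_
  filter_upwards [P.isOpen_whitneyNhd.mem_nhds hxN] with y hy
  have hsum : a * ∑ Q ∈ P.fineCubes, (ψ Q y - ψ Q x) = 0 := by
    obtain ha | ha := ha
    · rw [ha, zero_mul]
    · have h1 : ∀ z ∈ P.whitneyNhd, z (Fin.last d) ≤ 1 := by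
        intro z hz
        have h2 : P.len ≤ 2⁻¹ ^ 2 := pow_le_pow_of_le_one (by norm_num) (by norm_num) ha
        have := (DyadicCube.bounds_of_mem_whitneyNhd hz).2.2
        norm_num at h2
        linarith
      rw [Finset.sum_sub_distrib, hψ.sum_fineCubes_eq_one hy (h1 y hy),
        hψ.sum_fineCubes_eq_one hxN (h1 x hxN), sub_self, mul_zero]
  have e : selectedExtension ψ f y - selectedExtension ψ f x =
      ∑ Q ∈ P.fineCubes, (cubeAvg f Q.1.selectedAncestor - a) * (ψ Q y - ψ Q x) := by
    rw [hψ.selectedExtension_eq_sum f hy, hψ.selectedExtension_eq_sum f hxN,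
      ← Finset.sum_sub_distrib]
    simp only [sub_mul, Finset.sum_sub_distrib, ← Finset.mul_sum, mul_sub] at hsum ⊢
    linarith
  rw [e, ← P.sum_fineCubes fun Q => |cubeAvg f Q.selectedAncestor - a|, Finset.mul_sum,
    Finset.sum_mul]
  refine (norm_sum_le _ _).trans (Finset.sum_le_sum fun Q hQ => ?_)
  have hl : P.len ≤ 2 * Q.1.len :=
    DyadicCube.len_le_two_mul (DyadicCube.mem_fineCubes.1 hQ).2.1
  have hQl := Q.1.len_pos
  have h1 : (L : ℝ) / Q.1.len ≤ 2 * L / P.len := by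
    rw [div_le_div_iff₀ hQl hlen]
    nlinarith [L.coe_nonneg]
  rw [norm_mul, Real.norm_eq_abs, Real.norm_eq_abs]
  calc |cubeAvg f Q.1.selectedAncestor - a| * |ψ Q y - ψ Q x|
      ≤ |cubeAvg f Q.1.selectedAncestor - a| * (2 * L / P.len * ‖y - x‖) := by
        refine mul_le_mul_of_nonneg_left ?_ (abs_nonneg _)
        refine (hψ.lipschitz Q y (P.whitneyNhd_subset hy) x (P.whitneyNhd_subset hxN)).trans ?_
        rw [dist_eq_norm]
        exact mul_le_mul_of_nonneg_right h1 (norm_nonneg _)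
    _ = _ := by ring

end

/-! ### The weak gradient of a smooth function -/

theorem norm_gradient {E : Type*} [NormedAddCommGroup E] [InnerProductSpace ℝ E]
    [CompleteSpace E] (u : E → ℝ) (x : E) : ‖gradient u x‖ = ‖fderiv ℝ u x‖ :=
  LinearIsometryEquiv.norm_map _ _

theorem gradient_coord {n : ℕ} (u : EuclideanSpace ℝ (Fin n) → ℝ) (x : EuclideanSpace ℝ (Fin n))
    (i : Fin n) : gradient u x i = fderiv ℝ u x (EuclideanSpace.single i 1) := by
  have h : inner ℝ (gradient u x) (EuclideanSpace.single i 1) =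
      fderiv ℝ u x (EuclideanSpace.single i 1) := InnerProductSpace.toDual_symm_apply
  rw [← h, EuclideanSpace.inner_single_right]
  simp

/-- Nothing is known about `u` outside `U`, but the product vanishes off the support of `φ`, so it
is continuous with compact support on the whole space. -/
theorem integrable_mul_of_tsupport_subset {n : ℕ} {U : Set (EuclideanSpace ℝ (Fin n))}
    (hU : IsOpen U) {u φ : EuclideanSpace ℝ (Fin n) → ℝ} (hu : ContinuousOn u U)
    (hφ : Continuous φ) (hc : HasCompactSupport φ) (hs : tsupport φ ⊆ U) :
    Integrable (fun x => u x * φ x) := by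
  refine Continuous.integrable_of_hasCompactSupport (continuous_of_tsupport fun x hx => ?_)
    (hc.mul_left (f := u))
  have hxφ : x ∈ tsupport φ := tsupport_mul_subset_right (f := u) (g := φ) hx
  exact (hu.continuousAt (hU.mem_nhds (hs hxφ))).mul hφ.continuousAt

theorem isWeakGradient_gradient {d : ℕ} {u : EuclideanSpace ℝ (Fin (d + 1)) → ℝ}
    (hu : ContDiffOn ℝ ∞ u (upperHalf d)) : IsWeakGradient u (gradient u) := by
  have hU := isOpen_upperHalf d
  have hfd : ContinuousOn (fderiv ℝ u) (upperHalf d) :=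
    hu.continuousOn_fderiv_of_isOpen hU (by simp)
  refine ⟨?_, fun φ hφ hc hs i => ?_⟩
  · exact ((InnerProductSpace.toDual ℝ _).symm.continuous.comp_continuousOn
      hfd).locallyIntegrableOn hU.measurableSet
  · have hz : ∀ x ∉ upperHalf d, φ x = 0 := fun x hx =>
      image_eq_zero_of_notMem_tsupport fun h => hx (hs h)
    have hz' : ∀ x ∉ upperHalf d, fderiv ℝ φ x = 0 := fun x hx =>
      image_eq_zero_of_notMem_tsupport fun h => hx (hs (tsupport_fderiv_subset ℝ h))
    rw [setIntegral_eq_integral_of_forall_compl_eq_zero fun x hx => by simp [hz' x hx],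
      setIntegral_eq_integral_of_forall_compl_eq_zero fun x hx => by simp [hz x hx]]
    simp only [gradient_coord]
    have hφ1 : Continuous fun x => fderiv ℝ φ x (EuclideanSpace.single i 1) :=
      (hφ.continuous_fderiv (by simp)).clm_apply continuous_const
    have hc1 := hc.fderiv_apply (𝕜 := ℝ) (EuclideanSpace.single i (1 : ℝ))
    have hs1 : tsupport (fun x => fderiv ℝ φ x (EuclideanSpace.single i 1)) ⊆ upperHalf d :=
      (tsupport_fderiv_apply_subset ℝ _).trans hs
    refine integral_mul_fderiv_eq_neg_fderiv_mul_of_integrable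
      (integrable_mul_of_tsupport_subset hU (hfd.clm_apply continuousOn_const)
        hφ.continuous hc hs)
      (integrable_mul_of_tsupport_subset hU hu.continuousOn hφ1 hc1 hs1)
      (integrable_mul_of_tsupport_subset hU hu.continuousOn hφ.continuous hc hs) ?_ ?_
    · exact fun x hx => (hu.contDiffAt (hU.mem_nhds (hs hx))).differentiableAt (by simp)
    · exact fun x _ => hφ.differentiable (by simp) x

/-! ### The weighted measure of Whitney cubes -/

theorem log_two_le_one : Real.log 2 ≤ 1 := by linarith [Real.log_two_lt_d9]

/-- Below height one, 4/t ≤ 2^(k+2) makes the logarithm at most (k+2) log 2. Above it, the power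
factor on the right is at least 1 and log 4 ≤ 2. -/
theorem weight_le_of_mem_whitney {d : ℕ} {α lam : ℝ} (hα : 0 ≤ α) (hlam : 0 ≤ lam)
    {P : DyadicCube d} {x : EuclideanSpace ℝ (Fin (d + 1))} (hx : x ∈ P.whitney) :
    weight α lam x ≤ (2 * P.len) ^ α * ((P.level : ℝ) + 2) ^ lam := by
  have hlen := P.len_pos
  obtain ⟨-, h1, h2⟩ := hx
  have ht : 0 < x (Fin.last d) := hlen.trans h1
  have hl2 : 0 < Real.log 2 := Real.log_pos (by norm_num)
  have hl2' := log_two_le_one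
  unfold weight
  rw [abs_of_pos ht]
  split_ifs with h
  · refine mul_le_mul (Real.rpow_le_rpow ht.le h2 hα) (Real.rpow_le_rpow ?_ ?_ hlam)
      (Real.rpow_nonneg ?_ _) (by positivity)
    · exact Real.log_nonneg (by rw [le_div_iff₀ ht]; linarith)
    · calc Real.log (4 / x (Fin.last d)) ≤ Real.log (4 / P.len) :=
            Real.log_le_log (by positivity) (by gcongr)
        _ = Real.log (2 ^ (P.level + 2)) := by
            congr 1
            rw [DyadicCube.len, inv_pow, div_inv_eq_mul, pow_add]
            ring
        _ = (P.level + 2) * Real.log 2 := by rw [Real.log_pow]; push_cast; ring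
        _ ≤ (P.level + 2) * 1 := by gcongr
        _ = _ := mul_one _
    · exact Real.log_nonneg (by rw [le_div_iff₀ ht]; linarith)
  · rw [← one_mul (Real.log 4 ^ lam)]
    have h4 : Real.log 4 = 2 * Real.log 2 := by
      rw [show (4 : ℝ) = 2 ^ 2 by norm_num, Real.log_pow]; norm_num
    refine mul_le_mul (Real.one_le_rpow (by linarith) hα) (Real.rpow_le_rpow ?_ ?_ hlam)
      (Real.rpow_nonneg ?_ _) (by positivity)
    · rw [h4]; positivity
    · have : (0 : ℝ) ≤ P.level := by positivity
      linarith
    · rw [h4]; positivity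

/-- The weight supplies ℓ^(p-1) and the height of the cube one more ℓ. The resulting ℓ^p is exactly
what a gradient of size 1/ℓ needs. -/
theorem weightedMeasure_whitney_le {d : ℕ} {p lam : ℝ} (hp : 1 ≤ p) (hlam : 0 ≤ lam)
    (P : DyadicCube d) : weightedMeasure d (p - 1) lam P.whitney ≤
      ENNReal.ofReal (1 / Real.log 4 ^ lam) * ENNReal.ofReal (2 ^ (p - 1)) *
        (lpWeight p lam P.level * volume P.toSet) := by
  have hlen := P.len_pos
  rw [weightedMeasure, Measure.smul_apply, smul_eq_mul, mul_assoc]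
  refine mul_le_mul_right ?_ _
  rw [withDensity_apply _ P.measurableSet_whitney]
  calc ∫⁻ x in P.whitney, ENNReal.ofReal (weight (p - 1) lam x) ∂volume.restrict (upperHalf d)
      ≤ ∫⁻ x in P.whitney, ENNReal.ofReal
          ((2 * P.len) ^ (p - 1) * ((P.level : ℝ) + 2) ^ lam) ∂volume.restrict (upperHalf d) :=
        setLIntegral_mono' P.measurableSet_whitney fun x hx =>
          ENNReal.ofReal_le_ofReal (weight_le_of_mem_whitney (by linarith) hlam hx)
    _ ≤ ENNReal.ofReal ((2 * P.len) ^ (p - 1) * ((P.level : ℝ) + 2) ^ lam) *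
          volume P.whitney := by
        rw [setLIntegral_const]
        exact mul_le_mul_right (Measure.restrict_apply_le _ _) _
    _ = _ := by
        rw [P.volume_whitney, P.volume_toSet, pow_succ, lpWeight, logWeight,
          Real.mul_rpow (by norm_num) hlen.le, ENNReal.ofReal_mul (by positivity),
          ENNReal.ofReal_mul (by positivity)]
        have e : ENNReal.ofReal (((2 : ℝ)⁻¹ ^ P.level) ^ p) =
            ENNReal.ofReal (P.len ^ (p - 1)) * ENNReal.ofReal P.len := by
          rw [← ENNReal.ofReal_mul (by positivity)]
          congr 1
          rw [← Real.rpow_add_one hlen.ne', sub_add_cancel]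
          rfl
        rw [e]
        ring

/-- Whitney cubes of levels k ≥ 0 cover the strip of heights in (0, 2], which carries the whole
integral. -/
theorem lintegral_weightedMeasure_le {d : ℕ} {α lam : ℝ}
    {F : EuclideanSpace ℝ (Fin (d + 1)) → ℝ≥0∞} {B : DyadicCube d → ℝ≥0∞}
    (hB : ∀ P : DyadicCube d, ∀ x ∈ P.whitney, F x ≤ B P)
    (h0 : ∀ x, 2 < x (Fin.last d) → F x = 0) :
    ∫⁻ x, F x ∂weightedMeasure d α lam ≤ ∑' P, B P * weightedMeasure d α lam P.whitney := by
  have hae : ∀ᵐ x ∂weightedMeasure d α lam,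
      F x ≤ ∑' P : DyadicCube d, P.whitney.indicator (fun _ => B P) x := by
    refine Measure.ae_smul_measure ((withDensity_absolutelyContinuous _ _).ae_le ?_) _
    filter_upwards [ae_restrict_mem (isOpen_upperHalf d).measurableSet] with x hx
    by_cases h2 : x (Fin.last d) ≤ 2
    · obtain ⟨P, hP⟩ := exists_mem_whitney hx h2
      refine le_trans ?_ (ENNReal.le_tsum P)
      rw [indicator_of_mem hP]
      exact hB P x hP
    · rw [h0 x (not_le.1 h2)]
      exact zero_le
  calc _ ≤ ∫⁻ x, ∑' P : DyadicCube d, P.whitney.indicator (fun _ => B P) x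
        ∂weightedMeasure d α lam := lintegral_mono_ae hae
    _ = _ := by
        rw [lintegral_tsum fun P =>
          (measurable_const.indicator P.measurableSet_whitney).aemeasurable]
        refine tsum_congr fun P => ?_
        rw [lintegral_indicator P.measurableSet_whitney, setLIntegral_const]

/-! ### Boundedness of the extension -/

theorem ofReal_abs_rpow {p : ℝ} (hp : 0 ≤ p) (x : ℝ) : ENNReal.ofReal (|x| ^ p) = ‖x‖ₑ ^ p := by
  rw [Real.enorm_eq_ofReal_abs, ENNReal.ofReal_rpow_of_nonneg (abs_nonneg _) hp]

theorem sum_fineNear_rpow_le {d : ℕ} {p : ℝ} (hp : 1 ≤ p) (P : DyadicCube d)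
    (g : DyadicCube d → ℝ≥0∞) : (∑ Q ∈ P.fineNear, g Q) ^ p ≤
      ((3 * 4 ^ d : ℕ) : ℝ≥0∞) ^ (p - 1) * ∑ Q ∈ P.fineNear, g Q ^ p := by
  refine (ENNReal.rpow_sum_le_const_mul_sum_rpow _ _ hp).trans ?_
  have hp' : 0 ≤ p - 1 := by linarith
  gcongr
  exact P.card_fineNear_le

section

variable {d : ℕ} {L : ℝ≥0} {c : ℝ} {ψ : FineCube d → EuclideanSpace ℝ (Fin (d + 1)) → ℝ}

theorem IsWhitneyPartition.enorm_selectedExtension_rpow_le (hψ : IsWhitneyPartition L c ψ)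
    {p : ℝ} (hp : 1 ≤ p) (f : EuclideanSpace ℝ (Fin d) → ℝ) {P : DyadicCube d}
    {x : EuclideanSpace ℝ (Fin (d + 1))} (hx : x ∈ P.whitney) :
    ‖selectedExtension ψ f x‖ₑ ^ p ≤ ((3 * 4 ^ d : ℕ) : ℝ≥0∞) ^ (p - 1) *
      ∑ Q ∈ P.fineNear, ‖cubeAvg f Q.selectedAncestor‖ₑ ^ p := by
  have hxN := P.whitney_subset_whitneyNhd hx
  refine le_trans ?_ (sum_fineNear_rpow_le hp P fun Q => ‖cubeAvg f Q.selectedAncestor‖ₑ)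
  refine ENNReal.rpow_le_rpow ?_ (by linarith)
  rw [hψ.selectedExtension_eq_sum f hxN,
    ← P.sum_fineCubes fun Q => ‖cubeAvg f Q.selectedAncestor‖ₑ]
  refine (enorm_sum_le _ _).trans (Finset.sum_le_sum fun Q _ => ?_)
  rw [enorm_mul]
  have h1 := hψ.mem_Icc Q x (P.whitneyNhd_subset hxN)
  have h2 : ‖ψ Q x‖ₑ ≤ 1 := by
    rw [Real.enorm_eq_ofReal h1.1]
    exact ENNReal.ofReal_le_one.2 h1.2
  calc _ ≤ ‖cubeAvg f Q.1.selectedAncestor‖ₑ * 1 := by gcongr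
    _ = _ := mul_one _

theorem IsWhitneyPartition.enorm_gradient_rpow_le (hψ : IsWhitneyPartition L c ψ)
    {p : ℝ} (hp : 1 ≤ p) (f : EuclideanSpace ℝ (Fin d) → ℝ) {P : DyadicCube d}
    {x : EuclideanSpace ℝ (Fin (d + 1))} (hx : x ∈ P.whitney) {a : ℝ}
    (ha : a = 0 ∨ 2 ≤ P.level) :
    ‖gradient (selectedExtension ψ f) x‖ₑ ^ p * ENNReal.ofReal (((2 : ℝ)⁻¹ ^ P.level) ^ p) ≤
      ENNReal.ofReal (2 * L) ^ p * ((3 * 4 ^ d : ℕ) : ℝ≥0∞) ^ (p - 1) *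
      ∑ Q ∈ P.fineNear, ‖cubeAvg f Q.selectedAncestor - a‖ₑ ^ p := by
  have hp0 : 0 ≤ p := by linarith
  have hlen := P.len_pos
  have h1 : ‖gradient (selectedExtension ψ f) x‖ₑ * ENNReal.ofReal P.len ≤
      ENNReal.ofReal (2 * L) * ∑ Q ∈ P.fineNear, ‖cubeAvg f Q.selectedAncestor - a‖ₑ := by
    have e : ∑ Q ∈ P.fineNear, ‖cubeAvg f Q.selectedAncestor - a‖ₑ =
        ENNReal.ofReal (∑ Q ∈ P.fineNear, |cubeAvg f Q.selectedAncestor - a|) := by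
      rw [ENNReal.ofReal_sum_of_nonneg fun _ _ => abs_nonneg _]
      simp only [Real.enorm_eq_ofReal_abs]
    rw [← ofReal_norm, norm_gradient, e, ← ENNReal.ofReal_mul (norm_nonneg _),
      ← ENNReal.ofReal_mul (by positivity)]
    refine ENNReal.ofReal_le_ofReal ?_
    calc _ ≤ (2 * L / P.len * ∑ Q ∈ P.fineNear, |cubeAvg f Q.selectedAncestor - a|) * P.len :=
          mul_le_mul_of_nonneg_right (hψ.norm_fderiv_selectedExtension_le f hx ha) hlen.le
      _ = _ := by field_simp
  change _ * ENNReal.ofReal (P.len ^ p) ≤ _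
  rw [← ENNReal.ofReal_rpow_of_nonneg hlen.le hp0, ← ENNReal.mul_rpow_of_nonneg _ _ hp0,
    mul_assoc]
  refine (ENNReal.rpow_le_rpow h1 hp0).trans ?_
  rw [ENNReal.mul_rpow_of_nonneg _ _ hp0]
  exact mul_le_mul_right (sum_fineNear_rpow_le hp P _) _

end

theorem lintegral_selectedExtension_le (d : ℕ) {p lam : ℝ} (hp : 1 ≤ p) (hlam : 0 ≤ lam) :
    ∃ K : ℝ≥0∞, K ≠ ⊤ ∧ ∀ (L : ℝ≥0) (c : ℝ)
      (ψ : FineCube d → EuclideanSpace ℝ (Fin (d + 1)) → ℝ), IsWhitneyPartition L c ψ →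
      ∀ f : EuclideanSpace ℝ (Fin d) → ℝ, AEStronglyMeasurable f volume →
        ∫⁻ x, ‖selectedExtension ψ f x‖ₑ ^ p ∂weightedMeasure d (p - 1) lam ≤
          K * ∫⁻ x, ‖f x‖ₑ ^ p := by
  set A : ℝ≥0∞ := ENNReal.ofReal (1 / Real.log 4 ^ lam) * ENNReal.ofReal (2 ^ (p - 1)) with hA
  set N : ℝ≥0∞ := ((3 * 4 ^ d : ℕ) : ℝ≥0∞) ^ (p - 1) with hN
  set B : ℝ≥0∞ := ENNReal.ofReal (2 ^ p) * (ENNReal.ofReal (2 ^ lam) * 2 ^ d) *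
    (3 * 4 ^ d : ℕ) * (∑' k, lpWeight p lam k) with hB
  have hAt : A ≠ ⊤ := ENNReal.mul_ne_top ENNReal.ofReal_ne_top ENNReal.ofReal_ne_top
  have hNt : N ≠ ⊤ := ENNReal.rpow_ne_top_of_nonneg (by linarith) (ENNReal.natCast_ne_top _)
  have hBt : B ≠ ⊤ := by
    refine ENNReal.mul_ne_top (ENNReal.mul_ne_top (ENNReal.mul_ne_top ENNReal.ofReal_ne_top
      (ENNReal.mul_ne_top ENNReal.ofReal_ne_top (by simp))) (ENNReal.natCast_ne_top _))
      (tsum_lpWeight_ne_top hp lam)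
  refine ⟨N * A * B, ENNReal.mul_ne_top (ENNReal.mul_ne_top hNt hAt) hBt,
    fun L c ψ hψ f hf => ?_⟩
  refine (lintegral_weightedMeasure_le
    (fun P x hx => hψ.enorm_selectedExtension_rpow_le hp f hx) fun x hx => ?_).trans ?_
  · rw [hψ.selectedExtension_eq_zero f (by linarith), enorm_zero,
      ENNReal.zero_rpow_of_pos (by linarith)]
  · calc _ ≤ ∑' P : DyadicCube d, N * A * (lpWeight p lam P.level * volume P.toSet *
          ∑ Q ∈ P.fineNear, ‖cubeAvg f Q.selectedAncestor‖ₑ ^ p) := by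
          refine ENNReal.tsum_le_tsum fun P => ?_
          refine (mul_le_mul_right (weightedMeasure_whitney_le hp hlam P) _).trans_eq ?_
          rw [← hA, ← hN]
          ring
      _ ≤ N * A * (B * ∫⁻ x, ‖f x‖ₑ ^ p) := by
          rw [ENNReal.tsum_mul_left]
          exact mul_le_mul_right (tsum_near_cubeAvg_le hp hlam hf) _
      _ = _ := by ring

theorem lintegral_gradient_le {d : ℕ} (hd : 1 ≤ d) {p lam : ℝ} (hp : 1 ≤ p) (hlam : 0 ≤ lam)
    (L : ℝ≥0) :
    ∃ K : ℝ≥0∞, K ≠ ⊤ ∧ ∀ (c : ℝ)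
      (ψ : FineCube d → EuclideanSpace ℝ (Fin (d + 1)) → ℝ), IsWhitneyPartition L c ψ →
      ∀ f : EuclideanSpace ℝ (Fin d) → ℝ, AEStronglyMeasurable f volume →
        ∫⁻ x, ‖gradient (selectedExtension ψ f) x‖ₑ ^ p ∂weightedMeasure d (p - 1) lam ≤
          K * (besovEnergy p lam f + ∫⁻ x, ‖f x‖ₑ ^ p) := by
  have hp0 : 0 < p := by linarith
  set A : ℝ≥0∞ := ENNReal.ofReal (1 / Real.log 4 ^ lam) * ENNReal.ofReal (2 ^ (p - 1)) with hA
  set N : ℝ≥0∞ := ENNReal.ofReal (2 * L) ^ p * ((3 * 4 ^ d : ℕ) : ℝ≥0∞) ^ (p - 1) with hN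
  set B : ℝ≥0∞ := ENNReal.ofReal (2 ^ p) * (ENNReal.ofReal (2 ^ lam) * 2 ^ d) *
    (3 * 4 ^ d : ℕ) * (∑' k, lpWeight p lam k) with hB
  set D : ℝ≥0∞ := (1 + ENNReal.ofReal (2 ^ lam) * 2 ^ d) * ((3 * 4 ^ d : ℕ) *
        (ENNReal.ofReal (2 ^ lam) * (2 * d) * 2)) with hD
  have hAt : A ≠ ⊤ := ENNReal.mul_ne_top ENNReal.ofReal_ne_top ENNReal.ofReal_ne_top
  have hNt : N ≠ ⊤ := ENNReal.mul_ne_top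
    (ENNReal.rpow_ne_top_of_nonneg hp0.le ENNReal.ofReal_ne_top)
    (ENNReal.rpow_ne_top_of_nonneg (by linarith) (ENNReal.natCast_ne_top _))
  have hBt : B ≠ ⊤ := by
    refine ENNReal.mul_ne_top (ENNReal.mul_ne_top (ENNReal.mul_ne_top ENNReal.ofReal_ne_top
      (ENNReal.mul_ne_top ENNReal.ofReal_ne_top (by simp))) (ENNReal.natCast_ne_top _))
      (tsum_lpWeight_ne_top hp lam)
  have hDt : D ≠ ⊤ := by
    refine ENNReal.mul_ne_top (ENNReal.add_ne_top.2 ⟨by simp,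
      ENNReal.mul_ne_top ENNReal.ofReal_ne_top (by simp)⟩)
      (ENNReal.mul_ne_top (ENNReal.natCast_ne_top _)
      (ENNReal.mul_ne_top (ENNReal.mul_ne_top ENNReal.ofReal_ne_top ?_) (by simp)))
    exact ENNReal.mul_ne_top (by simp) (ENNReal.natCast_ne_top _)
  refine ⟨N * A * (D + ENNReal.ofReal (2 ^ p) * B), ENNReal.mul_ne_top (ENNReal.mul_ne_top hNt hAt)
    (ENNReal.add_ne_top.2 ⟨hDt, ENNReal.mul_ne_top ENNReal.ofReal_ne_top hBt⟩),
    fun c ψ hψ f hf => ?_⟩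
  set w : DyadicCube d → ℝ≥0∞ := fun P => ENNReal.ofReal (((2 : ℝ)⁻¹ ^ P.level) ^ p) with hw
  have hw0 : ∀ P, w P ≠ 0 := fun P => by
    rw [hw]
    simpa using Real.rpow_pos_of_pos (x := (2 ^ P.level)⁻¹) (by positivity) p
  have hwt : ∀ P, w P ≠ ⊤ := fun P => ENNReal.ofReal_ne_top
  -- One bound serves all levels: the first summand handles level at least two, with `a` the average
  -- over the ancestor of `P`. The second handles levels zero and one, with `a = 0`; there `2 ^ p *
  -- w P ≥ 1`, so inserting that factor is harmless and gives the sum the summable weight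
  -- `lpWeight`.
  set S : DyadicCube d → ℝ≥0∞ := fun P =>
    {P : DyadicCube d | 1 ≤ P.level}.indicator (fun P => ∑ Q ∈ P.fineNear, ENNReal.ofReal
        (|cubeAvg f P.selectedAncestor - cubeAvg f Q.selectedAncestor| ^ p)) P +
    ENNReal.ofReal (2 ^ p) * w P * ∑ Q ∈ P.fineNear, ‖cubeAvg f Q.selectedAncestor‖ₑ ^ p with hS
  have hpt : ∀ P : DyadicCube d, ∀ x ∈ P.whitney,
      ‖gradient (selectedExtension ψ f) x‖ₑ ^ p ≤ N * S P / w P := by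
    intro P x hx
    rw [ENNReal.le_div_iff_mul_le (Or.inl (hw0 P)) (Or.inl (hwt P))]
    by_cases h2 : 2 ≤ P.level
    · refine (hψ.enorm_gradient_rpow_le hp f hx
        (a := cubeAvg f P.selectedAncestor) (Or.inr h2)).trans (mul_le_mul_right ?_ _)
      refine le_add_right ?_
      rw [indicator_of_mem (show P ∈ {P : DyadicCube d | 1 ≤ P.level} from
        le_trans one_le_two h2)]
      refine Finset.sum_le_sum fun Q _ => ?_
      rw [ofReal_abs_rpow hp0.le, ← enorm_neg, neg_sub]
    · refine (hψ.enorm_gradient_rpow_le hp f hx (a := 0) (Or.inl rfl)).trans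
        (mul_le_mul_right ?_ _)
      refine le_add_left ?_
      have h1 : 1 ≤ ENNReal.ofReal (2 ^ p) * w P := by
        rw [hw, ← ENNReal.ofReal_mul (by positivity),
          ← Real.mul_rpow (by norm_num) (by positivity), ENNReal.one_le_ofReal]
        refine Real.one_le_rpow ?_ hp0.le
        have : (2 : ℝ)⁻¹ ^ 1 ≤ 2⁻¹ ^ P.level :=
          pow_le_pow_of_le_one (by norm_num) (by norm_num) (by omega)
        linarith
      simp only [sub_zero]
      exact le_mul_of_one_le_left' h1
  refine (lintegral_weightedMeasure_le hpt fun x hx => ?_).trans ?_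
  · have hev : selectedExtension ψ f =ᶠ[𝓝 x] fun _ => 0 := by
      have ho : IsOpen {y : EuclideanSpace ℝ (Fin (d + 1)) | 9 / 8 < y (Fin.last d)} :=
        isOpen_lt continuous_const (by fun_prop)
      filter_upwards [ho.mem_nhds (show 9 / 8 < x (Fin.last d) by linarith)] with y hy
      exact hψ.selectedExtension_eq_zero f hy
    rw [← ofReal_norm, norm_gradient, hev.fderiv_eq]
    simp [hp0]
  · calc _ ≤ ∑' P : DyadicCube d, N * A * (
          {P : DyadicCube d | 1 ≤ P.level}.indicator (fun P => logWeight lam P.level *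
            volume P.toSet * ∑ Q ∈ P.fineNear, ENNReal.ofReal
            (|cubeAvg f P.selectedAncestor - cubeAvg f Q.selectedAncestor| ^ p)) P +
          ENNReal.ofReal (2 ^ p) * (lpWeight p lam P.level * volume P.toSet *
            ∑ Q ∈ P.fineNear, ‖cubeAvg f Q.selectedAncestor‖ₑ ^ p)) := by
          refine ENNReal.tsum_le_tsum fun P => ?_
          refine (mul_le_mul_right (weightedMeasure_whitney_le hp hlam P) _).trans_eq ?_
          -- Here ℓ^(-p) from the gradient cancels ℓ^p from the measure, leaving the purely
          -- logarithmic weight of the Besov energy.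
          have e1 : N * S P / w P * (A * (lpWeight p lam P.level * volume P.toSet)) =
              N * A * (S P * (logWeight lam P.level * volume P.toSet)) := by
            have : lpWeight p lam P.level = w P * logWeight lam P.level := rfl
            calc _ = N * S P / w P * w P * (A * (logWeight lam P.level * volume P.toSet)) := by
                  rw [this]; ring
              _ = _ := by rw [ENNReal.div_mul_cancel (hw0 P) (hwt P)]; ring
          rw [← hA, e1, hS]
          have e2 : lpWeight p lam P.level = w P * logWeight lam P.level := rfl
          rw [e2]
          by_cases h : 1 ≤ P.level
          · simp only [indicator_of_mem (show P ∈ {P : DyadicCube d | 1 ≤ P.level} from h)]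
            ring
          · simp only [indicator_of_notMem (show P ∉ {P : DyadicCube d | 1 ≤ P.level} from h)]
            ring
      _ ≤ N * A * (D * besovEnergy p lam f +
            ENNReal.ofReal (2 ^ p) * (B * ∫⁻ x, ‖f x‖ₑ ^ p)) := by
          rw [ENNReal.tsum_mul_left, ENNReal.tsum_add, ENNReal.tsum_mul_left]
          refine mul_le_mul_right (add_le_add ?_ (mul_le_mul_right ?_ _)) _
          · exact tsum_near_energy_le hd hp0 hlam f
          · exact tsum_near_cubeAvg_le hp hlam hf
      _ ≤ N * A * ((D + ENNReal.ofReal (2 ^ p) * B) *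
            (besovEnergy p lam f + ∫⁻ x, ‖f x‖ₑ ^ p)) := by
          refine mul_le_mul_right ?_ _
          rw [add_mul, mul_add, mul_add, ← mul_assoc (ENNReal.ofReal (2 ^ p))]
          exact add_le_add le_self_add le_add_self
      _ = _ := by ring

theorem eLpNorm_ofReal_eq {α E : Type*} [MeasurableSpace α] [NormedAddCommGroup E] {p : ℝ}
    (hp : 0 < p) (g : α → E) (μ : Measure α) :
    eLpNorm g (ENNReal.ofReal p) μ = (∫⁻ x, ‖g x‖ₑ ^ p ∂μ) ^ (1 / p) := by
  rw [eLpNorm_eq_lintegral_rpow_enorm_toReal (by simpa using hp) (by simp),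
    ENNReal.toReal_ofReal hp.le]

theorem exists_sobolevNorm_selectedExtension_le {d : ℕ} (hd : 1 ≤ d) {p lam : ℝ} (hp : 1 ≤ p)
    (hlam : 0 ≤ lam) (L : ℝ≥0) :
    ∃ C : ℝ≥0, ∀ (c : ℝ)
      (ψ : FineCube d → EuclideanSpace ℝ (Fin (d + 1)) → ℝ), IsWhitneyPartition L c ψ →
      ∀ f : EuclideanSpace ℝ (Fin d) → ℝ, AEStronglyMeasurable f volume →
        sobolevNorm p (p - 1) lam (selectedExtension ψ f) ≤ C * besovNorm p lam f := by
  have hp0 : 0 < p := by linarith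
  have hp1 : 0 ≤ 1 / p := by positivity
  obtain ⟨K₁, hK₁, h₁⟩ := lintegral_selectedExtension_le d hp hlam
  obtain ⟨K₂, hK₂, h₂⟩ := lintegral_gradient_le hd hp hlam L
  have ht : K₁ ^ (1 / p) + K₂ ^ (1 / p) ≠ ⊤ := ENNReal.add_ne_top.2
    ⟨ENNReal.rpow_ne_top_of_nonneg hp1 hK₁, ENNReal.rpow_ne_top_of_nonneg hp1 hK₂⟩
  refine ⟨(K₁ ^ (1 / p) + K₂ ^ (1 / p)).toNNReal, fun c ψ hψ f hf => ?_⟩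
  rw [ENNReal.coe_toNNReal ht]
  have hG : (⨅ (G : EuclideanSpace ℝ (Fin (d + 1)) → EuclideanSpace ℝ (Fin (d + 1)))
      (_ : IsWeakGradient (selectedExtension ψ f) G),
        eLpNorm G (ENNReal.ofReal p) (weightedMeasure d (p - 1) lam)) ≤
      eLpNorm (gradient (selectedExtension ψ f)) (ENNReal.ofReal p)
        (weightedMeasure d (p - 1) lam) :=
    iInf₂_le _ (isWeakGradient_gradient (hψ.contDiffOn_selectedExtension f))
  refine (add_le_add_right hG _).trans ?_
  rw [besovNorm, eLpNorm_ofReal_eq hp0, eLpNorm_ofReal_eq hp0, eLpNorm_ofReal_eq hp0, add_mul]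
  refine add_le_add ?_ ?_
  · refine (ENNReal.rpow_le_rpow (h₁ L c ψ hψ f hf) hp1).trans ?_
    rw [ENNReal.mul_rpow_of_nonneg _ _ hp1]
    exact mul_le_mul_right le_self_add _
  · refine (ENNReal.rpow_le_rpow (h₂ c ψ hψ f hf) hp1).trans ?_
    rw [ENNReal.mul_rpow_of_nonneg _ _ hp1]
    refine mul_le_mul_right ?_ _
    rw [add_comm (besovEnergy p lam f)]
    -- The power 1/p is subadditive because 1/p ≤ 1.
    exact ENNReal.rpow_add_le_add_rpow _ _ hp1 (by rw [div_le_one hp0]; exact hp)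

/-! ### The trace of the extension -/

theorem DyadicCube.integrableOn_toSet {d : ℕ} {f : EuclideanSpace ℝ (Fin d) → ℝ}
    (hf : LocallyIntegrable f volume) (Q : DyadicCube d) : IntegrableOn f Q.toSet volume := by
  refine IntegrableOn.mono_set (hf.integrableOn_isCompact
    (isCompact_closedBall (WithLp.toLp 2 fun i => Q.len * (Q.idx i : ℝ)) (d * Q.len))) ?_
  intro x hx
  refine dist_le_of_abs_coord_le Q.len_pos.le fun i => ?_
  obtain ⟨h1, h2⟩ := hx i
  rw [abs_le]
  constructor <;> simp only <;> linarith [Q.len_pos]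

/-- Enlarging the domain of integration from the cube to the ball costs the ratio of volumes, which
does not depend on the size of the cube. -/
theorem abs_cubeAvg_sub_le {d : ℕ} {f : EuclideanSpace ℝ (Fin d) → ℝ}
    (hf : LocallyIntegrable f volume) (R : DyadicCube d) {x : EuclideanSpace ℝ (Fin d)} {K : ℝ}
    (hK : 0 < K) (hR : R.toSet ⊆ Metric.closedBall x (K * R.len)) :
    |cubeAvg f R - f x| ≤ K ^ d * volume.real (Metric.ball (0 : EuclideanSpace ℝ (Fin d)) 1) *
      ⨍ y in Metric.closedBall x (K * R.len), ‖f y - f x‖ := by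
  have hlen := R.len_pos
  have hint := R.integrableOn_toSet hf
  have hvR : volume.real R.toSet = R.len ^ d := by
    rw [Measure.real, R.volume_toSet, ENNReal.toReal_pow, ENNReal.toReal_ofReal hlen.le]
  have hconst : IntegrableOn (fun _ => f x) R.toSet volume :=
    integrableOn_const R.volume_toSet_ne_top
  have h1 : cubeAvg f R - f x = ⨍ y in R.toSet, (f y - f x) := by
    have hc : ⨍ _ in R.toSet, f x = f x :=
      setAverage_const R.volume_toSet_ne_zero R.volume_toSet_ne_top _
    conv_lhs => rw [← hc]
    rw [cubeAvg, setAverage_eq, setAverage_eq, setAverage_eq, integral_sub hint hconst, smul_sub]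
  have hball : IntegrableOn (fun y => ‖f y - f x‖) (Metric.closedBall x (K * R.len)) volume :=
    ((hf.integrableOn_isCompact (isCompact_closedBall _ _)).sub
      (integrableOn_const measure_closedBall_lt_top.ne)).norm
  have hV : 0 < volume.real (Metric.ball (0 : EuclideanSpace ℝ (Fin d)) 1) :=
    ENNReal.toReal_pos (Metric.measure_ball_pos _ _ one_pos).ne' measure_ball_lt_top.ne
  calc |cubeAvg f R - f x| = (R.len ^ d)⁻¹ * ‖∫ y in R.toSet, (f y - f x)‖ := by
        rw [h1, setAverage_eq, hvR, smul_eq_mul, abs_mul, abs_of_pos (by positivity),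
          Real.norm_eq_abs]
    _ ≤ (R.len ^ d)⁻¹ * ∫ y in Metric.closedBall x (K * R.len), ‖f y - f x‖ := by
        refine mul_le_mul_of_nonneg_left ((norm_integral_le_integral_norm _).trans ?_)
          (by positivity)
        exact setIntegral_mono_set hball (Eventually.of_forall fun y => norm_nonneg _)
          hR.eventuallyLE
    _ = _ := by
        rw [setAverage_eq, Measure.addHaar_real_closedBall _ _ (by positivity), smul_eq_mul]
        simp only [finrank_euclideanSpace, Fintype.card_fin]
        rw [mul_pow]
        field_simp

/-- In each coordinate the distance is at most the edge of the ancestor plus the edge of `P`, and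
`P.len ≤ 2 * Q.len`; hence the factor 3. -/
theorem selectedAncestor_toSet_subset_closedBall {d : ℕ} {P Q : DyadicCube d} (h : P.Near Q)
    (hQ : 1 ≤ Q.level) {x : EuclideanSpace ℝ (Fin d)} (hx : x ∈ P.toSet) :
    Q.selectedAncestor.toSet ⊆
      Metric.closedBall x (3 * (d + 1) * Q.selectedAncestor.len) := by
  have hS := Q.selectedAncestor.len_pos
  have hPQ : P.len ≤ 2 * Q.len := DyadicCube.len_le_two_mul h.2.1
  have hQS : Q.len ≤ Q.selectedAncestor.len :=
    DyadicCube.len_le_of_level_le (Nat.pow_log_le_self 2 (by omega))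
  intro y hy
  have hlow : ∀ i, Q.selectedAncestor.len * Q.selectedAncestor.idx i ≤ Q.len * Q.idx i ∧
      Q.len * (Q.idx i + 1) ≤
        Q.selectedAncestor.len * (Q.selectedAncestor.idx i + 1) := by
    -- The inclusion of half-open cubes passes to closures; evaluating it at the two extreme corners
    -- of `Q` compares the faces.
    have hcl : ∀ z : EuclideanSpace ℝ (Fin d), z ∈ closure Q.toSet →
        ∀ i, Q.selectedAncestor.len * Q.selectedAncestor.idx i ≤ z i ∧
          z i ≤ Q.selectedAncestor.len * (Q.selectedAncestor.idx i + 1) := by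
      intro z hz i
      have hclosed : IsClosed {z : EuclideanSpace ℝ (Fin d) |
          Q.selectedAncestor.len * Q.selectedAncestor.idx i ≤ z i ∧
          z i ≤ Q.selectedAncestor.len * (Q.selectedAncestor.idx i + 1)} :=
        isClosed_Icc.preimage
          (show Continuous fun z : EuclideanSpace ℝ (Fin d) => z i by fun_prop)
      refine closure_minimal (fun w hw => ?_) hclosed hz
      have := Q.subset_selectedAncestor hQ hw i
      exact ⟨this.1.le, this.2⟩
    have hQl := Q.len_pos
    intro i
    exact ⟨(hcl (WithLp.toLp 2 fun i => Q.len * Q.idx i)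
        (mem_closure_toSet fun i => ⟨le_rfl, by nlinarith⟩) i).1,
      (hcl (WithLp.toLp 2 fun i => Q.len * (Q.idx i + 1))
        (mem_closure_toSet fun i => ⟨by nlinarith, le_rfl⟩) i).2⟩
  have hd := dist_le_of_abs_coord_le (x := y) (y := x) (r := 3 * Q.selectedAncestor.len)
    (by positivity) fun i => by
      obtain ⟨a1, a2⟩ := hx i
      obtain ⟨b1, b2⟩ := hy i
      obtain ⟨c1, c2⟩ := hlow i
      obtain ⟨e1, e2⟩ := h.2.2 i
      rw [abs_le]
      constructor <;> linarith
  refine hd.trans ?_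
  nlinarith

theorem approxTrace_eq {d : ℕ} (k : ℕ) (u : EuclideanSpace ℝ (Fin (d + 1)) → ℝ)
    {Q : DyadicCube d} (hQ : Q.level = k) {x : EuclideanSpace ℝ (Fin d)} (hx : x ∈ Q.toSet) :
    approxTrace k u x = ⨍ y in Q.whitneyNhd, u y := by
  rw [approxTrace, tsum_eq_single ⟨Q, hQ⟩, indicator_of_mem hx]
  rintro ⟨R, hR⟩ hne
  refine indicator_of_notMem (fun hxR => hne ?_) _
  rw [Subtype.mk.injEq, DyadicCube.ext_iff']
  have hl : R.len = Q.len := by simp only [DyadicCube.len, hR, hQ]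
  refine ⟨hR.trans hQ.symm, funext fun i => ?_⟩
  have h1 := DyadicCube.mem_toSet_iff.1 hxR i
  rw [hl] at h1
  exact h1.trans (DyadicCube.mem_toSet_iff.1 hx i).symm

theorem DyadicCube.volume_whitneyNhd_ne_zero {d : ℕ} (Q : DyadicCube d) :
    volume Q.whitneyNhd ≠ 0 :=
  (Q.isOpen_whitneyNhd.measure_pos _ (Q.whitney_nonempty.mono Q.whitney_subset_whitneyNhd)).ne'

theorem DyadicCube.volume_whitneyNhd_ne_top {d : ℕ} (Q : DyadicCube d) :
    volume Q.whitneyNhd ≠ ⊤ := by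
  obtain ⟨w, hw⟩ := Q.whitney_nonempty
  obtain ⟨b1, b2, b3⟩ := DyadicCube.bounds_of_mem_whitneyNhd (Q.whitney_subset_whitneyNhd hw)
  have hsub : Q.whitneyNhd ⊆ Metric.closedBall w ((d + 1 : ℕ) * (3 / 2 * Q.len)) := by
    intro y hy
    obtain ⟨c1, c2, c3⟩ := DyadicCube.bounds_of_mem_whitneyNhd hy
    have hl := Q.len_pos
    refine dist_le_of_abs_coord_le (by positivity) fun i => ?_
    rw [abs_le]
    induction i using Fin.lastCases with
    | last => constructor <;> linarith
    | cast i =>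
      have := b1 i
      have := c1 i
      constructor <;> linarith
  exact ((measure_mono hsub).trans_lt measure_closedBall_lt_top).ne

theorem IsWhitneyPartition.hasTrace {d : ℕ} {L : ℝ≥0} {c : ℝ}
    {ψ : FineCube d → EuclideanSpace ℝ (Fin (d + 1)) → ℝ} (hψ : IsWhitneyPartition L c ψ)
    {f : EuclideanSpace ℝ (Fin d) → ℝ} (hf : LocallyIntegrable f volume) :
    HasTrace (selectedExtension ψ f) f := by
  set K : ℝ := 3 * (d + 1) with hK
  have hKpos : 0 < K := by positivity
  filter_upwards [IsUnifLocDoublingMeasure.ae_tendsto_average_norm_sub volume hf 1] with x hx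
  have hlim : Tendsto (fun i : ℕ => K * (2 : ℝ)⁻¹ ^ i) atTop (𝓝[>] 0) := by
    refine tendsto_nhdsWithin_iff.2 ⟨?_, Eventually.of_forall fun i => ?_⟩
    · simpa using (tendsto_pow_atTop_nhds_zero_of_lt_one (r := (2 : ℝ)⁻¹)
        (by norm_num) (by norm_num)).const_mul K
    · rw [mem_Ioi]; positivity
  have hM := (hx (fun _ => x) _ hlim (Eventually.of_forall fun i =>
    Metric.mem_closedBall_self (by positivity))).const_mul
      (K ^ d * volume.real (Metric.ball (0 : EuclideanSpace ℝ (Fin d)) 1))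
  rw [mul_zero] at hM
  rw [Metric.tendsto_atTop']
  intro ε hε
  obtain ⟨i₀, hi₀⟩ := eventually_atTop.1 (hM.eventually (gt_mem_nhds (half_pos hε)))
  -- A selected level exceeds half the level of the cube, and a near cube has level at least k - 1,
  -- so all ancestors involved have level at least `i₀`.
  refine ⟨2 * i₀ + 2, fun k hk => ?_⟩
  set Q : DyadicCube d := ⟨k, fun i => ⌈x i / (2⁻¹ : ℝ) ^ k⌉ - 1⟩ with hQ
  have hxQ : x ∈ Q.toSet := DyadicCube.mem_toSet_iff.2 fun i => rfl
  have hQlev : Q.level = k := rfl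
  have hclose : ∀ y ∈ Q.whitneyNhd, |selectedExtension ψ f y - f x| ≤ ε / 2 := by
    intro y hy
    have hy1 : y (Fin.last d) ≤ 1 := by
      have h2 : Q.len ≤ 2⁻¹ ^ 2 :=
        pow_le_pow_of_le_one (by norm_num) (by norm_num) (by omega)
      have := (DyadicCube.bounds_of_mem_whitneyNhd hy).2.2
      norm_num at h2
      linarith
    have hone := hψ.sum_fineCubes_eq_one hy hy1
    have e : selectedExtension ψ f y - f x =
        ∑ R ∈ Q.fineCubes, (cubeAvg f R.1.selectedAncestor - f x) * ψ R y := by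
      rw [hψ.selectedExtension_eq_sum f hy]
      simp only [sub_mul, Finset.sum_sub_distrib, ← Finset.mul_sum, hone, mul_one]
    rw [e]
    calc |∑ R ∈ Q.fineCubes, (cubeAvg f R.1.selectedAncestor - f x) * ψ R y|
        ≤ ∑ R ∈ Q.fineCubes, |(cubeAvg f R.1.selectedAncestor - f x) * ψ R y| :=
          Finset.abs_sum_le_sum_abs _ _
      _ ≤ ∑ R ∈ Q.fineCubes, ε / 2 * ψ R y := by
          refine Finset.sum_le_sum fun R hR => ?_
          have hnear := DyadicCube.mem_fineCubes.1 hR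
          have h0 := (hψ.mem_Icc R y (Q.whitneyNhd_subset hy)).1
          rw [abs_mul, abs_of_nonneg h0]
          refine mul_le_mul_of_nonneg_right ?_ h0
          have hlev : i₀ ≤ R.1.selectedAncestor.level := by
            have h1 : R.1.level < 2 ^ (Nat.log 2 R.1.level + 1) :=
              Nat.lt_pow_succ_log_self (by norm_num) _
            have h2 := hnear.1
            rw [pow_succ] at h1
            simp only [DyadicCube.selectedAncestor]
            omega
          exact (abs_cubeAvg_sub_le hf _ hKpos
            (selectedAncestor_toSet_subset_closedBall hnear R.2 hxQ)).trans (hi₀ _ hlev).le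
      _ = ε / 2 := by rw [← Finset.mul_sum, hone, mul_one]
  have hmem : ⨍ y in Q.whitneyNhd, selectedExtension ψ f y ∈ Metric.closedBall (f x) (ε / 2) := by
    refine (convex_closedBall _ _).set_average_mem Metric.isClosed_closedBall
      Q.volume_whitneyNhd_ne_zero Q.volume_whitneyNhd_ne_top ?_ ?_
    · filter_upwards [ae_restrict_mem Q.isOpen_whitneyNhd.measurableSet] with y hy
      exact hclose y hy
    · have : IsFiniteMeasure (volume.restrict Q.whitneyNhd) :=
        isFiniteMeasure_restrict.2 Q.volume_whitneyNhd_ne_top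
      refine Integrable.of_bound ?_ (|f x| + ε / 2) ?_
      · exact ((hψ.contDiffOn_selectedExtension f).continuousOn.mono
          Q.whitneyNhd_subset).aestronglyMeasurable Q.isOpen_whitneyNhd.measurableSet
      · filter_upwards [ae_restrict_mem Q.isOpen_whitneyNhd.measurableSet] with y hy
        have h1 := hclose y hy
        have h2 := abs_sub_abs_le_abs_sub (selectedExtension ψ f y) (f x)
        rw [Real.norm_eq_abs]
        linarith
  rw [approxTrace_eq k _ hQlev hxQ]
  exact (Metric.mem_closedBall.1 hmem).trans_lt (by linarith)

/-! ### Existence of admissible families -/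

/-- The midpoint value gives the lower bound 1/2 for the bumps at the faces of a cube. -/
theorem smoothTransition_half : Real.smoothTransition (1 / 2) = 1 / 2 := by
  have h : 0 < expNegInvGlue (1 / 2) := expNegInvGlue.pos_of_pos (by norm_num)
  rw [Real.smoothTransition, show (1 : ℝ) - 1 / 2 = 1 / 2 by norm_num]
  field_simp
  norm_num

/-- The derivative is continuous and vanishes outside [0, 1], hence is bounded. -/
theorem exists_smoothTransition_lipschitz :
    ∃ M : ℝ, 0 ≤ M ∧ ∀ a b, |Real.smoothTransition a - Real.smoothTransition b| ≤ M * |a - b| := by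
  have hc : ContDiff ℝ 1 Real.smoothTransition := Real.smoothTransition.contDiff
  have hcont : Continuous (deriv Real.smoothTransition) := hc.continuous_deriv le_rfl
  have hzero : ∀ x, x ∉ Icc (0 : ℝ) 1 → deriv Real.smoothTransition x = 0 := by
    intro x hx
    obtain h | h : x < 0 ∨ 1 < x := by
      by_contra! h
      exact hx ⟨h.1, h.2⟩
    · have : Real.smoothTransition =ᶠ[𝓝 x] fun _ => 0 := by
        filter_upwards [gt_mem_nhds h] with y hy
        exact Real.smoothTransition.zero_of_nonpos hy.le
      rw [this.deriv_eq, deriv_const]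
    · have : Real.smoothTransition =ᶠ[𝓝 x] fun _ => 1 := by
        filter_upwards [lt_mem_nhds h] with y hy
        exact Real.smoothTransition.one_of_one_le hy.le
      rw [this.deriv_eq, deriv_const]
  obtain ⟨M, hM⟩ := isCompact_Icc.exists_bound_of_continuousOn
    (hcont.continuousOn (s := Icc (0 : ℝ) 1))
  have hM0 : 0 ≤ M := (norm_nonneg _).trans (hM 0 (by simp))
  refine ⟨M, hM0, fun a b => ?_⟩
  refine Convex.norm_image_sub_le_of_norm_deriv_le (s := univ)
    (fun x _ => (hc.differentiable one_ne_zero) x) (fun x _ => ?_) convex_univ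
    (mem_univ b) (mem_univ a)
  by_cases hx : x ∈ Icc (0 : ℝ) 1
  · exact hM x hx
  · rw [hzero x hx, norm_zero]
    exact hM0

theorem abs_prod_sub_prod_le {ι : Type*} (s : Finset ι) {a b : ι → ℝ}
    (ha : ∀ i, a i ∈ Icc (0 : ℝ) 1) (hb : ∀ i, b i ∈ Icc (0 : ℝ) 1) :
    |∏ i ∈ s, a i - ∏ i ∈ s, b i| ≤ ∑ i ∈ s, |a i - b i| := by
  classical
  induction s using Finset.induction_on with
  | empty => simp
  | insert i s hi ih =>
    rw [Finset.prod_insert hi, Finset.prod_insert hi, Finset.sum_insert hi]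
    have h1 : |∏ i ∈ s, a i| ≤ 1 := by
      rw [abs_of_nonneg (Finset.prod_nonneg fun i _ => (ha i).1)]
      exact Finset.prod_le_one (fun i _ => (ha i).1) fun i _ => (ha i).2
    have h2 : |b i| ≤ 1 := by
      rw [abs_of_nonneg (hb i).1]
      exact (hb i).2
    calc _ = |(a i - b i) * ∏ i ∈ s, a i + b i * (∏ i ∈ s, a i - ∏ i ∈ s, b i)| := by
          congr 1; ring
      _ ≤ |a i - b i| * |∏ i ∈ s, a i| + |b i| * |∏ i ∈ s, a i - ∏ i ∈ s, b i| := by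
          rw [← abs_mul, ← abs_mul]
          exact abs_add_le _ _
      _ ≤ |a i - b i| * 1 + 1 * ∑ i ∈ s, |a i - b i| := by gcongr
      _ = _ := by ring

/-! ### One-dimensional steps and bumps -/

/-- A smooth step from `0` to `1` near the origin, at scale `ε`. -/
def cellStep (ε s : ℝ) : ℝ := Real.smoothTransition (s / ε + 1 / 2)

/-- A smooth function near the indicator of the unit interval. -/
def cellBump (ε s : ℝ) : ℝ := cellStep ε s - cellStep ε (s - 1)

/-- A smooth step from `0` to `1` near the height `2⁻ᵏ`; for `k = 0` it vanishes up to `1`. -/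
def heightStep (ε : ℝ) (k : ℕ) (t : ℝ) : ℝ :=
  Real.smoothTransition ((2 ^ k * t - 1) / ε + if k = 0 then 0 else 1 / 2)

/-- A smooth function near the indicator of the heights between `2⁻ᵏ` and `2¹⁻ᵏ`. -/
def heightBump (ε : ℝ) (k : ℕ) (t : ℝ) : ℝ := heightStep ε k t - heightStep ε (k - 1) t

section

variable {ε : ℝ}

theorem cellStep_mono (hε : 0 < ε) : Monotone (cellStep ε) := fun a b h =>
  Real.smoothTransition.monotone (by gcongr)

theorem cellStep_eq_zero (hε : 0 < ε) {s : ℝ} (h : s ≤ -ε / 2) : cellStep ε s = 0 := by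
  refine Real.smoothTransition.zero_of_nonpos ?_
  have : s / ε ≤ -1 / 2 := by rw [div_le_iff₀ hε]; linarith
  linarith

theorem cellStep_eq_one (hε : 0 < ε) {s : ℝ} (h : ε / 2 ≤ s) : cellStep ε s = 1 := by
  refine Real.smoothTransition.one_of_one_le ?_
  have : 1 / 2 ≤ s / ε := by rw [le_div_iff₀ hε]; linarith
  linarith

theorem cellStep_zero : cellStep ε 0 = 1 / 2 := by
  rw [cellStep, zero_div, zero_add, smoothTransition_half]

theorem cellBump_mem_Icc (hε : 0 < ε) (s : ℝ) : cellBump ε s ∈ Icc (0 : ℝ) 1 := by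
  have h1 := cellStep_mono hε (show s - 1 ≤ s by linarith)
  have h2 : cellStep ε s ≤ 1 := Real.smoothTransition.le_one _
  have h3 : 0 ≤ cellStep ε (s - 1) := Real.smoothTransition.nonneg _
  constructor <;> unfold cellBump <;> linarith

theorem mem_Ioo_of_cellBump_ne_zero (hε : 0 < ε) {s : ℝ} (h : cellBump ε s ≠ 0) :
    -ε / 2 < s ∧ s < 1 + ε / 2 := by
  by_contra hs
  refine h ?_
  rw [not_and_or, not_lt, not_lt] at hs
  unfold cellBump
  obtain hs | hs := hs
  · rw [cellStep_eq_zero hε hs, cellStep_eq_zero hε (by linarith), sub_zero]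
  · rw [cellStep_eq_one hε (by linarith), cellStep_eq_one hε (by linarith), sub_self]

/-- The two transition zones do not overlap, so at every point one step is saturated and the other
is on the favorable side of 1/2. -/
theorem half_le_cellBump (hε : 0 < ε) (hε1 : ε ≤ 1) {s : ℝ} (h0 : 0 ≤ s) (h1 : s ≤ 1) :
    1 / 2 ≤ cellBump ε s := by
  unfold cellBump
  have a1 : 1 / 2 ≤ cellStep ε s := cellStep_zero.symm.trans_le (cellStep_mono hε h0)
  have a2 : cellStep ε (s - 1) ≤ 1 / 2 :=
    (cellStep_mono hε (show s - 1 ≤ 0 by linarith)).trans_eq cellStep_zero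
  obtain h | h := le_total (ε / 2) s
  · rw [cellStep_eq_one hε h]
    linarith
  · rw [cellStep_eq_zero hε (s := s - 1) (by linarith)]
    linarith

/-- The three integer translates of the cell bump that can be nonzero at `s`. -/
def cellFinset (s : ℝ) : Finset ℤ := {⌊s⌋ - 1, ⌊s⌋, ⌊s⌋ + 1}

theorem sum_cellBump (hε : 0 < ε) (hε1 : ε ≤ 1) (s : ℝ) :
    ∑ m ∈ cellFinset s, cellBump ε (s - m) = 1 := by
  have f1 := Int.floor_le s
  have f2 := Int.lt_floor_add_one s
  rw [cellFinset, Finset.sum_insert (by simp; omega), Finset.sum_insert (by simp),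
    Finset.sum_singleton]
  unfold cellBump
  push_cast
  -- The sum telescopes to the leftmost step, which is 1, minus the rightmost step, which is 0.
  rw [cellStep_eq_one hε (s := s - (⌊s⌋ - 1)) (by linarith),
    cellStep_eq_zero hε (s := s - (⌊s⌋ + 1) - 1) (by linarith),
    show s - ((⌊s⌋ : ℝ) - 1) - 1 = s - ⌊s⌋ by ring, show s - ((⌊s⌋ : ℝ) + 1) = s - ⌊s⌋ - 1 by ring]
  ring

theorem mem_cellFinset (hε : 0 < ε) (hε1 : ε ≤ 1) {s : ℝ} {m : ℤ} (h : cellBump ε (s - m) ≠ 0) :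
    m ∈ cellFinset s := by
  obtain ⟨h1, h2⟩ := mem_Ioo_of_cellBump_ne_zero hε h
  have f1 := Int.floor_le s
  have f2 := Int.lt_floor_add_one s
  have a1 : (m : ℝ) < ⌊s⌋ + 2 := by linarith
  have a2 : (⌊s⌋ : ℝ) < m + 2 := by linarith
  have b1 : m < ⌊s⌋ + 2 := by exact_mod_cast a1
  have b2 : ⌊s⌋ < m + 2 := by exact_mod_cast a2
  simp only [cellFinset, Finset.mem_insert, Finset.mem_singleton]
  omega

theorem heightStep_zero_eq_zero (hε : 0 < ε) {t : ℝ} (ht : t ≤ 1) : heightStep ε 0 t = 0 := by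
  refine Real.smoothTransition.zero_of_nonpos ?_
  rw [if_pos rfl, add_zero]
  exact div_nonpos_of_nonpos_of_nonneg (by simpa using ht) hε.le

theorem heightStep_eq_cellStep {k : ℕ} (hk : k ≠ 0) (t : ℝ) :
    heightStep ε k t = cellStep ε (2 ^ k * t - 1) := by
  rw [heightStep, if_neg hk, cellStep]

theorem heightStep_le_cellStep (k : ℕ) (t : ℝ) :
    heightStep ε k t ≤ cellStep ε (2 ^ k * t - 1) := by
  refine Real.smoothTransition.monotone ?_
  split_ifs <;> linarith

theorem heightBump_mem_Icc (hε : 0 < ε) {k : ℕ} (hk : 1 ≤ k) {t : ℝ} (ht : 0 < t) :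
    heightBump ε k t ∈ Icc (0 : ℝ) 1 := by
  have h2 : heightStep ε k t ≤ 1 := Real.smoothTransition.le_one _
  have h3 : 0 ≤ heightStep ε (k - 1) t := Real.smoothTransition.nonneg _
  have h4 : heightStep ε (k - 1) t ≤ heightStep ε k t := by
    rw [heightStep_eq_cellStep (k := k) (by omega)]
    refine (heightStep_le_cellStep _ _).trans (cellStep_mono hε ?_)
    gcongr
    · norm_num
    · omega
  constructor <;> unfold heightBump <;> linarith

theorem two_pow_pred_mul {k : ℕ} (hk : 1 ≤ k) (t : ℝ) :
    (2 : ℝ) ^ k * t = 2 * (2 ^ (k - 1) * t) := by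
  conv_lhs => rw [← Nat.sub_add_cancel hk, pow_succ]
  ring

/-- The upper margin is 2ε because the unshifted step of level zero reaches 1 only at height 1 + ε.
-/
theorem mem_Ioo_of_heightBump_ne_zero (hε : 0 < ε) {k : ℕ} (hk : 1 ≤ k) {t : ℝ} (ht : 0 < t)
    (h : heightBump ε k t ≠ 0) : 1 - ε / 2 < 2 ^ k * t ∧ 2 ^ k * t < 2 + 2 * ε := by
  have e := two_pow_pred_mul hk t
  have hpos : 0 < 2 ^ (k - 1) * t := by positivity
  by_contra hs
  refine h ?_
  rw [not_and_or, not_lt, not_lt] at hs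
  unfold heightBump
  obtain hs | hs := hs
  · have h1 : heightStep ε (k - 1) t ≤ 0 :=
      (heightStep_le_cellStep _ _).trans_eq (cellStep_eq_zero hε (by linarith))
    rw [heightStep_eq_cellStep (by omega), cellStep_eq_zero hε (by linarith),
      le_antisymm h1 (Real.smoothTransition.nonneg _), sub_zero]
  · have h1 : heightStep ε (k - 1) t = 1 := by
      refine Real.smoothTransition.one_of_one_le ?_
      have : 1 ≤ (2 ^ (k - 1) * t - 1) / ε := by rw [le_div_iff₀ hε]; linarith
      split_ifs <;> linarith
    rw [heightStep_eq_cellStep (by omega), cellStep_eq_one hε (by linarith), h1, sub_self]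

theorem half_le_heightBump (hε : 0 < ε) (hε1 : ε ≤ 1 / 2) {k : ℕ} (hk : 1 ≤ k) {t : ℝ}
    (h1 : 1 < 2 ^ k * t) (h2 : 2 ^ k * t ≤ 2) : 1 / 2 ≤ heightBump ε k t := by
  have e := two_pow_pred_mul hk t
  have a1 : 1 / 2 ≤ heightStep ε k t := by
    rw [heightStep_eq_cellStep (by omega)]
    exact cellStep_zero.symm.trans_le (cellStep_mono hε (by linarith))
  have a2 : heightStep ε (k - 1) t ≤ 1 / 2 := (heightStep_le_cellStep _ _).trans
    ((cellStep_mono hε (by linarith)).trans_eq cellStep_zero)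
  unfold heightBump
  obtain h | h := le_total (1 + ε / 2) (2 ^ k * t)
  · rw [heightStep_eq_cellStep (by omega), cellStep_eq_one hε (by linarith)]
    linarith
  · have : heightStep ε (k - 1) t ≤ 0 :=
      (heightStep_le_cellStep _ _).trans_eq (cellStep_eq_zero hε (by linarith))
    linarith

end

/-! ### Product bumps on Whitney cubes -/

/-- The product bump function of a cube. -/
def cubeBump {d : ℕ} (ε : ℝ) (Q : DyadicCube d) (x : EuclideanSpace ℝ (Fin (d + 1))) : ℝ :=
  heightBump ε Q.level (x (Fin.last d)) *
    ∏ i : Fin d, cellBump ε (2 ^ Q.level * x i.castSucc - Q.idx i)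

theorem contDiff_cubeBump {d : ℕ} (ε : ℝ) (Q : DyadicCube d) : ContDiff ℝ ∞ (cubeBump ε Q) := by
  have hT : ContDiff ℝ ∞ Real.smoothTransition := Real.smoothTransition.contDiff
  have hcell : ContDiff ℝ ∞ (cellBump ε) := by
    unfold cellBump cellStep
    exact (hT.comp (by fun_prop)).sub (hT.comp (by fun_prop))
  have hheight : ContDiff ℝ ∞ (heightBump ε Q.level) := by
    unfold heightBump heightStep
    exact (hT.comp (by fun_prop)).sub (hT.comp (by fun_prop))
  unfold cubeBump
  refine ContDiff.mul (hheight.comp (by fun_prop)) (contDiff_prod fun i _ => ?_)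
  exact hcell.comp (by fun_prop)

theorem two_pow_mul_len {d : ℕ} (Q : DyadicCube d) : 2 ^ Q.level * Q.len = 1 := by
  rw [DyadicCube.len, ← mul_pow]
  norm_num

theorem abs_cubeBump_sub_le {d : ℕ} {ε M : ℝ} (hε : 0 < ε) (hM0 : 0 ≤ M)
    (hM : ∀ a b, |Real.smoothTransition a - Real.smoothTransition b| ≤ M * |a - b|)
    {Q : DyadicCube d} (hQ : 1 ≤ Q.level) {x y : EuclideanSpace ℝ (Fin (d + 1))}
    (hx : x ∈ upperHalf d) :
    |cubeBump ε Q x - cubeBump ε Q y| ≤ (d + 1) * (2 * M / ε) / Q.len * dist x y := by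
  have hcellStep : ∀ a b, |cellStep ε a - cellStep ε b| ≤ M / ε * |a - b| := by
    intro a b
    refine (hM _ _).trans_eq ?_
    rw [show a / ε + 1 / 2 - (b / ε + 1 / 2) = (a - b) / ε by ring, abs_div, abs_of_pos hε]
    ring
  have hcell : ∀ a b, |cellBump ε a - cellBump ε b| ≤ 2 * M / ε * |a - b| := by
    intro a b
    have h1 := hcellStep a b
    have h2 := hcellStep (a - 1) (b - 1)
    rw [show a - 1 - (b - 1) = a - b by ring] at h2
    calc _ = |(cellStep ε a - cellStep ε b) - (cellStep ε (a - 1) - cellStep ε (b - 1))| := by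
          unfold cellBump; congr 1; ring
      _ ≤ _ := abs_sub _ _
      _ ≤ M / ε * |a - b| + M / ε * |a - b| := add_le_add h1 h2
      _ = _ := by ring
  have hstep : ∀ (k : ℕ) (a b : ℝ), |heightStep ε k a - heightStep ε k b| ≤
      M / ε * (2 ^ k * |a - b|) := by
    intro k a b
    refine (hM _ _).trans_eq ?_
    rw [add_sub_add_right_eq_sub, ← sub_div, abs_div, abs_of_pos hε,
      show 2 ^ k * a - 1 - (2 ^ k * b - 1) = 2 ^ k * (a - b) by ring, abs_mul,
      abs_of_pos (show (0 : ℝ) < 2 ^ k by positivity)]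
    ring
  have hheight : ∀ a b, |heightBump ε Q.level a - heightBump ε Q.level b| ≤
      2 * M / ε * (2 ^ Q.level * |a - b|) := by
    intro a b
    have h1 := hstep Q.level a b
    have h2 := hstep (Q.level - 1) a b
    have h3 : (2 : ℝ) ^ (Q.level - 1) ≤ 2 ^ Q.level :=
      pow_le_pow_right₀ (by norm_num) (by omega)
    calc _ = |(heightStep ε Q.level a - heightStep ε Q.level b) -
          (heightStep ε (Q.level - 1) a - heightStep ε (Q.level - 1) b)| := by
          unfold heightBump; congr 1; ring
      _ ≤ _ := abs_sub _ _
      _ ≤ M / ε * (2 ^ Q.level * |a - b|) + M / ε * (2 ^ Q.level * |a - b|) := by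
          refine add_le_add h1 (h2.trans ?_)
          gcongr
      _ = _ := by ring
  have hlen : (1 : ℝ) / Q.len = 2 ^ Q.level := by
    rw [div_eq_iff Q.len_pos.ne', two_pow_mul_len]
  have hprod : |∏ i : Fin d, cellBump ε (2 ^ Q.level * x i.castSucc - Q.idx i) -
      ∏ i : Fin d, cellBump ε (2 ^ Q.level * y i.castSucc - Q.idx i)| ≤
      d * (2 * M / ε * (2 ^ Q.level * dist x y)) := by
    refine (abs_prod_sub_prod_le _ (fun i => cellBump_mem_Icc hε _)
      fun i => cellBump_mem_Icc hε _).trans ?_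
    refine (Finset.sum_le_card_nsmul _ _ (2 * M / ε * (2 ^ Q.level * dist x y))
      fun i _ => ?_).trans_eq (by simp)
    refine (hcell _ _).trans ?_
    rw [show 2 ^ Q.level * x i.castSucc - Q.idx i - (2 ^ Q.level * y i.castSucc - Q.idx i) =
      2 ^ Q.level * (x i.castSucc - y i.castSucc) by ring, abs_mul,
      abs_of_pos (show (0 : ℝ) < 2 ^ Q.level by positivity)]
    have := abs_coord_le_dist x y i.castSucc
    gcongr
  have hh : |heightBump ε Q.level (x (Fin.last d)) - heightBump ε Q.level (y (Fin.last d))| ≤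
      2 * M / ε * (2 ^ Q.level * dist x y) := by
    refine (hheight _ _).trans ?_
    have := abs_coord_le_dist x y (Fin.last d)
    gcongr
  have hhx := heightBump_mem_Icc hε hQ hx
  have hpy : (∏ i : Fin d, cellBump ε (2 ^ Q.level * y i.castSucc - Q.idx i)) ∈ Icc (0 : ℝ) 1 :=
    ⟨Finset.prod_nonneg fun i _ => (cellBump_mem_Icc hε _).1,
      Finset.prod_le_one (fun i _ => (cellBump_mem_Icc hε _).1)
        fun i _ => (cellBump_mem_Icc hε _).2⟩
  unfold cubeBump
  set a := heightBump ε Q.level (x (Fin.last d))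
  set a' := heightBump ε Q.level (y (Fin.last d))
  set b := ∏ i : Fin d, cellBump ε (2 ^ Q.level * x i.castSucc - Q.idx i)
  set b' := ∏ i : Fin d, cellBump ε (2 ^ Q.level * y i.castSucc - Q.idx i)
  -- In this splitting the bound on the height bump is needed only at `x`, where the height is known
  -- to be positive.
  calc |a * b - a' * b'| = |a * (b - b') + (a - a') * b'| := by congr 1; ring
    _ ≤ |a| * |b - b'| + |a - a'| * |b'| := by
        rw [← abs_mul, ← abs_mul]; exact abs_add_le _ _
    _ ≤ 1 * (d * (2 * M / ε * (2 ^ Q.level * dist x y))) +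
          2 * M / ε * (2 ^ Q.level * dist x y) * 1 := by
        rw [abs_of_nonneg hhx.1, abs_of_nonneg hpy.1]
        gcongr
        · exact hhx.2
        · exact hpy.1
        · exact hpy.2
    _ = (d + 1) * (2 * M / ε) * 2 ^ Q.level * dist x y := by ring
    _ = _ := by rw [← hlen]; ring

/-- Clamping to [a + r, b] instead of [a, b] keeps the point strictly to the right of `a`, as the
half-open cubes require. -/
theorem abs_clamp_sub_le {y a b r : ℝ} (hr : 0 ≤ r) (hab : a + r ≤ b) (h1 : a - 2 * r ≤ y)
    (h2 : y ≤ b + 2 * r) :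
    |y - min (max y (a + r)) b| ≤ 3 * r ∧ a + r ≤ min (max y (a + r)) b := by
  refine ⟨?_, le_min (le_max_right _ _) hab⟩
  rw [abs_le]
  constructor
  · have : min (max y (a + r)) b ≤ y + 3 * r :=
      (min_le_left _ _).trans (max_le (by linarith) (by linarith))
    linarith
  · have : y - 2 * r ≤ min (max y (a + r)) b :=
      le_min ((by linarith : y - 2 * r ≤ y).trans (le_max_left _ _)) (by linarith)
    linarith

theorem closure_support_cubeBump_subset {d : ℕ} {ε : ℝ} (hε : 0 < ε)
    (hεd : 16 * (d + 1) * ε ≤ 1) {Q : DyadicCube d} (hQ : 1 ≤ Q.level) :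
    closure {x | x ∈ upperHalf d ∧ cubeBump ε Q x ≠ 0} ⊆ Q.whitneyNhd := by
  have hlen := Q.len_pos
  have h2 := two_pow_mul_len Q
  have hd0 : (0 : ℝ) ≤ d := by positivity
  have hε16 : ε ≤ 1 / 16 := by nlinarith
  have hscale : ∀ a b : ℝ, a < 2 ^ Q.level * b → Q.len * a < b := fun a b h => by
    calc Q.len * a < Q.len * (2 ^ Q.level * b) := mul_lt_mul_of_pos_left h hlen
      _ = 2 ^ Q.level * Q.len * b := by ring
      _ = b := by rw [h2, one_mul]
  have hscale' : ∀ a b : ℝ, 2 ^ Q.level * b < a → b < Q.len * a := fun a b h => by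
    calc b = 2 ^ Q.level * Q.len * b := by rw [h2, one_mul]
      _ = Q.len * (2 ^ Q.level * b) := by ring
      _ < Q.len * a := mul_lt_mul_of_pos_left h hlen
  set r : ℝ := Q.len * ε with hr
  have hr0 : 0 < r := by positivity
  have hr1 : r ≤ Q.len / 16 := by nlinarith
  have hbox : closure {x | x ∈ upperHalf d ∧ cubeBump ε Q x ≠ 0} ⊆
      {x | (∀ i : Fin d, x i.castSucc ∈
          Icc (Q.len * Q.idx i - 2 * r) (Q.len * (Q.idx i + 1) + 2 * r)) ∧
        x (Fin.last d) ∈ Icc (Q.len - 2 * r) (2 * Q.len + 2 * r)} := by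
    refine closure_minimal ?_ ?_
    · rintro x ⟨hx, hne⟩
      have hh := mem_Ioo_of_heightBump_ne_zero hε hQ hx (left_ne_zero_of_mul hne)
      have hc := fun i => mem_Ioo_of_cellBump_ne_zero hε
        (Finset.prod_ne_zero_iff.1 (right_ne_zero_of_mul hne) i (Finset.mem_univ i))
      refine ⟨fun i => ?_, ?_⟩
      · have c1 := hscale (Q.idx i - ε / 2) (x i.castSucc) (by linarith [(hc i).1])
        have c2 := hscale' (Q.idx i + 1 + ε / 2) (x i.castSucc) (by linarith [(hc i).2])
        constructor <;> linarith
      · have c1 := hscale _ _ hh.1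
        have c2 := hscale' _ _ hh.2
        constructor <;> linarith
    · have h1 : IsClosed {x : EuclideanSpace ℝ (Fin (d + 1)) | ∀ i : Fin d, x i.castSucc ∈
          Icc (Q.len * Q.idx i - 2 * r) (Q.len * (Q.idx i + 1) + 2 * r)} := by
        have e : {x : EuclideanSpace ℝ (Fin (d + 1)) | ∀ i : Fin d, x i.castSucc ∈
            Icc (Q.len * Q.idx i - 2 * r) (Q.len * (Q.idx i + 1) + 2 * r)} =
            ⋂ i : Fin d, (fun x : EuclideanSpace ℝ (Fin (d + 1)) => x i.castSucc) ⁻¹'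
              Icc (Q.len * Q.idx i - 2 * r) (Q.len * (Q.idx i + 1) + 2 * r) := by
          ext x
          simp only [mem_iInter, mem_preimage, mem_ofPred_eq]
        rw [e]
        exact isClosed_iInter fun i => isClosed_Icc.preimage (by fun_prop)
      exact h1.inter (isClosed_Icc.preimage
        (show Continuous fun x : EuclideanSpace ℝ (Fin (d + 1)) => x (Fin.last d) by fun_prop))
  refine hbox.trans ?_
  rintro y ⟨hy1, hy2⟩
  have hc := fun i : Fin d => abs_clamp_sub_le hr0.le
    (show Q.len * Q.idx i + r ≤ Q.len * (Q.idx i + 1) by linarith) (hy1 i).1 (hy1 i).2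
  have hl := abs_clamp_sub_le hr0.le (show Q.len + r ≤ 2 * Q.len by linarith) hy2.1 hy2.2
  refine ⟨show 0 < y (Fin.last d) by linarith [hy2.1], ?_⟩
  let w : EuclideanSpace ℝ (Fin (d + 1)) := WithLp.toLp 2 (Fin.lastCases (motive := fun _ => ℝ)
    (min (max (y (Fin.last d)) (Q.len + r)) (2 * Q.len)) fun i =>
      min (max (y i.castSucc) (Q.len * Q.idx i + r)) (Q.len * (Q.idx i + 1)))
  have hw1 : ∀ i : Fin d, w i.castSucc =
      min (max (y i.castSucc) (Q.len * Q.idx i + r)) (Q.len * (Q.idx i + 1)) := fun i => by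
    simp [w]
  have hw2 : w (Fin.last d) = min (max (y (Fin.last d)) (Q.len + r)) (2 * Q.len) := by
    simp [w]
  have hw : w ∈ Q.whitney := by
    refine ⟨fun i => ?_, ?_, ?_⟩
    · simp only [hw1]
      exact ⟨by linarith [(hc i).2], min_le_right _ _⟩
    · rw [hw2]; linarith [hl.2]
    · rw [hw2]; exact min_le_right _ _
  -- The clamped point is within 3(d + 1)ε ℓ ≤ 3ℓ/16 < ℓ/4.
  refine (Metric.infDist_le_dist_of_mem hw).trans_lt ?_
  refine (dist_le_of_abs_coord_le (r := 3 * r) (by positivity) fun i => ?_).trans_lt ?_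
  · induction i using Fin.lastCases with
    | last => rw [hw2]; exact hl.1
    | cast i => rw [hw1]; exact (hc i).1
  · push_cast
    have : 16 * (d + 1) * ε * Q.len ≤ 1 * Q.len := mul_le_mul_of_nonneg_right hεd hlen.le
    nlinarith

/-- For a fixed level the cell bumps sum to 1 and only the height bump remains. The height bumps
telescope from the step of level zero, which vanishes up to height one, to a step of high level,
which equals 1. -/
theorem hasSum_cubeBump {d : ℕ} {ε : ℝ} (hε : 0 < ε) (hε1 : ε ≤ 1)
    {x : EuclideanSpace ℝ (Fin (d + 1))} (hx0 : x ∈ upperHalf d) (hx : x (Fin.last d) ≤ 1) :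
    HasSum (fun Q : FineCube d => cubeBump ε Q.1 x) 1 := by
  classical
  have ht : 0 < x (Fin.last d) := hx0
  let e : (Σ _ : ℕ, Fin d → ℤ) ≃ FineCube d :=
    { toFun := fun q => ⟨⟨q.1 + 1, q.2⟩, by simp⟩
      invFun := fun Q => ⟨Q.1.level - 1, Q.1.idx⟩
      left_inv := fun _ => rfl
      right_inv := by
        rintro ⟨⟨k, m⟩, hk⟩
        simp only at hk
        simp only [Subtype.mk.injEq, DyadicCube.mk.injEq, and_true]
        omega }
  rw [← e.hasSum_iff]
  obtain ⟨n, hn⟩ : ∃ n : ℕ, 2 / x (Fin.last d) < 2 ^ n := pow_unbounded_of_one_lt _ (by norm_num)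
  have hone : ∀ k, n < k → heightStep ε k (x (Fin.last d)) = 1 := by
    intro k hk
    rw [heightStep_eq_cellStep (by omega)]
    refine cellStep_eq_one hε ?_
    have h1 : (2 : ℝ) ^ n ≤ 2 ^ k := pow_le_pow_right₀ (by norm_num) hk.le
    have h2 : 2 < 2 ^ n * x (Fin.last d) := (div_lt_iff₀ ht).1 hn
    nlinarith
  let s : Finset (Σ _ : ℕ, Fin d → ℤ) := (Finset.range (n + 1)).sigma fun k =>
    Fintype.piFinset fun i => cellFinset (2 ^ (k + 1) * x i.castSucc)
  have hsum : ∑ q ∈ s, ((fun Q : FineCube d => cubeBump ε Q.1 x) ∘ e) q = 1 := by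
    rw [Finset.sum_sigma]
    have hk : ∀ k : ℕ, ∑ m ∈ Fintype.piFinset
        (fun i : Fin d => cellFinset (2 ^ (k + 1) * x i.castSucc)),
        ((fun Q : FineCube d => cubeBump ε Q.1 x) ∘ e) ⟨k, m⟩ =
        heightStep ε (k + 1) (x (Fin.last d)) - heightStep ε k (x (Fin.last d)) := by
      intro k
      have : ∀ m : Fin d → ℤ, ((fun Q : FineCube d => cubeBump ε Q.1 x) ∘ e) ⟨k, m⟩ =
          heightBump ε (k + 1) (x (Fin.last d)) *
            ∏ i : Fin d, cellBump ε (2 ^ (k + 1) * x i.castSucc - m i) := fun m => rfl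
      simp only [this]
      rw [← Finset.mul_sum, ← Finset.prod_univ_sum
        (fun i => cellFinset (2 ^ (k + 1) * x i.castSucc))
        (fun (i : Fin d) (m : ℤ) => cellBump ε (2 ^ (k + 1) * x i.castSucc - m)),
        Finset.prod_congr rfl fun i _ => sum_cellBump hε hε1 _, Finset.prod_const_one, mul_one]
      rfl
    rw [Finset.sum_congr rfl fun k _ => hk k, Finset.sum_range_sub
      (fun k => heightStep ε k (x (Fin.last d))), hone _ (by omega),
      heightStep_zero_eq_zero hε hx, sub_zero]
  rw [← hsum]
  refine hasSum_sum_of_ne_finset_zero ?_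
  rintro ⟨k, m⟩ hq
  by_contra hne
  have hne' : heightBump ε (k + 1) (x (Fin.last d)) *
    ∏ i : Fin d, cellBump ε (2 ^ (k + 1) * x i.castSucc - m i) ≠ 0 := hne
  refine hq (Finset.mem_sigma.2 ⟨Finset.mem_range.2 ?_, Fintype.mem_piFinset.2 fun i => ?_⟩)
  · by_contra! hk
    have hk' : n + 1 ≤ k := hk
    refine left_ne_zero_of_mul hne' ?_
    rw [heightBump, hone _ (by omega), hone _ (by omega), sub_self]
  · exact mem_cellFinset hε hε1
      (Finset.prod_ne_zero_iff.1 (right_ne_zero_of_mul hne') i (Finset.mem_univ i))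

theorem exists_isWhitneyPartition (d : ℕ) :
    ∃ (L : ℝ≥0) (c : ℝ) (ψ : FineCube d → EuclideanSpace ℝ (Fin (d + 1)) → ℝ),
      IsWhitneyPartition L c ψ := by
  obtain ⟨M, hM0, hM⟩ := exists_smoothTransition_lipschitz
  -- Of order 1/d so that the d + 1 coordinate errors together stay below a quarter of the edge
  -- length.
  set ε : ℝ := 1 / (16 * (d + 1)) with hεdef
  have hd0 : (0 : ℝ) ≤ d := by positivity
  have hε : 0 < ε := by positivity
  have hεd : 16 * (d + 1) * ε ≤ 1 := by rw [hεdef]; field_simp; rfl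
  have hε16 : ε ≤ 1 / 16 := by nlinarith
  refine ⟨⟨(d + 1) * (2 * M / ε), by positivity⟩, 1 / 2 * (1 / 2) ^ d,
    fun Q => cubeBump ε Q.1, ?_⟩
  refine ⟨fun Q => (contDiff_cubeBump ε Q.1).contDiffOn, fun Q x hx => ?_,
    fun Q x hx y _ => abs_cubeBump_sub_le hε hM0 hM Q.2 hx, by positivity,
    fun Q x hx => ?_, fun Q => closure_support_cubeBump_subset hε hεd Q.2, fun x hx => ?_⟩
  · have h1 := heightBump_mem_Icc hε Q.2 hx
    have h2 : ∀ i : Fin d, cellBump ε (2 ^ Q.1.level * x i.castSucc - Q.1.idx i) ∈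
      Icc (0 : ℝ) 1 := fun i => cellBump_mem_Icc hε _
    exact ⟨mul_nonneg h1.1 (Finset.prod_nonneg fun i _ => (h2 i).1),
      mul_le_one₀ h1.2 (Finset.prod_nonneg fun i _ => (h2 i).1)
        (Finset.prod_le_one (fun i _ => (h2 i).1) fun i _ => (h2 i).2)⟩
  · have h2 := two_pow_mul_len Q.1
    have hp : (0 : ℝ) < 2 ^ Q.1.level := by positivity
    obtain ⟨a1, a2, a3⟩ := hx
    refine mul_le_mul (half_le_heightBump hε (by linarith) Q.2 (by nlinarith) (by nlinarith)) ?_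
      (by positivity) (heightBump_mem_Icc hε Q.2 (Q.1.len_pos.trans a2)).1
    calc ((1 : ℝ) / 2) ^ d = ∏ _i : Fin d, (1 : ℝ) / 2 := by simp
      _ ≤ _ := by
        refine Finset.prod_le_prod (fun _ _ => by norm_num) fun i _ => ?_
        obtain ⟨b1, b2⟩ := a1 i
        simp only at b1 b2
        have c1 := mul_lt_mul_of_pos_left b1 hp
        have c2 := mul_le_mul_of_nonneg_left b2 hp.le
        rw [← mul_assoc, h2, one_mul] at c1 c2
        exact half_le_cellBump hε (by linarith) (by linarith) (by linarith)
  · obtain ⟨Q, hQ⟩ := mem_iUnion.1 hx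
    refine hasSum_cubeBump hε (by linarith) (Q.1.len_pos.trans hQ.2.1) ?_
    have h2 : Q.1.len ≤ 2⁻¹ ^ 1 := pow_le_pow_of_le_one (by norm_num) (by norm_num) Q.2
    linarith [hQ.2.2]

/-! ### Linearity -/

theorem cubeAvg_congr_ae {d : ℕ} {f g : EuclideanSpace ℝ (Fin d) → ℝ} (h : f =ᵐ[volume] g)
    (Q : DyadicCube d) : cubeAvg f Q = cubeAvg g Q :=
  average_congr (ae_restrict_of_ae h)

theorem cubeAvg_linear {d : ℕ} {f g : EuclideanSpace ℝ (Fin d) → ℝ}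
    (hf : LocallyIntegrable f volume) (hg : LocallyIntegrable g volume) (a b : ℝ)
    (Q : DyadicCube d) : cubeAvg (a • f + b • g) Q = a * cubeAvg f Q + b * cubeAvg g Q := by
  have hf' : Integrable (fun x => a * f x) (volume.restrict Q.toSet) :=
    (Q.integrableOn_toSet hf).const_mul a
  have hg' : Integrable (fun x => b * g x) (volume.restrict Q.toSet) :=
    (Q.integrableOn_toSet hg).const_mul b
  simp only [cubeAvg, setAverage_eq, Pi.add_apply, Pi.smul_apply, smul_eq_mul]
  rw [integral_add hf' hg', integral_const_mul, integral_const_mul]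
  ring

theorem enorm_linear_rpow_le {p : ℝ} (hp : 1 ≤ p) (a b x y : ℝ) :
    ‖a * x + b * y‖ₑ ^ p ≤ 2 ^ (p - 1) * ‖a‖ₑ ^ p * ‖x‖ₑ ^ p +
      2 ^ (p - 1) * ‖b‖ₑ ^ p * ‖y‖ₑ ^ p := by
  have hp0 : 0 ≤ p := by linarith
  calc ‖a * x + b * y‖ₑ ^ p ≤ (‖a * x‖ₑ + ‖b * y‖ₑ) ^ p := by
        gcongr
        exact enorm_add_le _ _
    _ ≤ 2 ^ (p - 1) * (‖a * x‖ₑ ^ p + ‖b * y‖ₑ ^ p) :=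
        ENNReal.rpow_add_le_mul_rpow_add_rpow _ _ hp
    _ = _ := by
        rw [enorm_mul, enorm_mul, ENNReal.mul_rpow_of_nonneg _ _ hp0,
          ENNReal.mul_rpow_of_nonneg _ _ hp0]
        ring

theorem besovEnergy_linear_le {d : ℕ} {p : ℝ} (hp : 1 ≤ p) (lam : ℝ)
    {f g : EuclideanSpace ℝ (Fin d) → ℝ} (hf : LocallyIntegrable f volume)
    (hg : LocallyIntegrable g volume) (a b : ℝ) :
    besovEnergy p lam (a • f + b • g) ≤ 2 ^ (p - 1) * ‖a‖ₑ ^ p * besovEnergy p lam f +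
      2 ^ (p - 1) * ‖b‖ₑ ^ p * besovEnergy p lam g := by
  have hp0 : 0 ≤ p := by linarith
  unfold besovEnergy
  simp only [← ENNReal.tsum_mul_left, ← ENNReal.tsum_add]
  refine ENNReal.tsum_le_tsum fun j => ENNReal.tsum_le_tsum fun Q =>
    ENNReal.tsum_le_tsum fun Q' => ?_
  rw [ofReal_abs_rpow hp0, ofReal_abs_rpow hp0, ofReal_abs_rpow hp0, cubeAvg_linear hf hg,
    cubeAvg_linear hf hg, show a * cubeAvg f Q.1 + b * cubeAvg g Q.1 -
      (a * cubeAvg f Q'.1 + b * cubeAvg g Q'.1) = a * (cubeAvg f Q.1 - cubeAvg f Q'.1) +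
        b * (cubeAvg g Q.1 - cubeAvg g Q'.1) by ring]
  set w := ENNReal.ofReal (((2 : ℝ) ^ j + 2) ^ lam)
  calc _ ≤ w * (volume Q.1.toSet * (_ + _)) :=
        mul_le_mul_right (mul_le_mul_right (enorm_linear_rpow_le hp a b _ _) _) _
    _ = _ := by ring

theorem memBesov_iff {d : ℕ} {p lam : ℝ} (hp : 0 < p) {f : EuclideanSpace ℝ (Fin d) → ℝ} :
    MemBesov p lam f ↔ LocallyIntegrable f volume ∧
      eLpNorm f (ENNReal.ofReal p) volume < ⊤ ∧ besovEnergy p lam f < ⊤ := by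
  rw [MemBesov, besovNorm, ENNReal.add_lt_top, ENNReal.rpow_lt_top_iff_of_pos (by positivity)]

theorem MemBesov.linear {d : ℕ} {p lam : ℝ} (hp : 1 ≤ p)
    {f g : EuclideanSpace ℝ (Fin d) → ℝ} (hf : MemBesov p lam f) (hg : MemBesov p lam g)
    (a b : ℝ) : MemBesov p lam (a • f + b • g) := by
  have hp0 : 0 < p := by linarith
  rw [memBesov_iff hp0] at hf hg ⊢
  obtain ⟨hf1, hf2, hf3⟩ := hf
  obtain ⟨hg1, hg2, hg3⟩ := hg
  refine ⟨(hf1.smul a).add (hg1.smul b), ?_, ?_⟩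
  · have hfm : MemLp f (ENNReal.ofReal p) volume := ⟨hf1.aestronglyMeasurable, hf2⟩
    have hgm : MemLp g (ENNReal.ofReal p) volume := ⟨hg1.aestronglyMeasurable, hg2⟩
    exact ((hfm.const_smul a).add (hgm.const_smul b)).2
  · refine (besovEnergy_linear_le hp lam hf1 hg1 a b).trans_lt ?_
    have hc : ∀ e : ℝ, (2 : ℝ≥0∞) ^ (p - 1) * ‖e‖ₑ ^ p < ⊤ := fun e =>
      ENNReal.mul_lt_top (ENNReal.rpow_lt_top_of_nonneg (by linarith) (by norm_num))
        (ENNReal.rpow_lt_top_of_nonneg hp0.le enorm_ne_top)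
    exact ENNReal.add_lt_top.2 ⟨ENNReal.mul_lt_top (hc a) hf3, ENNReal.mul_lt_top (hc b) hg3⟩

/-- Near every point the series is a finite sum or zero, so linearity of the averages passes through
it with no summability question. -/
theorem IsWhitneyPartition.selectedExtension_linear {d : ℕ} {L : ℝ≥0} {c : ℝ}
    {ψ : FineCube d → EuclideanSpace ℝ (Fin (d + 1)) → ℝ} (hψ : IsWhitneyPartition L c ψ)
    {f g : EuclideanSpace ℝ (Fin d) → ℝ} (hf : LocallyIntegrable f volume)
    (hg : LocallyIntegrable g volume) (a b : ℝ) {x : EuclideanSpace ℝ (Fin (d + 1))}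
    (hx : x ∈ upperHalf d) : selectedExtension ψ (a • f + b • g) x =
      a * selectedExtension ψ f x + b * selectedExtension ψ g x := by
  by_cases h2 : x (Fin.last d) ≤ 2
  · obtain ⟨P, hP⟩ := exists_mem_whitney hx h2
    have hxN := P.whitney_subset_whitneyNhd hP
    simp only [hψ.selectedExtension_eq_sum _ hxN, Finset.mul_sum, ← Finset.sum_add_distrib]
    refine Finset.sum_congr rfl fun Q _ => ?_
    rw [cubeAvg_linear hf hg]
    ring
  · have h9 : 9 / 8 < x (Fin.last d) := by linarith
    simp only [hψ.selectedExtension_eq_zero _ h9, mul_zero, add_zero]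

end

end SelectedWhitney

/-! ### The main theorem -/

open SelectedWhitney in
theorem theorem1p4 (d : ℕ) (hd : 1 ≤ d) (p lam : ℝ) (hp : (p, lam) ∈ Gamma) :
    -- admissible families of bump functions exist
    (∃ (L : ℝ≥0) (c : ℝ) (ψ : FineCube d → EuclideanSpace ℝ (Fin (d + 1)) → ℝ),
      IsWhitneyPartition L c ψ) ∧
    -- for each of them the selected Whitney extension has the asserted properties
    (∀ (L : ℝ≥0) (c : ℝ), ∃ C : ℝ≥0,
      ∀ ψ : FineCube d → EuclideanSpace ℝ (Fin (d + 1)) → ℝ, IsWhitneyPartition L c ψ →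
        -- it depends only on the almost everywhere class of the function
        (∀ f g : EuclideanSpace ℝ (Fin d) → ℝ, f =ᵐ[volume] g →
          ∀ x ∈ upperHalf d, selectedExtension ψ f x = selectedExtension ψ g x) ∧
        -- it is linear on the Besov-type space, which is a linear space
        (∀ f g : EuclideanSpace ℝ (Fin d) → ℝ, MemBesov p lam f → MemBesov p lam g →
          ∀ a b : ℝ, MemBesov p lam (a • f + b • g) ∧
            ∀ x ∈ upperHalf d, selectedExtension ψ (a • f + b • g) x =
              a * selectedExtension ψ f x + b * selectedExtension ψ g x) ∧
        -- it maps boundedly into the weighted Sobolev space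
        (∀ f : EuclideanSpace ℝ (Fin d) → ℝ, MemBesov p lam f →
          MemSobolev p (p - 1) lam (selectedExtension ψ f) ∧
            sobolevNorm p (p - 1) lam (selectedExtension ψ f) ≤ C * besovNorm p lam f) ∧
        -- the trace is a left inverse
        (∀ f : EuclideanSpace ℝ (Fin d) → ℝ, MemBesov p lam f →
          HasTrace (selectedExtension ψ f) f)) := by
  -- Both branches of Γ give p ≥ 1 and λ ≥ 0, the form in which the parameters enter the estimates.
  obtain ⟨h1, hlam⟩ : 1 ≤ p ∧ 0 ≤ lam := by
    obtain ⟨h, h'⟩ | ⟨h, h'⟩ := hp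
    · simp only at h h'
      exact ⟨h.le, by linarith⟩
    · exact ⟨h.ge, h'⟩
  refine ⟨exists_isWhitneyPartition d, fun L c => ?_⟩
  obtain ⟨C, hC⟩ := exists_sobolevNorm_selectedExtension_le hd h1 hlam L
  refine ⟨C, fun ψ hψ => ⟨fun f g hfg x _ => ?_, fun f g hf hg a b => ⟨hf.linear h1 hg a b,
    fun x hx => hψ.selectedExtension_linear hf.1 hg.1 a b hx⟩, fun f hf => ?_,
    fun f hf => hψ.hasTrace hf.1⟩⟩
  · simp only [selectedExtension, cubeAvg_congr_ae hfg]
  · have hle := hC c ψ hψ f hf.1.aestronglyMeasurable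
    have hsm := hψ.contDiffOn_selectedExtension f
    exact ⟨⟨hsm.continuousOn.locallyIntegrableOn (isOpen_upperHalf d).measurableSet,
      ⟨_, isWeakGradient_gradient hsm⟩,
      hle.trans_lt (ENNReal.mul_lt_top ENNReal.coe_lt_top hf.2)⟩, hle⟩
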